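/- Let $(M^n,g)$ be a smooth compact Riemannian manifold without boundary, $n\ge 3$, let $1\le k\le n$, and let $\gamma,s,r\in\mathbb R$ with $\gamma\ge 0$. For $\lambda\in\mathbb R^n$ let $\sigma_j(\lambda)$ be the $j$-th elementary symmetric function and $\Gamma_k=\{\lambda\in\mathbb R^n:\sigma_j(\lambda)>0,\ j=1,\dots,k\}$. Let $A$ be a smooth symmetric $(0,2)$-tensor on $M$ whose eigenvalues with respect to $g$ satisfy $\lambda(g^{-1}A)\in\Gamma_k$, and for a function $u$ put $$W[u]=g^{-1}\Big(\nabla^2u+s\,du\otimes du+\big(\gamma\Delta u-\tfrac r2|\nabla u|^2\big)g+A\Big),\qquad E_u=u_{tt}W[u]-g^{-1}du_t\otimes du_t,$$ where $\nabla$, $\nabla^2$, $\Delta$ are the gradient, Hessian and Laplace-Beltrami operator of $g$ in the space variable. Write $\sigma_k(W)=\sigma_k(\lambda(W))$ and $\sigma_k^{ij}(W)=\partial\sigma_k(W)/\partial W_{ij}$ (components in $g$-orthonormal frames). Let $\psi$ be a smooth positive function on $M\times[0,1]$ and let $u_0,u_1$ be smooth functions on $M$ with $\lambda(W[u_0]),\lambda(W[u_1])\in\Gamma_k$.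 Let $u\in C^3(M\times(0,1))\cap C^1(M\times[0,1])$ be an admissible solution of the Dirichlet problem $$u_{tt}\,\sigma_k(W[u])-\sigma_k^{ij}(W[u])\,u_{ti}u_{tj}=\psi(x,t),\qquad u(\cdot,0)=u_0,\quad u(\cdot,1)=u_1,$$ the equation being satisfied on $M\times(0,1)$; admissible means that $\lambda(W[u])\in\Gamma_k$, $u_{tt}>0$ and $\sigma_k(E_u)>0$ on $M\times(0,1)$. If $r\ne 0$ or $\gamma>0$, then $$\max_{M\times[0,1]}|\nabla u|\le C,$$ where, for the given $(M,g)$, $A$, $k$, $\gamma$, $s$, $r$, the constant $C>0$ depends only on upper bounds for $\sup_{M\times[0,1]}\psi$, $\sup_{M\times[0,1]}|\nabla(\psi^{1/(k+1)})|$, $|u_0|_{C^1(M)}$ and $|u_1|_{C^1(M)}$. In particular $C$ does not depend on $\inf\psi$. -/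

import Mathlib

open Set
open scoped Manifold ContDiff Topology Matrix

noncomputable section

namespace GurskyStreets

/-! ### Elementary symmetric functions of the eigenvalues of a matrix -/

section Algebra

variable {n : ℕ}

/-- `σ_k(λ(W))` for a real `n × n` matrix `W` (with `k ≤ n`): the `k`-th elementary symmetric
function of the eigenvalues, read off from the characteristic polynomial
`det (X - W) = ∑ (-1)^k σ_k X^(n-k)`. It is a polynomial in the entries of `W`; see
`sigma_eq_esymm_roots` for the expression through the eigenvalues. -/
def sigma (k : ℕ) (W : Matrix (Fin n) (Fin n) ℝ) : ℝ :=
  (-1) ^ k * W.charpoly.coeff (n - k)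

/-- If all eigenvalues of `W` are real, `sigma k W` is the elementary symmetric function of the
eigenvalues counted with multiplicity. -/
theorem sigma_eq_esymm_roots {k : ℕ} (hk : k ≤ n) (W : Matrix (Fin n) (Fin n) ℝ)
    (hW : W.charpoly.Splits) : sigma k W = W.charpoly.roots.esymm k := by
  have hdeg : W.charpoly.natDegree = n := by
    simp
  have hc := Polynomial.coeff_eq_esymm_roots_of_card (p := W.charpoly)
    (hW.natDegree_eq_card_roots.symm) (k := n - k) (by omega)
  rw [W.charpoly_monic.leadingCoeff, hdeg, Nat.sub_sub_self hk, one_mul] at hc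
  rw [sigma, hc, ← mul_assoc, ← mul_pow]
  simp

/-- `λ(W) ∈ Γ_k`, Gårding's cone: `σ_j(λ(W)) > 0` for `j = 1, …, k`. -/
def InGamma (k : ℕ) (W : Matrix (Fin n) (Fin n) ℝ) : Prop :=
  ∀ j, 1 ≤ j → j ≤ k → 0 < sigma j W

/-- `σ_k^{ij}(W) = ∂σ_k(W) / ∂W_{ij}`. -/
def sigmaDeriv (k : ℕ) (W : Matrix (Fin n) (Fin n) ℝ) (i j : Fin n) : ℝ :=
  deriv (fun τ : ℝ => sigma k (W + τ • Matrix.single i j (1 : ℝ))) 0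

end Algebra

/-! ### Riemannian geometry in local coordinates -/

section Geometry

variable {n : ℕ} {M : Type*} [TopologicalSpace M] [ChartedSpace (EuclideanSpace ℝ (Fin n)) M]

/-- A field of bilinear forms on the tangent spaces, i.e. a (not necessarily continuous)
`(0,2)`-tensor. -/
abbrev TwoTensor (n : ℕ) (M : Type*) [TopologicalSpace M]
    [ChartedSpace (EuclideanSpace ℝ (Fin n)) M] : Type _ :=
  ∀ x : M, TangentSpace (𝓡 n) x →L[ℝ] TangentSpace (𝓡 n) x →L[ℝ] ℝ

variable [IsManifold (𝓡 n) ∞ M]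

/-- Smooth Riemannian metrics on `M`. -/
abbrev RiemMetric (n : ℕ) (M : Type*) [TopologicalSpace M]
    [ChartedSpace (EuclideanSpace ℝ (Fin n)) M] [IsManifold (𝓡 n) ∞ M] : Type _ :=
  Bundle.ContMDiffRiemannianMetric (𝓡 n) ∞ (EuclideanSpace ℝ (Fin n))
    (fun x : M => TangentSpace (𝓡 n) x)

/-- Smoothness of a `(0,2)`-tensor, as a section of the bundle of bilinear forms. -/
def SmoothTwoTensor (A : TwoTensor n M) : Prop :=
  ContMDiff (𝓡 n) ((𝓡 n).prod 𝓘(ℝ, EuclideanSpace ℝ (Fin n) →L[ℝ]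
      EuclideanSpace ℝ (Fin n) →L[ℝ] ℝ)) ∞
    (fun x => Bundle.TotalSpace.mk' (EuclideanSpace ℝ (Fin n) →L[ℝ] EuclideanSpace ℝ (Fin n) →L[ℝ] ℝ)
      (E := fun x : M => TangentSpace (𝓡 n) x →L[ℝ] TangentSpace (𝓡 n) x →L[ℝ] ℝ) x (A x))

/-- The metric at `x` as a bilinear form. -/
def metricForm (g : RiemMetric n M) (x : M) : LinearMap.BilinForm ℝ (TangentSpace (𝓡 n) x) :=
  LinearMap.mk₂ ℝ (fun v w => g.inner x v w) (by simp) (by simp) (by simp) (by simp)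

theorem metricForm_nondegenerate (g : RiemMetric n M) (x : M) : (metricForm g x).Nondegenerate := by
  refine ⟨fun v hv => ?_, fun v hv => ?_⟩
  all_goals
    by_contra h
    exact (g.pos x v h).ne' (hv v)

instance finiteDimensional_tangentSpace (x : M) : FiniteDimensional ℝ (TangentSpace (𝓡 n) x) :=
  inferInstanceAs (FiniteDimensional ℝ (EuclideanSpace ℝ (Fin n)))

/-- The Riemannian gradient `∇f` of `f` at `x`. -/
def grad (g : RiemMetric n M) (f : M → ℝ) (x : M) : TangentSpace (𝓡 n) x :=
  ((metricForm g x).toDual (metricForm_nondegenerate g x)).symm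
    (mvfderiv (𝓡 n) f x : TangentSpace (𝓡 n) x →ₗ[ℝ] ℝ)

/-- The length `|∇f|` of the gradient with respect to `g`. -/
def gradNorm (g : RiemMetric n M) (f : M → ℝ) (x : M) : ℝ :=
  √(g.inner x (grad g f x) (grad g f x))

/-- The coordinate vector fields `∂_i` of the chart of the atlas chosen at `c`, at a point `x` of
its domain. -/
def coordVec (c x : M) (i : Fin n) : TangentSpace (𝓡 n) x :=
  (trivializationAt (EuclideanSpace ℝ (Fin n)) (TangentSpace (𝓡 n)) c).symmL ℝ x
    (EuclideanSpace.single i (1 : ℝ))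

/-- The components `T(∂_i, ∂_j)` of a `(0,2)`-tensor in the chart at `c`. -/
def tensorCoord (T : TwoTensor n M) (c x : M) : Matrix (Fin n) (Fin n) ℝ :=
  Matrix.of fun i j => T x (coordVec c x i) (coordVec c x j)

/-- Partial derivatives on the coordinate space. -/
def pd (i : Fin n) (F : EuclideanSpace ℝ (Fin n) → ℝ) (y : EuclideanSpace ℝ (Fin n)) : ℝ :=
  fderiv ℝ F y (EuclideanSpace.single i (1 : ℝ))

/-- A function on `M` written in the chart at `c`. -/
def inChart (c : M) (f : M → ℝ) : EuclideanSpace ℝ (Fin n) → ℝ :=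
  fun y => f ((extChartAt (𝓡 n) c).symm y)

/-- The components of `df` in the chart at `c`. -/
def dCoord (f : M → ℝ) (c x : M) : Fin n → ℝ :=
  fun i => pd i (inChart c f) (extChartAt (𝓡 n) c x)

/-- `∂_l g_{ij}` in the chart at `c`. -/
def dMetric (g : RiemMetric n M) (c x : M) (l i j : Fin n) : ℝ :=
  dCoord (fun z => tensorCoord g.inner c z i j) c x l

/-- The Christoffel symbols `Γ^m_{ij}` of the Levi-Civita connection in the chart at `c`. -/
def christoffel (g : RiemMetric n M) (c x : M) (m i j : Fin n) : ℝ :=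
  (1 / 2) * ∑ l, (tensorCoord g.inner c x)⁻¹ m l *
    (dMetric g c x i j l + dMetric g c x j i l - dMetric g c x l i j)

/-- The components `∂_i ∂_j f - Γ^m_{ij} ∂_m f` of the Hessian `∇²f` in the chart at `c`. -/
def hessCoord (g : RiemMetric n M) (f : M → ℝ) (c x : M) : Matrix (Fin n) (Fin n) ℝ :=
  Matrix.of fun i j =>
    pd i (pd j (inChart c f)) (extChartAt (𝓡 n) c x) -
      ∑ m, christoffel g c x m i j * dCoord f c x m

/-- The Laplace-Beltrami operator `Δf = g^{ij} ∇_{ij} f`, computed in the chart at `c`. -/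
def laplace (g : RiemMetric n M) (f : M → ℝ) (c x : M) : ℝ :=
  ((tensorCoord g.inner c x)⁻¹ * hessCoord g f c x).trace

/-! ### The modified Gursky-Streets equation -/

/-- The matrix of
`W[f] = g⁻¹ (∇²f + s df ⊗ df + (γ Δf - (r/2) |∇f|²) g + A)` in the chart at `c`. -/
def W (g : RiemMetric n M) (A : TwoTensor n M) (s r γ : ℝ) (f : M → ℝ) (c x : M) :
    Matrix (Fin n) (Fin n) ℝ :=
  (tensorCoord g.inner c x)⁻¹ *
    (hessCoord g f c x + s • Matrix.vecMulVec (dCoord f c x) (dCoord f c x) +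
      (γ * laplace g f c x - r / 2 * gradNorm g f x ^ 2) • tensorCoord g.inner c x +
      tensorCoord A c x)

/-- `λ(W[f]) ∈ Γ_k` at every point of `M`. The condition does not depend on the chart. -/
def WInGamma (g : RiemMetric n M) (A : TwoTensor n M) (s r γ : ℝ) (k : ℕ) (f : M → ℝ) : Prop :=
  ∀ c x : M, x ∈ (chartAt (EuclideanSpace ℝ (Fin n)) c).source → InGamma k (W g A s r γ f c x)

/-- The time derivative `u_t`. -/
def dt (u : M → ℝ → ℝ) (t : ℝ) (x : M) : ℝ := deriv (u x) t

/-- The second time derivative `u_tt`. -/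
def dtt (u : M → ℝ → ℝ) (t : ℝ) (x : M) : ℝ := deriv (deriv (u x)) t

/-- The matrix of `g⁻¹ du_t ⊗ du_t` in the chart at `c`. -/
def dutSq (g : RiemMetric n M) (u : M → ℝ → ℝ) (t : ℝ) (c x : M) : Matrix (Fin n) (Fin n) ℝ :=
  (tensorCoord g.inner c x)⁻¹ * Matrix.vecMulVec (dCoord (dt u t) c x) (dCoord (dt u t) c x)

/-- The matrix of `E_u = u_tt W[u] - g⁻¹ du_t ⊗ du_t` in the chart at `c`. -/
def Eu (g : RiemMetric n M) (A : TwoTensor n M) (s r γ : ℝ) (u : M → ℝ → ℝ) (t : ℝ) (c x : M) :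
    Matrix (Fin n) (Fin n) ℝ :=
  dtt u t x • W g A s r γ (fun y => u y t) c x - dutSq g u t c x

/-- The left-hand side `u_tt σ_k(W[u]) - σ_k^{ij}(W[u]) u_{ti} u_{tj}` of the equation; the
contraction of `σ_k^{ij}` with `du_t ⊗ du_t` uses the mixed components `g⁻¹ du_t ⊗ du_t`, which
are `u_{ti} u_{tj}` when the frame is orthonormal. -/
def operator (g : RiemMetric n M) (A : TwoTensor n M) (s r γ : ℝ) (k : ℕ) (u : M → ℝ → ℝ) (t : ℝ)
    (c x : M) : ℝ :=
  dtt u t x * sigma k (W g A s r γ (fun y => u y t) c x) -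
    ∑ i, ∑ j, sigmaDeriv k (W g A s r γ (fun y => u y t) c x) i j * dutSq g u t c x i j

/-- `C^m` regularity of a function of `(x, t)` on `M × J`. -/
def RegOn (m : WithTop ℕ∞) (u : M → ℝ → ℝ) (J : Set ℝ) : Prop :=
  ContMDiffOn ((𝓡 n).prod 𝓘(ℝ, ℝ)) 𝓘(ℝ, ℝ) m (fun p : M × ℝ => u p.1 p.2) (univ ×ˢ J)

/-- `u ∈ C³(M × (0,1)) ∩ C¹(M × [0,1])` is an admissible solution of
`u_tt σ_k(W[u]) - σ_k^{ij}(W[u]) u_{ti} u_{tj} = ψ`, `u(·,0) = u₀`, `u(·,1) = u₁`. The pointwise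
conditions do not depend on the chart. -/
structure IsAdmissibleSolution (g : RiemMetric n M) (A : TwoTensor n M) (s r γ : ℝ) (k : ℕ)
    (ψ : M → ℝ → ℝ) (u₀ u₁ : M → ℝ) (u : M → ℝ → ℝ) : Prop where
  reg_interior : RegOn (n := n) 3 u (Ioo 0 1)
  reg_closed : RegOn (n := n) 1 u (Icc 0 1)
  initial : ∀ x, u x 0 = u₀ x
  final : ∀ x, u x 1 = u₁ x
  gamma : ∀ t ∈ Ioo (0 : ℝ) 1, WInGamma g A s r γ k (fun y => u y t)
  dtt_pos : ∀ t ∈ Ioo (0 : ℝ) 1, ∀ x, 0 < dtt u t x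
  sigma_pos : ∀ t ∈ Ioo (0 : ℝ) 1, ∀ c x : M,
    x ∈ (chartAt (EuclideanSpace ℝ (Fin n)) c).source → 0 < sigma k (Eu g A s r γ u t c x)
  equation : ∀ t ∈ Ioo (0 : ℝ) 1, ∀ c x : M,
    x ∈ (chartAt (EuclideanSpace ℝ (Fin n)) c).source → operator g A s r γ k u t c x = ψ x t

end Geometry

end GurskyStreets

end

open GurskyStreets

namespace GurskyStreets

/-! ### Newton's inequalities for real-rooted polynomials. -/

section RealRooted

open Polynomial

/-! Put S = W[u] - u_tt⁻¹ g⁻¹ du_t ⊗ du_t. Because σ_k is affine along rank one perturbations, the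
equation reads u_tt σ_k(S) = ψ (`operator_eq`). Since W[u] is S plus a nonnegative rank one matrix,
W[u] ∈ Γ_k and σ_k(S) > 0 force S ∈ Γ_k (`InGamma.of_add_vecMulVec`). So the linearization at S has
positive weights T_i, ordered oppositely to the eigenvalues of S. In the analytic lemmas the order
of the symmetric function is written k + 1, and f = ψ^(1/(k+2)).

The sup bound uses no gradient. Convexity in t bounds u from above. At an interior minimum of u + a
t(1 - t) one has u_tt ≥ 2a and S ≥ A as forms, hence ψ ≥ 2a σ(g⁻¹A), which is impossible for large
a; this bounds u from below (`IsAdmissibleSolution.ge_of_boundary`).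

For the gradient, consider a maximum of ½|∇u|² exp(φ(u) + η t²) with φ(u) = ε₀ exp(Lu). If it lies
on t = 0 or t = 1, the boundary data bound it. At an interior maximum, take normal coordinates that
diagonalize S and use the second order conditions along e_t, e_m - (u_tm/u_tt) e_t and e_m. Combined
with the weights of the linearization, they reproduce the third derivatives of the differentiated
equation, which therefore cancel (`MaximumJet.main_inequality`). What is left must be shown positive
when q = |∇u| is large.

That is the algebraic heart, `cone_inequality`. If γ > 0, the weights contain γ ∑ T_i in every
direction and the term Λ φ' γ q² dominates. If γ = 0 and r ≠ 0, either the Hessian part B is large,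
or the zeroth order term has the good sign, or a fixed part of ∑ T_i q² sits on one component of ∇u
(`gradient_weight_dichotomy`). In the last case the critical point equations and the ordering of the
weights prevent the vector w from being small where T is large (`weighted_sq_lower_bound`), and Λ φ'
∑ T_i w_i² dominates.

The derivative of ψ enters as (k+2) f^(k+1) ∇f. Maclaurin's inequality gives f^(k+1) ≤ σ_{k+1}(S) +
u_tt σ_k(S) (`pow_le_sigma_add`), and the good terms control the right-hand side, so no lower bound
for ψ is needed.

Uniform constants come from compactness: normal coordinates are quadratic maps depending
continuously on a point and a normalized frame, and these range over a compact set
(`exists_normalData`, `exists_goodChart`). -/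

theorem splits_derivative {p : ℝ[X]} (hp : p.Splits) : (derivative p).Splits := by
  rw [splits_iff_card_roots]
  -- Rolle with multiplicities: differentiation loses at most one root, and it lowers the degree by
  -- at least one.
  have h1 := card_roots_le_derivative p
  have h2 := hp.natDegree_eq_card_roots
  have h3 := natDegree_derivative_le p
  have h4 := card_roots' (derivative p)
  rcases Nat.eq_zero_or_pos p.natDegree with h | h
  · have : derivative p = 0 := by
      rw [eq_C_of_natDegree_eq_zero h, derivative_C]
    simp [this]
  · omega

theorem splits_iterate_derivative {p : ℝ[X]} (hp : p.Splits) (m : ℕ) :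
    (derivative^[m] p).Splits := by
  induction m with
  | zero => simpa using hp
  | succ m ih => rw [Function.iterate_succ_apply']; exact splits_derivative ih

/-- Laguerre's inequality for real-rooted polynomials. -/
theorem laguerre_inequality {p : ℝ[X]} (hp : p.Splits) (x : ℝ) :
    p.eval x * (derivative (derivative p)).eval x ≤ (derivative p).eval x ^ 2 := by
  obtain ⟨m, hm⟩ := splits_iff_exists_multiset.1 hp
  have key : ∀ m : Multiset ℝ, ∀ q : ℝ[X], q = (m.map (fun a => X - C a)).prod →
      q.eval x * (derivative (derivative q)).eval x ≤ (derivative q).eval x ^ 2 := by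
    intro m
    induction m using Multiset.induction with
    | empty => intro q hq; simp [hq]
    | cons a m ih =>
      intro q hq
      have h := ih _ rfl
      set q' := (m.map (fun a => X - C a)).prod
      rw [Multiset.map_cons, Multiset.prod_cons] at hq
      simp only [hq, derivative_mul, derivative_sub, derivative_X, derivative_C, sub_zero,
        derivative_add, one_mul, eval_add, eval_mul, eval_sub, eval_X, eval_C]
      -- For q = (x - a) q', the defect of q is q'(x)² plus (x - a)² times the defect of the factor
      -- q'.
      nlinarith [sq_nonneg (q'.eval x), mul_le_mul_of_nonneg_left h (sq_nonneg (x - a))]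
  have h := key m _ rfl
  rw [hm]
  simp only [derivative_C_mul, eval_mul, eval_C]
  nlinarith [mul_le_mul_of_nonneg_left h (sq_nonneg p.leadingCoeff)]

/-- Newton's inequality in the weak form `c_{j} c_{j+2} ≤ c_{j+1}²`. -/
theorem newton_inequality {p : ℝ[X]} (hp : p.Splits) (j : ℕ) :
    p.coeff j * p.coeff (j + 2) ≤ p.coeff (j + 1) ^ 2 := by
  -- At 0 the j-th derivative has value, slope and second derivative j! c_j, (j+1)! c_{j+1} and
  -- (j+2)! c_{j+2}.
  have h := laguerre_inequality (splits_iterate_derivative hp j) 0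
  simp only [← coeff_zero_eq_eval_zero, coeff_derivative, coeff_iterate_derivative,
    nsmul_eq_mul] at h
  have e0 : (0 + j).descFactorial j = j.factorial := by simp [Nat.descFactorial_self]
  have e1 : (0 + 1 + j).descFactorial j = (j + 1).factorial := by
    have := Nat.factorial_mul_descFactorial (n := j + 1) (k := j) (by omega)
    rw [Nat.add_sub_cancel_left] at this
    rw [← this]; simp [add_comm]
  have e2 : 2 * (0 + 1 + 1 + j).descFactorial j = (j + 2).factorial := by
    have := Nat.factorial_mul_descFactorial (n := j + 2) (k := j) (by omega)
    rw [Nat.add_sub_cancel_left] at this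
    rw [← this]; simp [add_comm, Nat.factorial]
  have e2' : (2 : ℝ) * ((0 + 1 + 1 + j).descFactorial j : ℝ) = ((j + 2).factorial : ℝ) := by
    exact_mod_cast e2
  rw [e0, e1] at h
  have e3 : ((j + 1).factorial : ℝ) = (j + 1) * j.factorial := by
    push_cast [Nat.factorial_succ]; ring
  have e4 : ((j + 2).factorial : ℝ) = (j + 2) * ((j + 1) * j.factorial) := by
    push_cast [Nat.factorial_succ]; ring
  have i1 : 0 + 1 + j = j + 1 := by omega
  have i2 : 0 + 1 + 1 + j = j + 2 := by omega
  have i0 : 0 + j = j := by omega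
  rw [i1, i0] at h
  rw [i2] at h e2'
  have hf : (0 : ℝ) < j.factorial := by positivity
  set a := p.coeff j
  set b := p.coeff (j + 1)
  set c := p.coeff (j + 2)
  set f : ℝ := (j.factorial : ℝ)
  rw [e4] at e2'
  have h' : f * a * ((j + 2) * ((j + 1) * f) * c) ≤ ((j + 1) * f * b) ^ 2 := by
    rw [e3] at h
    rw [← e2']
    norm_num at h ⊢
    nlinarith [h]
  have h2 : (f ^ 2 * (j + 1)) * ((j + 2) * (a * c)) ≤ (f ^ 2 * (j + 1)) * ((j + 1) * b ^ 2) := by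
    nlinarith [h']
  have h3 := le_of_mul_le_mul_left h2 (by positivity)
  by_cases hac : a * c ≤ 0
  · exact hac.trans (sq_nonneg _)
  · push Not at hac
    have : ((j : ℝ) + 1) * (a * c) ≤ (j + 1) * b ^ 2 := by nlinarith
    exact le_of_mul_le_mul_left this (by positivity)

end RealRooted

/-! ### Elementary symmetric functions on Gårding's cone. -/

section Symmetric

open Polynomial

variable {ι : Type*}

/-- The elementary symmetric function `e_j` of the `l i`, `i ∈ s`. -/
noncomputable def esymmOn (s : Finset ι) (l : ι → ℝ) (j : ℕ) : ℝ :=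
  (∏ i ∈ s, (1 + C (l i) * X)).coeff j

theorem esymmOn_zero (s : Finset ι) (l : ι → ℝ) : esymmOn s l 0 = 1 := by
  simp [esymmOn, coeff_zero_eq_eval_zero, eval_prod]

theorem esymmOn_newton (s : Finset ι) (l : ι → ℝ) (j : ℕ) :
    esymmOn s l j * esymmOn s l (j + 2) ≤ esymmOn s l (j + 1) ^ 2 := by
  refine newton_inequality (Splits.prod fun i _ => ?_) j
  refine Splits.of_natDegree_le_one ?_
  compute_degree

/-- Maclaurin's inequalities without the optimal constants. -/
theorem esymmOn_maclaurin {s : Finset ι} {l : ι → ℝ} {k : ℕ}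
    (h : ∀ j, j ≤ k → 0 < esymmOn s l j) :
    ∀ j, j ≤ k → esymmOn s l k ^ j ≤ esymmOn s l j ^ k := by
  have step : ∀ j, j + 1 ≤ k → esymmOn s l (j + 1) ^ j ≤ esymmOn s l j ^ (j + 1) := by
    intro j
    induction j with
    | zero => intro _; simp [esymmOn_zero]
    | succ j ih =>
      intro hj
      have h0 := ih (by omega)
      have hN := esymmOn_newton s l j
      have ha := h j (by omega)
      have hb := h (j + 1) (by omega)
      have hc := h (j + 2) (by omega)
      set a := esymmOn s l j
      set b := esymmOn s l (j + 1)
      set c := esymmOn s l (j + 1 + 1)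
      have hN' : a * c ≤ b ^ 2 := hN
      have h1 : (a * c) ^ (j + 1) ≤ (b ^ 2) ^ (j + 1) := pow_le_pow_left₀ (by positivity) hN' _
      -- The induction hypothesis trades b ^ j for a ^ (j + 1), after which Newton applies to the
      -- product a * c.
      have h2 : b ^ j * c ^ (j + 1) ≤ b ^ j * b ^ (j + 1 + 1) := by
        calc b ^ j * c ^ (j + 1) ≤ a ^ (j + 1) * c ^ (j + 1) := by gcongr
          _ = (a * c) ^ (j + 1) := by ring
          _ ≤ (b ^ 2) ^ (j + 1) := h1
          _ = b ^ j * b ^ (j + 1 + 1) := by ring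
      exact le_of_mul_le_mul_left h2 (by positivity)
  intro j hj
  induction k with
  | zero => 
    obtain rfl : j = 0 := by omega
    simp
  | succ k ih =>
    rcases Nat.lt_or_ge k j with hjk | hjk
    · obtain rfl : j = k + 1 := by omega
      exact le_rfl
    · have h0 := ih (fun i hi => h i (by omega)) (fun i hi => step i (by omega)) hjk
      have h1 := step k le_rfl
      have ha := h j hj
      have hb := h k (by omega)
      have hc := h (k + 1) le_rfl
      rcases Nat.eq_zero_or_pos k with rfl | hk
      · obtain rfl : j = 0 := by omega
        simp [esymmOn_zero]
      · refine le_of_pow_le_pow_left₀ hk.ne' (by positivity) ?_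
        calc (esymmOn s l (k + 1) ^ j) ^ k = (esymmOn s l (k + 1) ^ k) ^ j := by ring
          _ ≤ (esymmOn s l k ^ (k + 1)) ^ j := by gcongr
          _ = (esymmOn s l k ^ j) ^ (k + 1) := by ring
          _ ≤ (esymmOn s l j ^ k) ^ (k + 1) := by gcongr
          _ = (esymmOn s l j ^ (k + 1)) ^ k := by ring

variable [DecidableEq ι]

theorem esymmOn_succ {s : Finset ι} {i : ι} (hi : i ∈ s) (l : ι → ℝ) (j : ℕ) :
    esymmOn s l (j + 1) = esymmOn (s.erase i) l (j + 1) + l i * esymmOn (s.erase i) l j := by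
  rw [esymmOn, ← Finset.mul_prod_erase s _ hi, add_mul, one_mul, coeff_add, mul_assoc, coeff_C_mul,
    coeff_X_mul]
  rfl

/-- Removing one variable maps `Γ_{k+1}` into `Γ_k`. -/
theorem esymmOn_erase_pos {s : Finset ι} {l : ι → ℝ} {k : ℕ}
    (h : ∀ j, j ≤ k + 1 → 0 < esymmOn s l j) {i : ι} (hi : i ∈ s) :
    ∀ j, j ≤ k → 0 < esymmOn (s.erase i) l j := by
  intro j
  induction j with
  | zero => intro _; rw [esymmOn_zero]; norm_num
  | succ j ih =>
    intro hj
    have ha := ih (by omega)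
    by_contra hb
    push Not at hb
    have h1 := h (j + 1) (by omega)
    have h2 := h (j + 2) (by omega)
    rw [esymmOn_succ hi] at h1 h2
    have hN := esymmOn_newton (s.erase i) l j
    set a := esymmOn (s.erase i) l j
    set b := esymmOn (s.erase i) l (j + 1)
    set c := esymmOn (s.erase i) l (j + 1 + 1)
    have hl : 0 < l i := by
      by_contra hl; push Not at hl
      nlinarith
    -- In the sum of the next two inequalities the terms with `l i` cancel, leaving a c > b²,
    -- against Newton.
    have h3 : 0 < a * (c + l i * b) := mul_pos ha h2
    have h4 : 0 ≤ -b * (b + l i * a) := mul_nonneg (by linarith) h1.le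
    have hN' : a * c ≤ b ^ 2 := hN
    nlinarith

/-- Euler's identity, read off the k-th coefficient of the derivative of ∏ (1 + l_i X). -/
theorem sum_erase_mul_esymmOn (s : Finset ι) (l : ι → ℝ) (k : ℕ) :
    ∑ m ∈ s, esymmOn (s.erase m) l k * l m = (k + 1) * esymmOn s l (k + 1) := by
  have h : (derivative (∏ i ∈ s, (1 + C (l i) * X))).coeff k
      = ∑ m ∈ s, esymmOn (s.erase m) l k * l m := by
    rw [derivative_prod_finset]
    simp [esymmOn]
  rw [← h, coeff_derivative, esymmOn]
  ring

/-- Identifies the trace of the linearization with a multiple of e_k, which makes Maclaurin's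
inequality usable for it. -/
theorem sum_erase_esymmOn (s : Finset ι) (l : ι → ℝ) (k : ℕ) :
    ∑ m ∈ s, esymmOn (s.erase m) l k = (s.card - k) * esymmOn s l k := by
  rcases k with _ | k
  · simp [esymmOn_zero]
  · have h1 : ∀ m ∈ s, esymmOn (s.erase m) l (k + 1) =
        esymmOn s l (k + 1) - esymmOn (s.erase m) l k * l m := by
      intro m hm
      rw [esymmOn_succ hm l k]; ring
    rw [Finset.sum_congr rfl h1, Finset.sum_sub_distrib, sum_erase_mul_esymmOn]
    simp
    ring

/-- On `Γ_{k+1}` the derivatives of `e_{k+1}` are ordered oppositely to the variables. -/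
theorem esymmOn_erase_anti {s : Finset ι} {l : ι → ℝ} {k : ℕ}
    (h : ∀ j, j ≤ k + 1 → 0 < esymmOn s l j) {a b : ι} (ha : a ∈ s) (hb : b ∈ s)
    (hab : l a ≤ l b) : esymmOn (s.erase b) l k ≤ esymmOn (s.erase a) l k := by
  rcases eq_or_ne a b with rfl | hne
  · exact le_rfl
  rcases k with _ | k
  · simp [esymmOn_zero]
  have h1 : a ∈ s.erase b := Finset.mem_erase.2 ⟨hne, ha⟩
  have h2 : b ∈ s.erase a := Finset.mem_erase.2 ⟨hne.symm, hb⟩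
  -- Both sides are split over the variable still present; they then differ only by `l a` versus `l
  -- b` times a positive factor with both variables removed.
  rw [esymmOn_succ h1, esymmOn_succ h2, Finset.erase_right_comm]
  have := esymmOn_erase_pos (esymmOn_erase_pos h ha) h2 k le_rfl
  nlinarith

end Symmetric

/-! ### The functions σ_k of a matrix and their derivatives. -/

section SigmaMatrix

open Polynomial

variable {n : ℕ}

/-- The polynomial `det (1 + x W) = ∑ σ_k(W) x^k`. -/
noncomputable def sigmaPoly (W : Matrix (Fin n) (Fin n) ℝ) : ℝ[X] :=
  (1 + (X : ℝ[X]) • W.map C).det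

theorem sigma_eq_sum_minors {k : ℕ} (hk : k ≤ n) (W : Matrix (Fin n) (Fin n) ℝ) :
    sigma k W = ∑ s ∈ (Finset.univ : Finset (Fin n)).powersetCard k,
      (W.submatrix (Subtype.val : s → Fin n) (Subtype.val : s → Fin n)).det := by
  have h := Matrix.charpoly_coeff_eq_sum_minors W k (by simpa using hk)
  rw [Fintype.card_fin] at h
  rw [sigma, h, ← mul_assoc, ← mul_pow]
  simp

theorem sigma_eq_coeff {k : ℕ} (hk : k ≤ n) (W : Matrix (Fin n) (Fin n) ℝ) :
    sigma k W = (sigmaPoly W).coeff k := by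
  rw [sigma_eq_sum_minors hk, sigmaPoly, Matrix.coeff_det_one_add_X_smul_eq_sum_minors]

theorem eval_sigmaPoly (W : Matrix (Fin n) (Fin n) ℝ) (x : ℝ) :
    (sigmaPoly W).eval x = (1 + x • W).det := by
  rw [sigmaPoly, ← coe_evalRingHom, RingHom.map_det]
  congr 1
  ext i j
  by_cases h : i = j
  · subst h; simp [mul_comm x]
  · simp [h, mul_comm x]

/-- Frame independence: it lets the equation and the cone conditions be checked in whichever frame
is convenient. -/
theorem sigma_conj {k : ℕ} (W P Q : Matrix (Fin n) (Fin n) ℝ) (h : P * Q = 1) :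
    sigma k (Q * W * P) = sigma k W := by
  rw [sigma, sigma, Matrix.charpoly_mul_comm, ← mul_assoc, h, one_mul]

theorem sigma_diagonal {k : ℕ} (hk : k ≤ n) (l : Fin n → ℝ) :
    sigma k (Matrix.diagonal l) = esymmOn Finset.univ l k := by
  rw [sigma_eq_coeff hk, esymmOn, sigmaPoly]
  congr 1
  rw [show (1 + (X : ℝ[X]) • (Matrix.diagonal l).map C : Matrix (Fin n) (Fin n) ℝ[X]) =
    Matrix.diagonal (fun i => 1 + C (l i) * X) from ?_, Matrix.det_diagonal]
  ext1 i j
  by_cases h : i = j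
  · subst h; simp [mul_comm (X : ℝ[X])]
  · simp [h]

theorem sigma_smul {k : ℕ} (hk : k ≤ n) (c : ℝ) (W : Matrix (Fin n) (Fin n) ℝ) :
    sigma k (c • W) = c ^ k * sigma k W := by
  rw [sigma_eq_sum_minors hk, sigma_eq_sum_minors hk, Finset.mul_sum]
  refine Finset.sum_congr rfl fun s hs => ?_
  rw [show (c • W).submatrix (Subtype.val : s → Fin n) (Subtype.val : s → Fin n) =
    c • W.submatrix (Subtype.val : s → Fin n) (Subtype.val : s → Fin n) from rfl,
    Matrix.det_smul, Fintype.card_coe, (Finset.mem_powersetCard.mp hs).2]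

theorem sigma_zero (W : Matrix (Fin n) (Fin n) ℝ) : sigma 0 W = 1 := by
  rw [sigma_eq_sum_minors (Nat.zero_le n)]
  simp

/-- The matrix determinant lemma, with the rank one matrix seen as a column times a row. -/
theorem det_add_smul_vecMulVec {A : Matrix (Fin n) (Fin n) ℝ} (hA : IsUnit A.det) (c : ℝ)
    (a b : Fin n → ℝ) :
    (A + c • Matrix.vecMulVec a b).det = A.det * (1 + c * (b ⬝ᵥ (A⁻¹ *ᵥ a))) := by
  have h := Matrix.det_add_replicateCol_mul_replicateRow (ι := Unit) hA (c • a) b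
  have e : Matrix.replicateCol Unit (c • a) * Matrix.replicateRow Unit b =
      c • Matrix.vecMulVec a b := by
    ext i j; simp [Matrix.mul_apply, Matrix.vecMulVec_apply, mul_assoc]
  rw [e] at h
  rw [h, Matrix.det_unique (_ : Matrix Unit Unit ℝ), Matrix.mul_assoc]
  congr 1
  simp only [Matrix.add_apply, Matrix.one_apply_eq]
  congr 1
  rw [show (Matrix.replicateRow Unit b * (A⁻¹ * Matrix.replicateCol Unit (c • a))) default default
    = b ⬝ᵥ (A⁻¹ *ᵥ (c • a)) from ?_, Matrix.mulVec_smul, dotProduct_smul, smul_eq_mul]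
  simp only [Matrix.mul_apply, dotProduct, Matrix.mulVec, Matrix.replicateRow_apply,
    Matrix.replicateCol_apply]

/-- det (1 + xW) is a polynomial in x with value 1 at 0, so it vanishes finitely often. Identities
between such polynomials may therefore be checked where 1 + xW is invertible. -/
theorem infinite_isUnit_det_one_add_smul (W : Matrix (Fin n) (Fin n) ℝ) :
    {x : ℝ | IsUnit (1 + x • W).det}.Infinite := by
  have h0 : sigmaPoly W ≠ 0 := by
    intro h
    have := eval_sigmaPoly W 0
    simp [h] at this
  have hfin : {x : ℝ | (sigmaPoly W).IsRoot x}.Finite := finite_setOfPred_isRoot h0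
  refine hfin.infinite_compl.mono fun x hx => ?_
  simp only [mem_compl_iff, mem_ofPred_eq, IsRoot.def, eval_sigmaPoly] at hx
  exact isUnit_iff_ne_zero.2 hx

/-- `σ_k` is affine along rank one perturbations. -/
theorem sigma_add_smul_vecMulVec_affine {k : ℕ} (hk : k ≤ n) (W : Matrix (Fin n) (Fin n) ℝ)
    (a b : Fin n → ℝ) (τ : ℝ) :
    sigma k (W + τ • Matrix.vecMulVec a b) =
      sigma k W + τ * (sigma k (W + Matrix.vecMulVec a b) - sigma k W) := by
  have h : sigmaPoly (W + τ • Matrix.vecMulVec a b) =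
      sigmaPoly W + C τ * (sigmaPoly (W + Matrix.vecMulVec a b) - sigmaPoly W) := by
    refine eq_of_infinite_eval_eq _ _ ((infinite_isUnit_det_one_add_smul W).mono fun x hx => ?_)
    have hx' : IsUnit (1 + x • W).det := hx
    simp only [mem_ofPred_eq, eval_add, eval_mul, eval_C, eval_sub, eval_sigmaPoly, smul_add,
      smul_smul, ← add_assoc]
    rw [det_add_smul_vecMulVec hx', det_add_smul_vecMulVec hx']
    ring
  rw [sigma_eq_coeff hk, sigma_eq_coeff hk, sigma_eq_coeff hk, h]
  simp

theorem contDiff_sigma {k : ℕ} (hk : k ≤ n) {X : Type*} [NormedAddCommGroup X] [NormedSpace ℝ X]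
    {S : X → Matrix (Fin n) (Fin n) ℝ} {x : X} {m : WithTop ℕ∞}
    (hS : ∀ i j, ContDiffAt ℝ m (fun y => S y i j) x) :
    ContDiffAt ℝ m (fun y => sigma k (S y)) x := by
  simp only [sigma_eq_sum_minors hk, Matrix.det_apply]
  refine ContDiffAt.sum fun s _ => ContDiffAt.sum fun e _ => ?_
  refine ContDiffAt.const_smul _ (contDiffAt_prod fun i _ => ?_)
  exact hS _ _

/-- The chain rule with all n² entries treated as independent variables, matching the definition of
`sigmaDeriv`. -/
theorem hasDerivAt_sigma {k : ℕ} (hk : k ≤ n) {S : ℝ → Matrix (Fin n) (Fin n) ℝ}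
    {S' : Matrix (Fin n) (Fin n) ℝ} {t : ℝ}
    (hS : ∀ i j, HasDerivAt (fun y => S y i j) (S' i j) t) :
    HasDerivAt (fun y => sigma k (S y)) (∑ i, ∑ j, sigmaDeriv k (S t) i j * S' i j) t := by
  let F : (Fin n → Fin n → ℝ) → ℝ := fun V => sigma k (Matrix.of V)
  have hF : ∀ V, DifferentiableAt ℝ F V := fun V =>
    (contDiff_sigma (m := 1) hk (S := fun V : Fin n → Fin n → ℝ => Matrix.of V)
      (fun i j => by simp only [Matrix.of_apply]; fun_prop)).differentiableAt one_ne_zero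
  have h1 : HasDerivAt (fun y => (fun i j => S y i j : Fin n → Fin n → ℝ))
      (fun i j => S' i j) t := by
    rw [hasDerivAt_pi]; intro i; rw [hasDerivAt_pi]; intro j; exact hS i j
  have h2 := (hF (fun i j => S t i j)).hasFDerivAt.comp_hasDerivAt t h1
  have h3 : ∀ i j, fderiv ℝ F (fun i j => S t i j) (Pi.single i (Pi.single j 1)) =
      sigmaDeriv k (S t) i j := by
    intro i j
    have hl : HasDerivAt (fun τ : ℝ => (fun i j => S t i j : Fin n → Fin n → ℝ) +
        τ • (Pi.single i (Pi.single j (1 : ℝ)) : Fin n → Fin n → ℝ))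
        (Pi.single i (Pi.single j (1 : ℝ)) : Fin n → Fin n → ℝ) 0 := by
      simpa using ((hasDerivAt_id (0 : ℝ)).smul_const
        (Pi.single i (Pi.single j (1 : ℝ)) : Fin n → Fin n → ℝ)).const_add
          (fun i j => S t i j : Fin n → Fin n → ℝ)
    have h4 := HasFDerivAt.comp_hasDerivAt (l := F) (x := (0 : ℝ)) (by
      simpa using (hF (fun i j => S t i j)).hasFDerivAt) hl
    rw [sigmaDeriv, ← h4.deriv]
    congr 1
    funext τ
    simp only [Function.comp, F]
    congr 1
    ext a b
    by_cases ha : a = i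
    · subst ha
      by_cases hb : b = j
      · subst hb; simp
      · simp [hb, Ne.symm hb]
    · simp [ha, Ne.symm ha]
  convert! h2 using 1
  have e : (fun i j => S' i j : Fin n → Fin n → ℝ) =
      ∑ i, ∑ j, S' i j • (Pi.single i (Pi.single j (1 : ℝ)) : Fin n → Fin n → ℝ) := by
    ext a b
    simp [Finset.sum_apply, Pi.single_apply, Finset.sum_ite_eq, ite_apply]
  rw [e]
  simp only [map_sum, map_smul, h3, smul_eq_mul]
  refine Finset.sum_congr rfl fun i _ => Finset.sum_congr rfl fun j _ => mul_comm _ _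

/-- The slope of the affine function is its derivative at 0. With τ = -1/u_tt this rewrites the
operator of the equation as u_tt σ_k(S). -/
theorem sigma_add_smul_vecMulVec {k : ℕ} (hk : k ≤ n) (W : Matrix (Fin n) (Fin n) ℝ)
    (a b : Fin n → ℝ) (τ : ℝ) :
    sigma k (W + τ • Matrix.vecMulVec a b) =
      sigma k W + τ * ∑ i, ∑ j, sigmaDeriv k W i j * Matrix.vecMulVec a b i j := by
  have h1 := hasDerivAt_sigma hk (S := fun τ : ℝ => W + τ • Matrix.vecMulVec a b) (t := 0)
    (S' := Matrix.vecMulVec a b) (fun i j => by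
      simpa using ((hasDerivAt_id (0 : ℝ)).mul_const (Matrix.vecMulVec a b i j)).const_add (W i j))
  have h2 : HasDerivAt (fun τ : ℝ => sigma k (W + τ • Matrix.vecMulVec a b))
      (sigma k (W + Matrix.vecMulVec a b) - sigma k W) 0 := by
    simp only [sigma_add_smul_vecMulVec_affine hk W a b]
    simpa using ((hasDerivAt_id (0 : ℝ)).mul_const
      (sigma k (W + Matrix.vecMulVec a b) - sigma k W)).const_add (sigma k W)
  rw [sigma_add_smul_vecMulVec_affine hk, h2.unique h1]
  simp

/-- On the diagonal a single variable moves. Off the diagonal the rank one correction in the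
determinant lemma is an off-diagonal entry of the inverse of a diagonal matrix, hence zero. -/
theorem sigmaDeriv_diagonal {k : ℕ} (hk : k + 1 ≤ n) (l : Fin n → ℝ) (i j : Fin n) :
    sigmaDeriv (k + 1) (Matrix.diagonal l) i j =
      if i = j then esymmOn (Finset.univ.erase i) l k else 0 := by
  rw [sigmaDeriv]
  split_ifs with h
  · subst h
    have e : ∀ τ : ℝ, sigma (k + 1) (Matrix.diagonal l + τ • Matrix.single i i (1 : ℝ)) =
        esymmOn (Finset.univ.erase i) l (k + 1) +
          (l i + τ) * esymmOn (Finset.univ.erase i) l k := by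
      intro τ
      have : Matrix.diagonal l + τ • Matrix.single i i (1 : ℝ) =
          Matrix.diagonal (Function.update l i (l i + τ)) := by
        ext a b
        by_cases hab : a = b
        · subst hab
          by_cases ha : a = i
          · subst ha; simp
          · simp [ha, Ne.symm ha]
        · simp only [Matrix.add_apply, Matrix.smul_apply, Matrix.diagonal_apply_ne _ hab, zero_add,
            smul_eq_mul]
          rw [Matrix.single_apply, if_neg (by rintro ⟨rfl, rfl⟩; exact hab rfl), mul_zero]
      rw [this, sigma_diagonal hk, esymmOn_succ (Finset.mem_univ i), Function.update_self]
      have hc : ∀ m, esymmOn (Finset.univ.erase i) (Function.update l i (l i + τ)) m =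
          esymmOn (Finset.univ.erase i) l m := by
        intro m
        rw [esymmOn, esymmOn]
        congr 1
        refine Finset.prod_congr rfl fun a ha => ?_
        rw [Function.update_of_ne (Finset.ne_of_mem_erase ha)]
      rw [hc, hc]
    simp only [e]
    simp
  · have hs : Matrix.single i j (1 : ℝ) = Matrix.vecMulVec (Pi.single i 1) (Pi.single j 1) := by
      rw [Matrix.single_eq_single_vecMulVec_single]
    have e : ∀ τ : ℝ, sigma (k + 1) (Matrix.diagonal l + τ • Matrix.single i j (1 : ℝ)) =
        sigma (k + 1) (Matrix.diagonal l) := by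
      intro τ
      rw [sigma_eq_coeff hk, sigma_eq_coeff hk]
      congr 1
      refine eq_of_infinite_eval_eq _ _
        ((infinite_isUnit_det_one_add_smul (Matrix.diagonal l)).mono fun x hx => ?_)
      have hx' : IsUnit (1 + x • Matrix.diagonal l).det := hx
      simp only [mem_ofPred_eq, eval_sigmaPoly, smul_add, smul_smul, ← add_assoc]
      rw [hs, det_add_smul_vecMulVec hx']
      have hd : (1 + x • Matrix.diagonal l : Matrix (Fin n) (Fin n) ℝ) =
          Matrix.diagonal (fun i => 1 + x * l i) := by
        ext a b
        by_cases hab : a = b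
        · subst hab; simp
        · simp [hab]
      rw [hd, Matrix.inv_diagonal]
      simp [Pi.single_eq_of_ne h]
    simp only [e, deriv_const]

theorem hasDerivAt_sigma_diagonal {k : ℕ} (hk : k + 1 ≤ n) {S : ℝ → Matrix (Fin n) (Fin n) ℝ}
    {S' : Matrix (Fin n) (Fin n) ℝ} {t : ℝ} {l : Fin n → ℝ} (hl : S t = Matrix.diagonal l)
    (hS : ∀ i j, HasDerivAt (fun y => S y i j) (S' i j) t) :
    HasDerivAt (fun y => sigma (k + 1) (S y))
      (∑ i, esymmOn (Finset.univ.erase i) l k * S' i i) t := by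
  convert! hasDerivAt_sigma hk hS using 1
  simp [hl, sigmaDeriv_diagonal hk]

theorem sigma_diagonal_add_vecMulVec {k : ℕ} (hk : k + 1 ≤ n) (l a : Fin n → ℝ) (τ : ℝ) :
    sigma (k + 1) (Matrix.diagonal l + τ • Matrix.vecMulVec a a) =
      esymmOn Finset.univ l (k + 1) +
        τ * ∑ i, esymmOn (Finset.univ.erase i) l k * a i ^ 2 := by
  rw [sigma_add_smul_vecMulVec hk, sigma_diagonal hk]
  simp [sigmaDeriv_diagonal hk, Matrix.vecMulVec_apply, sq]

end SigmaMatrix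

/-! ### Monotonicity of σ_j and stability of Γ_k for symmetric matrices. -/

section Garding

variable {n : ℕ}

theorem InGamma.conj {k : ℕ} {W P Q : Matrix (Fin n) (Fin n) ℝ} (h : P * Q = 1)
    (hW : InGamma k W) : InGamma k (Q * W * P) := fun j h1 h2 => by
  rw [sigma_conj W P Q h]; exact hW j h1 h2

/-- Orthogonal diagonalization of a real symmetric matrix. -/
theorem exists_orthogonal_diagonalization {S : Matrix (Fin n) (Fin n) ℝ} (hS : Sᵀ = S) :
    ∃ (O : Matrix (Fin n) (Fin n) ℝ) (l : Fin n → ℝ), Oᵀ * O = 1 ∧ O * Oᵀ = 1 ∧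
      Oᵀ * S * O = Matrix.diagonal l := by
  have hH : S.IsHermitian := by
    rw [Matrix.IsHermitian, Matrix.conjTranspose_eq_transpose_of_trivial]; exact hS
  refine ⟨hH.eigenvectorUnitary, hH.eigenvalues, ?_, ?_, ?_⟩
  · have := Unitary.coe_star_mul_self hH.eigenvectorUnitary
    rwa [Matrix.star_eq_conjTranspose, Matrix.conjTranspose_eq_transpose_of_trivial] at this
  · have := Unitary.coe_mul_star_self hH.eigenvectorUnitary
    rwa [Unitary.coe_star, Matrix.star_eq_conjTranspose, Matrix.conjTranspose_eq_transpose_of_trivial] at this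
  · have := hH.conjStarAlgAut_star_eigenvectorUnitary
    rw [Unitary.conjStarAlgAut_star_apply, Matrix.star_eq_conjTranspose,
      Matrix.conjTranspose_eq_transpose_of_trivial] at this
    exact this

theorem InGamma.esymmOn_pos {k : ℕ} (hk : k ≤ n) {l : Fin n → ℝ}
    (h : InGamma k (Matrix.diagonal l)) : ∀ j, j ≤ k → 0 < esymmOn Finset.univ l j := by
  intro j hj
  rcases Nat.eq_zero_or_pos j with rfl | h0
  · rw [esymmOn_zero]; norm_num
  · rw [← sigma_diagonal (hj.trans hk)]; exact h j h0 hj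

theorem InGamma.maclaurin {k : ℕ} (hk : k ≤ n) {S : Matrix (Fin n) (Fin n) ℝ} (hS : Sᵀ = S)
    (h : InGamma k S) {j : ℕ} (hj : j ≤ k) : sigma k S ^ j ≤ sigma j S ^ k := by
  obtain ⟨O, l, h1, h2, h3⟩ := exists_orthogonal_diagonalization hS
  have hd := h.conj h2
  rw [h3] at hd
  rw [← sigma_conj S O Oᵀ h2, ← sigma_conj (k := j) S O Oᵀ h2, h3, sigma_diagonal hk,
    sigma_diagonal (hj.trans hk)]
  exact esymmOn_maclaurin (hd.esymmOn_pos hk) j hj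

/-- Adding a nonnegative rank one matrix increases `σ_j` on `Γ_k`. -/
theorem InGamma.sigma_le_add_vecMulVec {k : ℕ} (hk : k ≤ n) {S : Matrix (Fin n) (Fin n) ℝ}
    (hS : Sᵀ = S) (h : InGamma k S) (a : Fin n → ℝ) {j : ℕ} (hj : j ≤ k) :
    sigma j S ≤ sigma j (S + Matrix.vecMulVec a a) := by
  rcases j with _ | j
  · simp [sigma_zero]
  obtain ⟨O, l, h1, h2, h3⟩ := exists_orthogonal_diagonalization hS
  have hd := h.conj h2
  rw [h3] at hd
  have e : Oᵀ * (S + Matrix.vecMulVec a a) * O =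
      Matrix.diagonal l + (1 : ℝ) • Matrix.vecMulVec (Oᵀ *ᵥ a) (Oᵀ *ᵥ a) := by
    rw [mul_add, add_mul, h3, one_smul, Matrix.mul_vecMulVec, Matrix.vecMulVec_mul,
      Matrix.mulVec_transpose]
  rw [← sigma_conj S O Oᵀ h2, ← sigma_conj (S + Matrix.vecMulVec a a) O Oᵀ h2, h3, e,
    sigma_diagonal_add_vecMulVec (hj.trans hk), sigma_diagonal (hj.trans hk), one_mul]
  have hp := hd.esymmOn_pos hk
  have : 0 ≤ ∑ i, esymmOn (Finset.univ.erase i) l j * (Oᵀ *ᵥ a) i ^ 2 :=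
    Finset.sum_nonneg fun i _ => mul_nonneg
      (esymmOn_erase_pos (fun m hm => hp m (by omega)) (Finset.mem_univ i) j le_rfl).le
      (sq_nonneg _)
  linarith

/-- Symmetry and cone membership are carried through the induction because each single step needs
them for the partial sum reached so far. -/
theorem InGamma.sigma_le_add_sum {k : ℕ} (hk : k ≤ n) {S : Matrix (Fin n) (Fin n) ℝ}
    (hS : Sᵀ = S) (h : InGamma k S) {ι : Type*} (s : Finset ι) (a : ι → Fin n → ℝ) :
    (S + ∑ i ∈ s, Matrix.vecMulVec (a i) (a i))ᵀ = S + ∑ i ∈ s, Matrix.vecMulVec (a i) (a i) ∧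
    InGamma k (S + ∑ i ∈ s, Matrix.vecMulVec (a i) (a i)) ∧
      ∀ j ≤ k, sigma j S ≤ sigma j (S + ∑ i ∈ s, Matrix.vecMulVec (a i) (a i)) := by
  classical
  induction s using Finset.induction_on with
  | empty => simpa using ⟨hS, h⟩
  | insert i s hi ih =>
    obtain ⟨h1, h2, h3⟩ := ih
    rw [Finset.sum_insert hi, add_comm (Matrix.vecMulVec _ _), ← add_assoc]
    have h4 : ∀ j ≤ k, _ := fun j hj => h2.sigma_le_add_vecMulVec hk h1 (a i) hj
    refine ⟨?_, fun j hj1 hj2 => (h2 j hj1 hj2).trans_le (h4 j hj2),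
      fun j hj => (h3 j hj).trans (h4 j hj)⟩
    rw [Matrix.transpose_add, h1, Matrix.transpose_vecMulVec]

/-- `σ_j` is monotone on `Γ_k` with respect to the order of quadratic forms. -/
theorem InGamma.sigma_mono {k : ℕ} (hk : k ≤ n) {S S' : Matrix (Fin n) (Fin n) ℝ}
    (hS : Sᵀ = S) (hS' : S'ᵀ = S') (h : InGamma k S)
    (hle : ∀ x : Fin n → ℝ, x ⬝ᵥ (S *ᵥ x) ≤ x ⬝ᵥ (S' *ᵥ x)) {j : ℕ} (hj : j ≤ k) :
    sigma j S ≤ sigma j S' := by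
  have hsym : (S' - S)ᵀ = S' - S := by rw [Matrix.transpose_sub, hS, hS']
  obtain ⟨O, l, h1, h2, h3⟩ := exists_orthogonal_diagonalization hsym
  have hl : ∀ i, 0 ≤ l i := by
    intro i
    have e : l i = (Oᵀ * (S' - S) * O) i i := by rw [h3]; simp
    have e2 : (Oᵀ * (S' - S) * O) i i = (fun a => O a i) ⬝ᵥ ((S' - S) *ᵥ (fun a => O a i)) := by
      rw [mul_assoc, Matrix.mul_apply]
      simp only [dotProduct, Matrix.transpose_apply]
      rfl
    rw [e, e2, Matrix.sub_mulVec, dotProduct_sub]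
    linarith [hle (fun a => O a i)]
  -- The spectral decomposition writes the nonnegative difference as a sum of nonnegative rank one
  -- matrices.
  have hdec : S' = S + ∑ i, Matrix.vecMulVec (fun a => √(l i) * O a i) (fun a => √(l i) * O a i) := by
    have : S' - S = O * Matrix.diagonal l * Oᵀ := by
      rw [← h3]
      calc S' - S = (O * Oᵀ) * (S' - S) * (O * Oᵀ) := by rw [h2]; simp
        _ = _ := by simp only [mul_assoc]
    rw [← sub_eq_iff_eq_add', this]
    ext a b
    rw [Matrix.mul_apply, Matrix.sum_apply]
    simp only [Matrix.mul_diagonal, Matrix.transpose_apply, Matrix.vecMulVec_apply]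
    refine Finset.sum_congr rfl fun i _ => ?_
    have := Real.mul_self_sqrt (hl i)
    linear_combination (-(O a i * O b i)) * this
  rw [hdec]
  exact (h.sigma_le_add_sum hk hS Finset.univ _).2.2 j hj

/-- If `S + a aᵀ ∈ Γ_k` and `σ_k(S) > 0`, then `S ∈ Γ_k`. -/
theorem InGamma.of_add_vecMulVec {k : ℕ} (hk : k ≤ n) {S : Matrix (Fin n) (Fin n) ℝ}
    (hS : Sᵀ = S) {a : Fin n → ℝ} (h : InGamma k (S + Matrix.vecMulVec a a))
    (hpos : 0 < sigma k S) : InGamma k S := by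
  set R := Matrix.vecMulVec a a with hR
  have hsym : ∀ τ : ℝ, (S + τ • R)ᵀ = S + τ • R := by
    intro τ
    rw [Matrix.transpose_add, hS, Matrix.transpose_smul, hR, Matrix.transpose_vecMulVec]
  have haff : ∀ j ≤ k, ∀ τ : ℝ,
      sigma j (S + τ • R) = sigma j S + τ * (sigma j (S + R) - sigma j S) :=
    fun j hj τ => sigma_add_smul_vecMulVec_affine (hj.trans hk) S a a τ
  have hcont : ∀ j ≤ k, Continuous fun τ : ℝ => sigma j (S + τ • R) := by
    intro j hj
    simp only [haff j hj]
    fun_prop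
  rcases Nat.eq_zero_or_pos k with rfl | hk0
  · intro j h1 h2; omega
  -- An affine function that is positive at both ends of the segment is positive on it.
  have hkpos : ∀ τ ∈ Icc (0 : ℝ) 1, 0 < sigma k (S + τ • R) := by
    intro τ hτ
    have := h k hk0 le_rfl
    rw [haff k le_rfl]
    rcases eq_or_lt_of_le hτ.1 with h0 | h0
    · rw [← h0]; simpa using hpos
    · nlinarith [hτ.2, mul_pos h0 this, mul_nonneg (sub_nonneg.2 hτ.2) hpos.le]
  -- Continuity method down from τ = 1. `A` is the open cone condition; `B` is a closed condition
  -- implied by it. Where σ_k > 0, Maclaurin keeps every σ_j in `B` from vanishing, so the two sets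
  -- agree on [0, 1] and connectedness reaches τ = 0.
  let A : Set ℝ := {τ | ∀ j ∈ Finset.Icc 1 k, 0 < sigma j (S + τ • R)}
  let B : Set ℝ := {τ | ∀ j ∈ Finset.Icc 1 k,
    0 ≤ sigma j (S + τ • R) ∧ sigma k (S + τ • R) ^ j ≤ sigma j (S + τ • R) ^ k}
  have hA : IsOpen A := by
    simp only [A, ofPred_forall]
    exact isOpen_biInter_finset fun j hj => isOpen_lt continuous_const
      (hcont j (Finset.mem_Icc.1 hj).2)
  have hB : IsClosed B := by
    simp only [B, ofPred_forall]
    refine isClosed_biInter fun j hj => ?_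
    have hj' := (Finset.mem_Icc.1 hj).2
    exact (isClosed_le continuous_const (hcont j hj')).inter
      (isClosed_le ((hcont k le_rfl).pow _) ((hcont j hj').pow _))
  have hAB : ∀ τ, τ ∈ A → τ ∈ B := by
    intro τ hτ j hj
    refine ⟨(hτ j hj).le, ?_⟩
    exact InGamma.maclaurin hk (hsym τ) (fun i h1 h2 => hτ i (Finset.mem_Icc.2 ⟨h1, h2⟩))
      (Finset.mem_Icc.1 hj).2
  have hBA : ∀ τ ∈ Icc (0 : ℝ) 1, τ ∈ B → τ ∈ A := by
    intro τ hτ hB j hj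
    obtain ⟨h1, h2⟩ := hB j hj
    refine lt_of_le_of_ne h1 fun h0 => ?_
    rw [← h0, zero_pow hk0.ne'] at h2
    exact absurd h2 (not_le.2 (pow_pos (hkpos τ hτ) _))
  have hsub : Icc (0 : ℝ) 1 ⊆ A := by
    refine isPreconnected_Icc.subset_left_of_subset_union hA hB.isOpen_compl ?_ ?_ ?_
    · exact disjoint_left.2 fun τ h1 h2 => h2 (hAB τ h1)
    · intro τ hτ
      by_cases hb : τ ∈ B
      · exact Or.inl (hBA τ hτ hb)
      · exact Or.inr hb
    · refine ⟨1, ⟨by norm_num, by norm_num⟩, fun j hj => ?_⟩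
      rw [one_smul]
      exact h j (Finset.mem_Icc.1 hj).1 (Finset.mem_Icc.1 hj).2
  intro j h1 h2
  have := hsub (show (0 : ℝ) ∈ Icc (0 : ℝ) 1 from ⟨le_rfl, by norm_num⟩) j (Finset.mem_Icc.2 ⟨h1, h2⟩)
  simpa using this

end Garding

/-! ### The algebraic inequality that makes the maximum principle work. -/

section ConeInequality

variable {n : ℕ}

theorem sum_sq_le_of_mem {a : Fin n → ℝ} {q : ℝ} (ha : ∑ i, a i ^ 2 = q ^ 2) (i : Fin n) :
    a i ^ 2 ≤ q ^ 2 := by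
  rw [← ha]
  exact Finset.single_le_sum (f := fun i => a i ^ 2) (fun j _ => sq_nonneg _) (Finset.mem_univ i)

/-- The crude estimate, for the cases in which some other term dominates and the sign of this one
does not matter. -/
theorem lower_order_bound {T a : Fin n → ℝ} {s r q : ℝ} (hT : ∀ i, 0 ≤ T i)
    (ha : ∑ i, a i ^ 2 = q ^ 2) :
    -((|s| + |r|) * q ^ 2 * ∑ i, T i) ≤ ∑ i, T i * (s * a i ^ 2 - r / 2 * q ^ 2) := by
  rw [Finset.mul_sum, ← Finset.sum_neg_distrib]
  refine Finset.sum_le_sum fun i _ => ?_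
  have h1 := sum_sq_le_of_mem ha i
  have h2 : -(|s| * q ^ 2) ≤ s * a i ^ 2 := by
    have := neg_abs_le s
    nlinarith [sq_nonneg (a i), abs_nonneg s]
  have h3 : r / 2 * q ^ 2 ≤ |r| * q ^ 2 := by
    have := le_abs_self r
    nlinarith [sq_nonneg q, abs_nonneg r]
  nlinarith [hT i]

/-- The weights of the large components of `w` are bounded below. -/
theorem weighted_sq_lower_bound {T l a w : Fin n → ℝ} {A : Fin n → Fin n → ℝ}
    {C q φ m c₁ ν : ℝ} (hC : 0 ≤ C) (hm : 0 < m) (hφ : m ≤ φ) (hc₁ : 0 < c₁) (hc₁' : c₁ ≤ 1)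
    (hq : 1 ≤ q) (hqC : n * (2 * n * C / m * (1 / c₁ + 1)) ≤ q ^ 2 / 4)
    (ha : ∑ i, a i ^ 2 = q ^ 2) (hT : ∀ i, 0 ≤ T i)
    (hord : ∀ i j, l i ≤ l j → T j ≤ T i) (hA : ∀ i j, |A i j| ≤ C)
    (hw : ∀ i, a i * (l i + ν) - ∑ j, A i j * a j = -(q ^ 2 / 2) * φ * w i)
    (hwa : q ^ 2 ≤ ∑ i, w i * a i)
    (i₀ : Fin n) (hi₀ : c₁ * q ^ 2 * (∑ i, T i) ≤ T i₀ * a i₀ ^ 2) (hτ : 0 < ∑ i, T i) :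
    c₁ * (c₁ / (4 * n)) ^ 2 * q ^ 2 * (∑ i, T i) ≤ ∑ i, T i * w i ^ 2 := by
  set τ := ∑ i, T i
  have hn : (0 : ℝ) < n := by
    have := i₀.pos
    exact_mod_cast this
  have hq0 : 0 < q := by linarith
  have hφ0 : 0 < φ := by linarith
  have hTτ : ∀ i, T i ≤ τ := fun i =>
    Finset.single_le_sum (f := T) (fun j _ => hT j) (Finset.mem_univ i)
  have haq : ∀ i, a i ^ 2 ≤ q ^ 2 := sum_sq_le_of_mem ha
  have haq' : ∀ i, |a i| ≤ q := fun i => abs_le_of_sq_le_sq (haq i) hq0.le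
  have hT0 : c₁ * τ ≤ T i₀ := by
    have : c₁ * τ * q ^ 2 ≤ T i₀ * q ^ 2 := by nlinarith [hT i₀, haq i₀]
    exact le_of_mul_le_mul_right this (by positivity)
  have ha0 : c₁ * q ^ 2 ≤ a i₀ ^ 2 := by
    have : c₁ * q ^ 2 * τ ≤ a i₀ ^ 2 * τ := by nlinarith [hTτ i₀, sq_nonneg (a i₀)]
    exact le_of_mul_le_mul_right this hτ
  have ha0' : 0 < a i₀ ^ 2 := by
    have : 0 < c₁ * q ^ 2 := by positivity
    linarith
  set θ := 2 * n * C / m with hθ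
  have hθ0 : 0 ≤ θ := by positivity
  -- The contribution of `A` to w_i a_i; it stays bounded as q grows, with bound θ.
  set e : Fin n → ℝ := fun i => 2 / (q ^ 2 * φ) * (a i * ∑ j, A i j * a j) with he
  have hebound : ∀ i, |e i| ≤ θ := by
    intro i
    have h1 : |∑ j, A i j * a j| ≤ n * (C * q) := by
      refine (Finset.abs_sum_le_sum_abs _ _).trans ?_
      have : ∑ j : Fin n, |A i j * a j| ≤ ∑ j : Fin n, C * q := Finset.sum_le_sum fun j _ => by
        rw [abs_mul]; exact mul_le_mul (hA i j) (haq' j) (abs_nonneg _) hC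
      simpa using this
    rw [he]
    simp only
    rw [abs_mul, abs_mul, abs_of_pos (by positivity : (0 : ℝ) < 2 / (q ^ 2 * φ))]
    calc 2 / (q ^ 2 * φ) * (|a i| * |∑ j, A i j * a j|) ≤ 2 / (q ^ 2 * φ) * (q * (n * (C * q))) := by
          have := haq' i
          gcongr
      _ = 2 * n * C / φ := by field_simp
      _ ≤ θ := by rw [hθ]; gcongr
  have hwe : ∀ i, w i * a i = -(2 / (q ^ 2 * φ)) * (a i ^ 2 * (l i + ν)) + e i := by
    intro i
    have h1 := hw i
    have h2 : w i = -(2 / (q ^ 2 * φ)) * (a i * (l i + ν) - ∑ j, A i j * a j) := by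
      rw [h1]; field_simp
    rw [h2, he]; ring
  by_contra hcon
  push Not at hcon
  -- Chosen so that n κ q² / c₁ = q² / 4 in the final sum.
  set κ := c₁ / (4 * n) with hκ
  have hκ0 : 0 < κ := by positivity
  have hsmall : ∀ j, T i₀ ≤ T j → |w j| ≤ κ * q := by
    intro j hj
    by_contra h
    push Not at h
    have h1 : (κ * q) ^ 2 ≤ w j ^ 2 := by
      rw [← sq_abs (w j)]; gcongr
    have h2 : T j * w j ^ 2 ≤ ∑ i, T i * w i ^ 2 :=
      Finset.single_le_sum (f := fun i => T i * w i ^ 2)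
        (fun i _ => mul_nonneg (hT i) (sq_nonneg _)) (Finset.mem_univ j)
    have h3 : c₁ * τ * (κ * q) ^ 2 ≤ T j * w j ^ 2 :=
      mul_le_mul (hT0.trans hj) h1 (by positivity) (hT j)
    have h4 : c₁ * κ ^ 2 * q ^ 2 * τ = c₁ * τ * (κ * q) ^ 2 := by ring
    linarith
  have hw0 : |w i₀ * a i₀| ≤ κ * q ^ 2 := by
    rw [abs_mul]
    have := mul_le_mul (hsmall i₀ le_rfl) (haq' i₀) (abs_nonneg _) (by positivity)
    linarith [show κ * q * q = κ * q ^ 2 by ring]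
  -- If the weight at j is at least that at i₀, then w_j is small by the assumed failure. Otherwise
  -- the ordering gives l_j > l_{i₀}, and the critical point equation bounds w_j a_j above by a_j² /
  -- a_{i₀}² times its value at i₀, up to θ.
  have hall : ∀ j, w j * a j ≤ (κ * q ^ 2 + θ) / c₁ + θ := by
    intro j
    have hc1 : κ * q ^ 2 + θ ≤ (κ * q ^ 2 + θ) / c₁ := by
      rw [le_div_iff₀ hc₁]
      nlinarith [show 0 ≤ κ * q ^ 2 + θ by positivity]
    by_cases hj : T i₀ ≤ T j
    · have := mul_le_mul (hsmall j hj) (haq' j) (abs_nonneg _) (by positivity)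
      rw [← abs_mul] at this
      linarith [le_abs_self (w j * a j), show κ * q * q = κ * q ^ 2 by ring]
    · have hl : l i₀ < l j := by
        by_contra h; push Not at h
        exact hj (hord _ _ h)
      have h1 : w j * a j ≤ -(2 / (q ^ 2 * φ)) * (a j ^ 2 * (l i₀ + ν)) + θ := by
        rw [hwe j]
        have h2 : a j ^ 2 * (l i₀ + ν) ≤ a j ^ 2 * (l j + ν) :=
          mul_le_mul_of_nonneg_left (by linarith) (sq_nonneg _)
        have h3 : 0 ≤ 2 / (q ^ 2 * φ) := by positivity
        nlinarith [le_abs_self (e j), hebound j]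
      have h2 : -(2 / (q ^ 2 * φ)) * (l i₀ + ν) = (w i₀ * a i₀ - e i₀) / a i₀ ^ 2 := by
        rw [hwe i₀, add_sub_cancel_right, eq_div_iff ha0'.ne']; ring
      have h3 : -(2 / (q ^ 2 * φ)) * (a j ^ 2 * (l i₀ + ν)) =
          (a j ^ 2 / a i₀ ^ 2) * (w i₀ * a i₀ - e i₀) := by
        rw [show -(2 / (q ^ 2 * φ)) * (a j ^ 2 * (l i₀ + ν)) =
          a j ^ 2 * (-(2 / (q ^ 2 * φ)) * (l i₀ + ν)) by ring, h2]
        ring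
      have h4 : w i₀ * a i₀ - e i₀ ≤ κ * q ^ 2 + θ := by
        linarith [le_abs_self (w i₀ * a i₀), neg_abs_le (e i₀), hebound i₀]
      have h5 : a j ^ 2 / a i₀ ^ 2 ≤ 1 / c₁ := by
        rw [div_le_div_iff₀ ha0' hc₁]
        nlinarith [haq j]
      have h6 : (a j ^ 2 / a i₀ ^ 2) * (w i₀ * a i₀ - e i₀) ≤ 1 / c₁ * (κ * q ^ 2 + θ) :=
        (mul_le_mul_of_nonneg_left h4 (by positivity)).trans
          (mul_le_mul_of_nonneg_right h5 (by positivity))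
      have h7 : 1 / c₁ * (κ * q ^ 2 + θ) = (κ * q ^ 2 + θ) / c₁ := by ring
      linarith
  -- Summation gives at most q²/4 + q²/4, while the sum is at least q².
  have hsum : ∑ j, w j * a j ≤ n * ((κ * q ^ 2 + θ) / c₁ + θ) := by
    have := Finset.sum_le_sum (s := Finset.univ) fun j _ => hall j
    simpa only [Finset.sum_const, Finset.card_univ, Fintype.card_fin, nsmul_eq_mul] using this
  have hkq : n * ((κ * q ^ 2 + θ) / c₁ + θ) = q ^ 2 / 4 + n * (θ * (1 / c₁ + 1)) := by
    rw [hκ]; field_simp; ring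
  have : 0 < q ^ 2 := by positivity
  linarith

/-- Either the zeroth order term is positive, or the gradient direction carries a definite part of
the weights. -/
theorem gradient_weight_dichotomy {T l a : Fin n → ℝ} {A B : Fin n → Fin n → ℝ}
    {s r q C : ℝ} (hr : r ≠ 0) (hT : ∀ i, 0 ≤ T i)
    (hTl : 0 ≤ ∑ i, T i * l i) (hA : ∀ i j, |A i j| ≤ C)
    (hB : ∀ i, B i i = l i + r / 2 * q ^ 2 - s * a i ^ 2 - A i i)
    (hqC : 8 * C ≤ |r| * q ^ 2)
    (hX : ∑ i, T i * ∑ j, B i j ^ 2 ≤ (|r| / 8) ^ 2 * q ^ 4 * ∑ i, T i) :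
    |r| / 4 * q ^ 2 * (∑ i, T i) ≤ ∑ i, T i * (s * a i ^ 2 - r / 2 * q ^ 2) ∨
      |r| / 4 * q ^ 2 * (∑ i, T i) ≤ (|s| + |r|) * ∑ i, T i * a i ^ 2 := by
  set τ := ∑ i, T i with hτ
  have hτ0 : 0 ≤ τ := Finset.sum_nonneg fun i _ => hT i
  have hTa : 0 ≤ ∑ i, T i * a i ^ 2 := Finset.sum_nonneg fun i _ =>
    mul_nonneg (hT i) (sq_nonneg _)
  have hexp : ∑ i, T i * (s * a i ^ 2 - r / 2 * q ^ 2) =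
      s * (∑ i, T i * a i ^ 2) - r / 2 * q ^ 2 * τ := by
    rw [hτ, Finset.mul_sum, Finset.mul_sum, ← Finset.sum_sub_distrib]
    exact Finset.sum_congr rfl fun i _ => by ring
  rw [hexp]
  have hrTa : 0 ≤ |r| * ∑ i, T i * a i ^ 2 := mul_nonneg (abs_nonneg r) hTa
  -- For r < 0 the term -r/2 q² is favourable and only the s-term can spoil it, which requires a
  -- large ∑ T_i a_i². For r > 0 Cauchy-Schwarz makes ∑ T_i B_ii small; since ∑ T_i l_i ≥ 0, only
  -- the s-term can compensate r/2 q² ∑ T_i.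
  rcases lt_or_gt_of_ne hr with hneg | hpos
  · by_cases hc : |r| / 4 * q ^ 2 * τ ≤ s * (∑ i, T i * a i ^ 2) - r / 2 * q ^ 2 * τ
    · exact Or.inl hc
    · push Not at hc
      right
      have h1 : -(|s| * ∑ i, T i * a i ^ 2) ≤ s * ∑ i, T i * a i ^ 2 := by
        rw [← neg_mul]
        exact mul_le_mul_of_nonneg_right (neg_abs_le s) hTa
      rw [abs_of_neg hneg] at *
      linarith
  · right
    rw [abs_of_pos hpos] at *
    have hBii : ∑ i, T i * B i i = ∑ i, T i * l i + r / 2 * q ^ 2 * τ -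
        s * (∑ i, T i * a i ^ 2) - ∑ i, T i * A i i := by
      rw [hτ, Finset.mul_sum, Finset.mul_sum, ← Finset.sum_add_distrib,
        ← Finset.sum_sub_distrib, ← Finset.sum_sub_distrib]
      refine Finset.sum_congr rfl fun i _ => ?_
      rw [hB i]; ring
    have hAii : ∑ i, T i * A i i ≤ C * τ := by
      rw [hτ, Finset.mul_sum]
      refine Finset.sum_le_sum fun i _ => ?_
      rw [mul_comm]
      exact mul_le_mul_of_nonneg_right ((le_abs_self _).trans (hA i i)) (hT i)
    have hCS : (∑ i, T i * B i i) ^ 2 ≤ τ * ∑ i, T i * ∑ j, B i j ^ 2 := by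
      have h1 := Finset.sum_sq_le_sum_mul_sum_of_sq_le_mul Finset.univ
        (r := fun i => T i * B i i) (f := T) (g := fun i => T i * B i i ^ 2)
        (fun i _ => hT i) (fun i _ => mul_nonneg (hT i) (sq_nonneg _))
        (fun i _ => le_of_eq (by ring))
      refine h1.trans (mul_le_mul_of_nonneg_left ?_ hτ0)
      refine Finset.sum_le_sum fun i _ => mul_le_mul_of_nonneg_left ?_ (hT i)
      exact Finset.single_le_sum (f := fun j => B i j ^ 2) (fun j _ => sq_nonneg _)
        (Finset.mem_univ i)
    have hB8 : ∑ i, T i * B i i ≤ r / 8 * q ^ 2 * τ := by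
      refine abs_le_of_sq_le_sq' (hCS.trans ?_) (by positivity) |>.2
      calc τ * ∑ i, T i * ∑ j, B i j ^ 2 ≤ τ * ((r / 8) ^ 2 * q ^ 4 * τ) :=
            mul_le_mul_of_nonneg_left hX hτ0
        _ = (r / 8 * q ^ 2 * τ) ^ 2 := by ring
    have hs : s * ∑ i, T i * a i ^ 2 ≤ |s| * ∑ i, T i * a i ^ 2 :=
      mul_le_mul_of_nonneg_right (le_abs_self s) hTa
    have h8 : 8 * C * τ ≤ r * q ^ 2 * τ := mul_le_mul_of_nonneg_right hqC hτ0
    linarith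

set_option maxHeartbeats 1000000 in
/-- The algebraic inequality behind the gradient estimate. Here `T` stands for the derivatives of
`σ_k` at a diagonal matrix with entries `l`, `a` for the gradient, `B` for the part of the Hessian
that enters the linearized operator, and `w` is determined by the critical point equations. -/
theorem cone_inequality (n : ℕ) (s r γ C : ℝ) (hγ : 0 ≤ γ) (hrγ : r ≠ 0 ∨ 0 < γ) (hC : 0 ≤ C) :
    ∃ Λ ε c : ℝ, 0 ≤ Λ ∧ 0 < ε ∧ ε ≤ 1 ∧ 0 < c ∧ ∀ m : ℝ, 0 < m → ∃ q₀ : ℝ, 1 ≤ q₀ ∧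
      ∀ (φ q D : ℝ) (T l a w : Fin n → ℝ) (A B : Fin n → Fin n → ℝ), m ≤ φ → φ ≤ ε → q₀ ≤ q →
        ∑ i, a i ^ 2 = q ^ 2 → (∀ i, 0 ≤ T i) → (∀ i j, l i ≤ l j → T j ≤ T i) →
        0 ≤ ∑ i, T i * l i → (∀ i j, |A i j| ≤ C) →
        (∀ i j, B i j =
          (if i = j then l i + r / 2 * q ^ 2 - γ * D else 0) - s * a i * a j - A i j) →
        (∀ i, ∑ j, B i j * a j = -(q ^ 2 / 2) * φ * w i) → q ^ 2 ≤ ∑ i, w i * a i →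
        c * φ * q ^ 2 * ∑ i, T i ≤ 2 / q ^ 2 * ∑ i, T i * ∑ j, B i j ^ 2 +
          φ * ∑ i, T i * (s * a i ^ 2 - r / 2 * q ^ 2) +
          Λ * φ * ∑ i, T i * (w i ^ 2 + γ * q ^ 2) := by
  -- When γ > 0 a large Λ suffices. When γ = 0, the unknown trace D drops out of B and r ≠ 0 is
  -- needed.
  rcases hγ.lt_or_eq with hγ' | hγ'
  · refine ⟨(|s| + |r| + 1) / γ, 1, 1, by positivity, one_pos, le_rfl, one_pos, fun m hm =>
      ⟨1, le_rfl, ?_⟩⟩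
    intro φ q D T l a w A B hφ _ hq ha hT _ _ _ _ _ _
    have h1 := lower_order_bound (s := s) (r := r) hT ha
    have h2 : γ * q ^ 2 * ∑ i, T i ≤ ∑ i, T i * (w i ^ 2 + γ * q ^ 2) := by
      rw [Finset.mul_sum]
      refine Finset.sum_le_sum fun i _ => ?_
      nlinarith [mul_nonneg (hT i) (sq_nonneg (w i))]
    have h3 : 0 ≤ 2 / q ^ 2 * ∑ i, T i * ∑ j, B i j ^ 2 :=
      mul_nonneg (by positivity) (Finset.sum_nonneg fun i _ => mul_nonneg (hT i)
        (Finset.sum_nonneg fun j _ => sq_nonneg _))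
    have hφ0 : 0 < φ := by linarith
    have h4 : (|s| + |r| + 1) / γ * φ * (γ * q ^ 2 * ∑ i, T i) ≤
        (|s| + |r| + 1) / γ * φ * ∑ i, T i * (w i ^ 2 + γ * q ^ 2) :=
      mul_le_mul_of_nonneg_left h2 (by positivity)
    have h5 : (|s| + |r| + 1) / γ * φ * (γ * q ^ 2 * ∑ i, T i) =
        φ * ((|s| + |r| + 1) * q ^ 2 * ∑ i, T i) := by
      field_simp
    have h6 := mul_le_mul_of_nonneg_left h1 hφ0.le
    linarith
  · have hr : r ≠ 0 := hrγ.resolve_right (by rw [← hγ']; exact lt_irrefl _)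
    have hr0 : 0 < |r| := abs_pos.2 hr
    rcases Nat.eq_zero_or_pos n with rfl | hn
    · exact ⟨0, 1, 1, le_rfl, one_pos, le_rfl, one_pos, fun m _ => ⟨1, le_rfl, by
        intro φ q D T l a w A B _ _ _ _ _ _ _ _ _ _ _; simp⟩⟩
    have hn' : (0 : ℝ) < n := by exact_mod_cast hn
    have hn1 : (1 : ℝ) ≤ n := by exact_mod_cast hn
    -- The fraction of the gradient weight from the dichotomy, divided by n for the pigeonhole
    -- choice of i₀.
    set c₁ : ℝ := |r| / (4 * (|s| + |r|)) / n with hc₁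
    have hc₁0 : 0 < c₁ := by positivity
    have hc₁1 : c₁ ≤ 1 := by
      rw [hc₁, div_div, div_le_one (by positivity)]
      nlinarith [abs_nonneg s, mul_nonneg (abs_nonneg s) (sub_nonneg.2 hn1),
        mul_nonneg hr0.le (sub_nonneg.2 hn1)]
    -- The bound of `weighted_sq_lower_bound` times Λ is exactly (|s| + |r| + 1) q² ∑ T_i, enough to
    -- absorb the lower order terms with one unit left.
    set Λ : ℝ := (|s| + |r| + 1) / (c₁ * (c₁ / (4 * n)) ^ 2) with hΛ
    have hΛ0 : 0 ≤ Λ := by positivity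
    set δ : ℝ := (|r| / 8) ^ 2 with hδ
    have hδ0 : 0 < δ := by positivity
    -- The smallness of φ lets the Hessian term, of size 2 δ q² ∑ T_i without a factor φ, absorb the
    -- lower order terms. The lower bound m enters only q₀.
    refine ⟨Λ, min 1 (2 * δ / (|s| + |r| + 1)), min 1 (|r| / 4), hΛ0, by positivity,
      min_le_left _ _, by positivity, fun m hm => ?_⟩
    refine ⟨1 + 8 * C / |r| + 4 * (n * (2 * n * C / m * (1 / c₁ + 1))), by
      have : 0 ≤ 8 * C / |r| + 4 * (n * (2 * n * C / m * (1 / c₁ + 1))) := by positivity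
      linarith, ?_⟩
    intro φ q D T l a w A B hφ hφε hq ha hT hord hTl hA hB hBa hwa
    have hφ0 : 0 < φ := by linarith
    have hp1 : 0 ≤ 8 * C / |r| := by positivity
    have hp2 : 0 ≤ 4 * (n * (2 * n * C / m * (1 / c₁ + 1))) := by positivity
    have hq1 : 1 ≤ q := by linarith
    have hqq : q ≤ q ^ 2 := by nlinarith
    have hqC : n * (2 * n * C / m * (1 / c₁ + 1)) ≤ q ^ 2 / 4 := by linarith
    have hqC' : 8 * C ≤ |r| * q ^ 2 := by
      have : 8 * C / |r| ≤ q ^ 2 := by linarith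
      rw [div_le_iff₀ hr0] at this
      linarith
    subst hγ'
    set τ := ∑ i, T i with hτ
    have hτ0 : 0 ≤ τ := Finset.sum_nonneg fun i _ => hT i
    set X := ∑ i, T i * ∑ j, B i j ^ 2 with hX
    have hX0 : 0 ≤ X := Finset.sum_nonneg fun i _ => mul_nonneg (hT i)
      (Finset.sum_nonneg fun j _ => sq_nonneg _)
    have hlow := lower_order_bound (s := s) (r := r) hT ha
    rw [← hτ] at hlow
    have hlow' := mul_le_mul_of_nonneg_left hlow hφ0.le
    have hw0 : 0 ≤ ∑ i, T i * (w i ^ 2 + 0 * q ^ 2) :=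
      Finset.sum_nonneg fun i _ => mul_nonneg (hT i) (by nlinarith [sq_nonneg (w i)])
    have hcle : min 1 (|r| / 4) * φ * q ^ 2 * τ ≤ 1 * φ * q ^ 2 * τ := by
      gcongr; exact min_le_left _ _
    have hcle' : min 1 (|r| / 4) * φ * q ^ 2 * τ ≤ |r| / 4 * φ * q ^ 2 * τ := by
      gcongr; exact min_le_right _ _
    -- A large weighted Hessian already wins; a small one is the hypothesis of the dichotomy.
    by_cases hXδ : δ * q ^ 4 * τ ≤ X
    · have h1 : 2 / q ^ 2 * (δ * q ^ 4 * τ) ≤ 2 / q ^ 2 * X :=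
        mul_le_mul_of_nonneg_left hXδ (by positivity)
      have h2 : 2 / q ^ 2 * (δ * q ^ 4 * τ) = 2 * δ * (q ^ 2 * τ) := by
        field_simp
      have h3 : φ * (|s| + |r| + 1) ≤ 2 * δ := by
        have := hφε.trans (min_le_right _ _)
        rwa [le_div_iff₀ (by positivity)] at this
      have h4 : φ * (|s| + |r| + 1) * (q ^ 2 * τ) ≤ 2 * δ * (q ^ 2 * τ) :=
        mul_le_mul_of_nonneg_right h3 (by positivity)
      have h5 : 0 ≤ Λ * φ * ∑ i, T i * (w i ^ 2 + 0 * q ^ 2) := by positivity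
      linarith
    · push Not at hXδ
      have hXterm : 0 ≤ 2 / q ^ 2 * X := by positivity
      rcases hτ0.lt_or_eq with hτp | hτz
      swap
      · have hTz : ∀ i, T i = 0 := by
          intro i
          have := (Finset.sum_eq_zero_iff_of_nonneg (fun i _ => hT i)).1 (hτ.symm.trans hτz.symm)
          exact this i (Finset.mem_univ i)
        have e1 : X = 0 := Finset.sum_eq_zero fun i _ => by rw [hTz i, zero_mul]
        have e2 : ∑ i, T i * (s * a i ^ 2 - r / 2 * q ^ 2) = 0 :=
          Finset.sum_eq_zero fun i _ => by rw [hTz i, zero_mul]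
        have e3 : ∑ i, T i * (w i ^ 2 + 0 * q ^ 2) = 0 :=
          Finset.sum_eq_zero fun i _ => by rw [hTz i, zero_mul]
        rw [← hτz, e1, e2, e3]
        simp only [mul_zero, add_zero, le_refl]
      have hdich := gradient_weight_dichotomy (s := s) (a := a) hr hT hTl hA (fun i => by
        rw [hB i i, if_pos rfl]; ring) hqC' hXδ.le
      rcases hdich with hgood | hgood
      · have h1 := mul_le_mul_of_nonneg_left hgood hφ0.le
        have h5 : 0 ≤ Λ * φ * ∑ i, T i * (w i ^ 2 + 0 * q ^ 2) := by positivity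
        linarith
      · have hi₀ : ∃ i₀, c₁ * q ^ 2 * τ ≤ T i₀ * a i₀ ^ 2 := by
          by_contra hcon
          push Not at hcon
          have h1 : ∑ i, T i * a i ^ 2 < ∑ i : Fin n, c₁ * q ^ 2 * τ :=
            Finset.sum_lt_sum_of_nonempty ⟨⟨0, hn⟩, Finset.mem_univ _⟩ fun i _ => hcon i
          simp only [Finset.sum_const, Finset.card_univ, Fintype.card_fin, nsmul_eq_mul] at h1
          have h2 : (|s| + |r|) * (n * (c₁ * q ^ 2 * τ)) = |r| / 4 * q ^ 2 * τ := by
            rw [hc₁]; field_simp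
          have h3 := mul_lt_mul_of_pos_left h1 (by positivity : 0 < |s| + |r|)
          linarith
        obtain ⟨i₀, hi₀⟩ := hi₀
        -- Applying B to the gradient turns -s a_i a_j into -s q² a_i. Together with r/2 q² this is
        -- a scalar ν, so the critical equation is diagonal up to `A`.
        have hmain := weighted_sq_lower_bound (w := w) (A := A) (ν := r / 2 * q ^ 2 - s * q ^ 2)
          hC hm hφ hc₁0 hc₁1 hq1 hqC ha hT hord hA (by
            intro i
            rw [← hBa i]
            have e : ∀ j, B i j * a j = (if i = j then (l i + r / 2 * q ^ 2) * a j else 0) -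
                s * a i * a j ^ 2 - A i j * a j := by
              intro j; rw [hB i j]; split_ifs <;> ring
            simp only [e, Finset.sum_sub_distrib, ← Finset.mul_sum, ha, Finset.sum_ite_eq,
              Finset.mem_univ, if_true]
            ring) hwa i₀ hi₀ hτp
        have h1 : Λ * φ * (c₁ * (c₁ / (4 * n)) ^ 2 * q ^ 2 * τ) ≤
            Λ * φ * ∑ i, T i * (w i ^ 2 + 0 * q ^ 2) := by
          refine mul_le_mul_of_nonneg_left ?_ (by positivity)
          simpa using hmain
        have h2 : Λ * φ * (c₁ * (c₁ / (4 * n)) ^ 2 * q ^ 2 * τ) =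
            (|s| + |r| + 1) * φ * (q ^ 2 * τ) := by
          rw [hΛ]; field_simp
        linarith

end ConeInequality

/-! ### The differential inequality at a maximum of the test function. -/

section JetInequality

/-- The square produced by the first order condition costs at most φ z², and z differs from x by
2ηty/φ, whose square is absorbed by η y² since η is small against φ. With x and y the derivatives of
u and t along a line, the choice φ'' = (2Λ + 2) φ' leaves Λ φ z² over. -/
theorem quadratic_completion {Λ φ η t x y : ℝ} (hΛ : 0 ≤ Λ) (hφ : 0 < φ) (hφ1 : φ ≤ 1)
    (hη : 0 < η) (hηφ : η * (8 * (Λ + 1)) ≤ φ) (ht : t ^ 2 ≤ 1) :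
    η * y ^ 2 + Λ * φ * ((φ * x + 2 * η * t * y) / φ) ^ 2 ≤
      (2 * Λ + 2) * φ * x ^ 2 + 2 * η * y ^ 2 - (φ * x + 2 * η * t * y) ^ 2 := by
  set z := (φ * x + 2 * η * t * y) / φ with hz
  have hz1 : φ * x + 2 * η * t * y = φ * z := by rw [hz]; field_simp
  rw [hz1]
  have hz2 : z = x + 2 * η * t * y / φ := by rw [hz]; field_simp
  set e := 2 * η * t * y / φ with he
  have h1 : z ^ 2 ≤ 2 * x ^ 2 + 2 * e ^ 2 := by rw [hz2]; nlinarith [sq_nonneg (x - e)]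
  have h2 : (φ * z) ^ 2 ≤ φ * z ^ 2 := by
    rw [mul_pow]; nlinarith [sq_nonneg z, mul_nonneg (mul_nonneg hφ.le (sub_nonneg.2 hφ1)) (sq_nonneg z)]
  have h3 : 2 * (Λ + 1) * φ * e ^ 2 ≤ η * y ^ 2 := by
    have : 2 * (Λ + 1) * φ * e ^ 2 = (η * (8 * (Λ + 1)) / φ) * (t ^ 2 * (η * y ^ 2)) := by
      rw [he]; field_simp; ring
    rw [this]
    have h4 : η * (8 * (Λ + 1)) / φ ≤ 1 := (div_le_one hφ).2 hηφ
    have h5 : 0 ≤ η * (8 * (Λ + 1)) / φ := by positivity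
    calc (η * (8 * (Λ + 1)) / φ) * (t ^ 2 * (η * y ^ 2)) ≤ 1 * (1 * (η * y ^ 2)) := by gcongr
      _ = η * y ^ 2 := by ring
  have h6 : (Λ + 1) * φ * z ^ 2 ≤ (Λ + 1) * φ * (2 * x ^ 2 + 2 * e ^ 2) :=
    mul_le_mul_of_nonneg_left h1 (by positivity)
  linarith

/-- If f^(k+1) > σ, replacing one factor σ by f^(k+1) in the (k+1)-st power of the product relation,
followed by Maclaurin, gives f^(k+1) ≤ τ e. The bound needs no positive lower bound for f. -/
theorem pow_le_sigma_add {k : ℕ} {σ e τ f : ℝ} (hσ : 0 < σ) (he : 0 < e) (hτ : 0 < τ)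
    (hf : 0 < f) (hprod : f ^ (k + 2) = τ * σ) (hmac : σ ^ k ≤ e ^ (k + 1)) :
    f ^ (k + 1) ≤ σ + τ * e := by
  by_cases h : f ^ (k + 1) ≤ σ
  · have : 0 < τ * e := by positivity
    linarith
  · push Not at h
    suffices h' : f ^ (k + 1) ≤ τ * e by linarith
    refine le_of_pow_le_pow_left₀ (Nat.succ_ne_zero k) (by positivity) ?_
    have h1 : σ * (f ^ (k + 1)) ^ (k + 1) ≤ σ * (τ * e) ^ (k + 1) := by
      calc σ * (f ^ (k + 1)) ^ (k + 1) ≤ f ^ (k + 1) * (f ^ (k + 1)) ^ (k + 1) := by gcongr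
        _ = (f ^ (k + 2)) ^ (k + 1) := by ring
        _ = (τ * σ) ^ (k + 1) := by rw [hprod]
        _ = σ * (τ ^ (k + 1) * σ ^ k) := by ring
        _ ≤ σ * (τ ^ (k + 1) * e ^ (k + 1)) := by gcongr
        _ = σ * (τ * e) ^ (k + 1) := by ring
    exact le_of_mul_le_mul_left h1 hσ

variable {n : ℕ}

/-- The derivatives up to third order of a solution at an interior maximum of
`|∇u|² exp (φ(u) + η t²)`, in normal coordinates that diagonalize `W[u] - u_tt⁻¹ du_t ⊗ du_t`. Here
`φ₁ = φ'(u)`, `φ₂ = φ''(u)`, `a = ∇u`, `b = ∇u_t`, `h = ∇²u`; the third derivatives `Y`, `Z`, `X`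
are contracted with `a`, and `E`, `G`, `N` are the error terms coming from the derivatives of the
metric, the Christoffel symbols and the tensor `A`. -/
structure MaximumJet (n k : ℕ) (s r γ φ₁ φ₂ η C K : ℝ) where
  (q ut utt t f P : ℝ)
  (l a b Z X E G N : Fin n → ℝ)
  Y : ℝ
  (h A : Fin n → Fin n → ℝ)
  q_pos : 0 < q
  f_pos : 0 < f
  utt_pos : 0 < utt
  t_sq_le : t ^ 2 ≤ 1
  sum_sq : ∑ i, a i ^ 2 = q ^ 2
  cone : ∀ j, j ≤ k + 1 → 0 < esymmOn Finset.univ l j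
  A_le : ∀ i j, |A i j| ≤ C
  S_eq : ∀ i j, (if i = j then l i else 0) = h i j + s * a i * a j + A i j +
    (if i = j then γ * ∑ m, h m m - r / 2 * q ^ 2 else 0) - b i * b j / utt
  crit_space : ∀ i, ∑ j, h i j * a j = -(q ^ 2 / 2) * φ₁ * a i
  crit_time : ∑ j, b j * a j = -(q ^ 2 / 2) * (φ₁ * ut + 2 * η * t)
  E_le : ∀ m, |E m| ≤ C * q ^ 2
  G_le : ∀ m, |G m| ≤ C * q ^ 2
  N_le : ∀ m, |N m| ≤ C * q ^ 2
  f_pow : f ^ (k + 2) = utt * esymmOn Finset.univ l (k + 1)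
  P_ge : -((k + 2) * K * f ^ (k + 1) * q) ≤ P
  eq_deriv : P = esymmOn Finset.univ l (k + 1) * Y + utt * ∑ m, esymmOn (Finset.univ.erase m) l k *
    (Z m - G m + 2 * s * a m * ∑ j, h m j * a j + N m + γ * ∑ j, (X j - G j) -
      r * ∑ i, a i * ∑ j, h i j * a j)
  second_time : ∑ i, b i ^ 2 + Y + q ^ 2 / 2 * (φ₂ * ut ^ 2 + φ₁ * utt + 2 * η) -
    q ^ 2 / 2 * (φ₁ * ut + 2 * η * t) ^ 2 ≤ 0
  second_mixed : ∀ m, ∑ i, (h m i - b m / utt * b i) ^ 2 + Z m + E m +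
    q ^ 2 / 2 * (φ₂ * (a m - b m / utt * ut) ^ 2 +
      φ₁ * (h m m - 2 * (b m / utt) * b m + (b m / utt) ^ 2 * utt) + 2 * η * (b m / utt) ^ 2) -
    q ^ 2 / 2 * (φ₁ * a m - b m / utt * (φ₁ * ut + 2 * η * t)) ^ 2 ≤ 0
  second_space : ∀ m, ∑ i, h m i ^ 2 + X m + E m +
    q ^ 2 / 2 * (φ₂ * a m ^ 2 + φ₁ * h m m) - q ^ 2 / 2 * (φ₁ * a m) ^ 2 ≤ 0

namespace MaximumJet

variable {k : ℕ} {s r γ φ₁ φ₂ η C K : ℝ} (J : MaximumJet n k s r γ φ₁ φ₂ η C K)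

/-- The derivatives of `σ_{k+1}`. -/
noncomputable def T (m : Fin n) : ℝ := esymmOn (Finset.univ.erase m) J.l k

theorem T_pos (m : Fin n) : 0 < J.T m :=
  esymmOn_erase_pos J.cone (Finset.mem_univ m) k le_rfl

/-- The part of the Hessian entering the linearized operator. -/
noncomputable def B (i j : Fin n) : ℝ := J.h i j - J.b i / J.utt * J.b j

/-- The vector `∇u - ζ p` of the critical point equations. -/
noncomputable def w (i : Fin n) : ℝ :=
  (φ₁ * J.a i - J.b i / J.utt * (φ₁ * J.ut + 2 * η * J.t)) / φ₁

/-- The du_t part of S is exactly what B subtracts from the Hessian, so B is diagonal up to terms in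
∇u and A. -/
theorem B_eq (i j : Fin n) : J.B i j =
    (if i = j then J.l i + r / 2 * J.q ^ 2 - γ * ∑ m, J.h m m else 0) - s * J.a i * J.a j -
      J.A i j := by
  have h := J.S_eq i j
  rw [B]
  split_ifs at h ⊢ with hij
  · linear_combination -h
  · linear_combination -h

/-- The space and time critical point equations combined so that w is the only new unknown. -/
theorem B_mul_a (hφ : 0 < φ₁) (i : Fin n) :
    ∑ j, J.B i j * J.a j = -(J.q ^ 2 / 2) * φ₁ * J.w i := by
  have e : ∀ j, J.B i j * J.a j = J.h i j * J.a j - J.b i / J.utt * (J.b j * J.a j) := by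
    intro j; rw [B]; ring
  simp only [e, Finset.sum_sub_distrib, ← Finset.mul_sum, J.crit_space, J.crit_time, w]
  field_simp
  ring

/-- By the time equation ∇u_t · ∇u is a negative multiple of ζ = φ₁ u_t + 2ηt, so the correction in
w contributes a square with the good sign. -/
theorem sq_le_sum_w_mul_a (hφ : 0 < φ₁) : J.q ^ 2 ≤ ∑ i, J.w i * J.a i := by
  have hu := J.utt_pos
  have e : ∀ i, J.w i * J.a i =
      J.a i ^ 2 - (φ₁ * J.ut + 2 * η * J.t) / (φ₁ * J.utt) * (J.b i * J.a i) := by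
    intro i; rw [w]; field_simp
  simp only [e, Finset.sum_sub_distrib, ← Finset.mul_sum, J.crit_time, J.sum_sq]
  have : (φ₁ * J.ut + 2 * η * J.t) / (φ₁ * J.utt) *
      (-(J.q ^ 2 / 2) * (φ₁ * J.ut + 2 * η * J.t)) =
      -((φ₁ * J.ut + 2 * η * J.t) ^ 2 * J.q ^ 2 / (2 * (φ₁ * J.utt))) := by
    field_simp
  rw [this]
  have : 0 ≤ (φ₁ * J.ut + 2 * η * J.t) ^ 2 * J.q ^ 2 / (2 * (φ₁ * J.utt)) := by positivity
  linarith

theorem sum_T_mul_l : ∑ m, J.T m * J.l m = (k + 1) * esymmOn Finset.univ J.l (k + 1) :=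
  sum_erase_mul_esymmOn _ _ _

/-- The differential inequality at the maximum. -/
theorem main_inequality {Λ : ℝ} (hΛ : 0 ≤ Λ) (hγ : 0 ≤ γ) (hC : 0 ≤ C) (hφ : 0 < φ₁)
    (hφ1 : φ₁ ≤ 1) (hφ₂ : φ₂ = (2 * Λ + 2) * φ₁) (hη : 0 < η) (hηφ : η * (8 * (Λ + 1)) ≤ φ₁) :
    η * esymmOn Finset.univ J.l (k + 1) + J.utt * (2 / J.q ^ 2 * ∑ i, J.T i * ∑ j, J.B i j ^ 2 +
      φ₁ * ∑ i, J.T i * (s * J.a i ^ 2 - r / 2 * J.q ^ 2) +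
      Λ * φ₁ * ∑ i, J.T i * (J.w i ^ 2 + γ * J.q ^ 2)) + 2 / J.q ^ 2 * J.P -
      C * (7 + 4 * γ * n) * (J.utt * ∑ i, J.T i) ≤ 0 := by
  subst hφ₂
  have hu := J.utt_pos
  have hq := J.q_pos
  set v := J.q ^ 2 / 2 with hv
  have hv0 : 0 < v := by positivity
  set σ := esymmOn Finset.univ J.l (k + 1) with hσ
  have hσ0 : 0 < σ := J.cone (k + 1) le_rfl
  have hT := fun m => (J.T_pos m).le
  set ζ := φ₁ * J.ut + 2 * η * J.t with hζ
  -- the time direction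
  have ht : J.Y + v * (φ₁ * J.utt + η) ≤ 0 := by
    have h1 := J.second_time
    have h2 := quadratic_completion (x := J.ut) (y := 1) hΛ hφ hφ1 hη hηφ J.t_sq_le
    have h3 : 0 ≤ ∑ i, J.b i ^ 2 := Finset.sum_nonneg fun i _ => sq_nonneg _
    have h4 : 0 ≤ Λ * φ₁ * ((φ₁ * J.ut + 2 * η * J.t * 1) / φ₁) ^ 2 := by positivity
    have h5 := mul_le_mul_of_nonneg_left (h2.trans' (le_add_of_nonneg_right h4)) hv0.le
    rw [hv] at *
    linarith
  -- the mixed directions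
  have hm : ∀ m, ∑ j, J.B m j ^ 2 + J.Z m + J.E m + v * (Λ * φ₁ * J.w m ^ 2) +
      v * φ₁ * (J.h m m - J.b m * J.b m / J.utt) ≤ 0 := by
    intro m
    have h1 := J.second_mixed m
    have h2 := quadratic_completion (x := J.a m - J.b m / J.utt * J.ut) (y := -(J.b m / J.utt))
      hΛ hφ hφ1 hη hηφ J.t_sq_le
    have e : φ₁ * (J.a m - J.b m / J.utt * J.ut) + 2 * η * J.t * -(J.b m / J.utt) =
        φ₁ * J.a m - J.b m / J.utt * (φ₁ * J.ut + 2 * η * J.t) := by ring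
    rw [e, ← w] at h2
    have h4 : 0 ≤ η * (-(J.b m / J.utt)) ^ 2 := by positivity
    have h5 := mul_le_mul_of_nonneg_left (h2.trans' (le_add_of_nonneg_left h4)) hv0.le
    have e2 : J.h m m - 2 * (J.b m / J.utt) * J.b m + (J.b m / J.utt) ^ 2 * J.utt =
        J.h m m - J.b m * J.b m / J.utt := by field_simp; ring
    rw [e2] at h1
    simp only [B]
    rw [hv] at *
    linarith
  -- the space directions
  have hs : ∀ m, J.X m + J.E m + v * (Λ * φ₁ * J.a m ^ 2) + v * φ₁ * J.h m m ≤ 0 := by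
    intro m
    have h1 := J.second_space m
    have h3 : 0 ≤ ∑ i, J.h m i ^ 2 := Finset.sum_nonneg fun i _ => sq_nonneg _
    have h4 : v * (Λ * φ₁ * J.a m ^ 2) ≤
        v * ((2 * Λ + 2) * φ₁ * J.a m ^ 2 - (φ₁ * J.a m) ^ 2) := by
      refine mul_le_mul_of_nonneg_left ?_ hv0.le
      have : φ₁ * φ₁ * J.a m ^ 2 ≤ φ₁ * 1 * J.a m ^ 2 := by gcongr
      have : 0 ≤ Λ * φ₁ * J.a m ^ 2 := by positivity
      have : 0 ≤ φ₁ * J.a m ^ 2 := by positivity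
      linarith
    rw [hv] at *
    linarith
  have hs' : ∑ j, J.X j + ∑ j, J.E j + v * (Λ * φ₁ * J.q ^ 2) + v * φ₁ * ∑ j, J.h j j ≤ 0 := by
    have := Finset.sum_nonpos fun m (_ : m ∈ Finset.univ) => hs m
    simp only [Finset.sum_add_distrib, ← Finset.mul_sum, J.sum_sq] at this
    exact this
  set τ := ∑ i, J.T i with hτ
  have hτ0 : 0 ≤ τ := Finset.sum_nonneg fun m _ => hT m
  have haha : ∑ i, J.a i * ∑ j, J.h i j * J.a j = -v * φ₁ * J.q ^ 2 := by
    calc ∑ i, J.a i * ∑ j, J.h i j * J.a j = ∑ i, -v * φ₁ * J.a i ^ 2 :=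
          Finset.sum_congr rfl fun i _ => by rw [J.crit_space, ← hv]; ring
      _ = -v * φ₁ * J.q ^ 2 := by rw [← Finset.mul_sum, J.sum_sq]
  -- error terms
  have herr : ∀ m, J.E m + γ * ∑ j, J.E j + J.G m - J.N m + γ * ∑ j, J.G j ≥
      -(C * (3 + 2 * γ * n) * J.q ^ 2) := by
    intro m
    have h1 : -(n * (C * J.q ^ 2)) ≤ ∑ j, J.E j := by
      have := Finset.sum_le_sum (s := Finset.univ) fun j _ => neg_le_of_abs_le (J.E_le j)
      simpa using this
    have h2 : -(n * (C * J.q ^ 2)) ≤ ∑ j, J.G j := by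
      have := Finset.sum_le_sum (s := Finset.univ) fun j _ => neg_le_of_abs_le (J.G_le j)
      simpa using this
    have h3 := mul_le_mul_of_nonneg_left h1 hγ
    have h4 := mul_le_mul_of_nonneg_left h2 hγ
    have h5 := neg_le_of_abs_le (J.E_le m)
    have h6 := neg_le_of_abs_le (J.G_le m)
    have h7 := le_of_abs_le (J.N_le m)
    linarith
  -- pointwise inequality for each weight
  have hpt : ∀ m, ∑ j, J.B m j ^ 2 + v * φ₁ * (s * J.a m ^ 2 - r / 2 * J.q ^ 2) +
      v * (Λ * φ₁ * (J.w m ^ 2 + γ * J.q ^ 2)) - C * (3 + 2 * γ * n) * J.q ^ 2 - v * φ₁ * C +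
      v * φ₁ * J.l m +
      (J.Z m - J.G m + 2 * s * J.a m * ∑ j, J.h m j * J.a j + J.N m +
        γ * ∑ j, (J.X j - J.G j) - r * ∑ i, J.a i * ∑ j, J.h i j * J.a j) ≤ 0 := by
    intro m
    -- Differentiating the terms quadratic in ∇u doubles them. Against the single copy in S this
    -- reverses the sign of the s and r terms, while the multiples of Δu cancel.
    rw [haha, J.crit_space m, Finset.sum_sub_distrib]
    have h1 := hm m
    have h2 := mul_le_mul_of_nonneg_left hs' hγ
    have h3 := herr m
    have h4 := J.S_eq m m
    simp only [if_true] at h4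
    have h5 : J.h m m - J.b m * J.b m / J.utt = J.l m - s * J.a m ^ 2 - J.A m m -
        γ * (∑ j, J.h j j) + r / 2 * J.q ^ 2 := by
      linear_combination -h4
    rw [h5] at h1
    have h6 : v * φ₁ * J.A m m ≤ v * φ₁ * C :=
      mul_le_mul_of_nonneg_left (le_of_abs_le (J.A_le m m)) (by positivity)
    rw [← hv]
    linarith
  have hsum : ∑ m, J.T m * (∑ j, J.B m j ^ 2 + v * φ₁ * (s * J.a m ^ 2 - r / 2 * J.q ^ 2) +
      v * (Λ * φ₁ * (J.w m ^ 2 + γ * J.q ^ 2)) - C * (3 + 2 * γ * n) * J.q ^ 2 - v * φ₁ * C +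
      v * φ₁ * J.l m) + ∑ m, J.T m *
      (J.Z m - J.G m + 2 * s * J.a m * ∑ j, J.h m j * J.a j + J.N m +
        γ * ∑ j, (J.X j - J.G j) - r * ∑ i, J.a i * ∑ j, J.h i j * J.a j) ≤ 0 := by
    rw [← Finset.sum_add_distrib]
    refine Finset.sum_nonpos fun m _ => ?_
    rw [← mul_add]
    exact mul_nonpos_of_nonneg_of_nonpos (hT m) (hpt m)
  have hP := J.eq_deriv
  have hexp : ∑ m, J.T m * (∑ j, J.B m j ^ 2 + v * φ₁ * (s * J.a m ^ 2 - r / 2 * J.q ^ 2) +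
      v * (Λ * φ₁ * (J.w m ^ 2 + γ * J.q ^ 2)) - C * (3 + 2 * γ * n) * J.q ^ 2 - v * φ₁ * C +
      v * φ₁ * J.l m) = ∑ m, J.T m * ∑ j, J.B m j ^ 2 +
      v * φ₁ * (∑ m, J.T m * (s * J.a m ^ 2 - r / 2 * J.q ^ 2)) +
      v * (Λ * φ₁ * ∑ m, J.T m * (J.w m ^ 2 + γ * J.q ^ 2)) -
      (C * (3 + 2 * γ * n) * J.q ^ 2 + v * φ₁ * C) * τ + v * φ₁ * ((k + 1) * σ) := by
    rw [← J.sum_T_mul_l, hτ]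
    simp only [Finset.mul_sum, ← Finset.sum_add_distrib, ← Finset.sum_sub_distrib]
    exact Finset.sum_congr rfl fun m _ => by simp only [mul_add, mul_sub, Finset.mul_sum]; ring
  rw [hexp] at hsum
  set Q1 := ∑ m, J.T m * ∑ j, J.B m j ^ 2
  set Q2 := ∑ m, J.T m * (s * J.a m ^ 2 - r / 2 * J.q ^ 2)
  set Q3 := ∑ m, J.T m * (J.w m ^ 2 + γ * J.q ^ 2)
  set Q4 := ∑ m, J.T m *
      (J.Z m - J.G m + 2 * s * J.a m * ∑ j, J.h m j * J.a j + J.N m +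
        γ * ∑ j, (J.X j - J.G j) - r * ∑ i, J.a i * ∑ j, J.h i j * J.a j) with hQ4
  have hP' : J.P = σ * J.Y + J.utt * Q4 := hP
  -- The time inequality weighted by σ and the summed space inequalities weighted by u_tt contain
  -- the right-hand side of the differentiated equation, which is replaced by P.
  have h1 := mul_le_mul_of_nonneg_left ht hσ0.le
  have h2 := mul_le_mul_of_nonneg_left hsum hu.le
  have h3 : σ * (v * η) + J.utt * (Q1 + v * φ₁ * Q2 + v * (Λ * φ₁ * Q3)) + J.P -
      (C * (3 + 2 * γ * n) * J.q ^ 2 + v * φ₁ * C) * (J.utt * τ) ≤ 0 := by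
    -- k + 1 copies come from ∑ T_m l_m and one from the time direction; the total is nonnegative
    -- and is dropped.
    have h4 : 0 ≤ v * φ₁ * J.utt * σ * (k + 2) := by positivity
    rw [hP']
    linarith
  -- Since q² = 2v the bracket doubles to 6 + 4γn, and φ₁ ≤ 1 adds the remaining unit.
  have h5 : (C * (3 + 2 * γ * n) * J.q ^ 2 + v * φ₁ * C) * (J.utt * τ) ≤
      v * (C * (7 + 4 * γ * n)) * (J.utt * τ) := by
    refine mul_le_mul_of_nonneg_right ?_ (by positivity)
    have : v * φ₁ * C ≤ v * 1 * C := by gcongr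
    have e : J.q ^ 2 = 2 * v := by rw [hv]; ring
    rw [e]
    linarith
  have h6 : v * (η * σ + J.utt * (2 / J.q ^ 2 * Q1 + φ₁ * Q2 + Λ * φ₁ * Q3) + 2 / J.q ^ 2 * J.P -
      C * (7 + 4 * γ * n) * (J.utt * τ)) ≤ v * 0 := by
    have e : 2 / J.q ^ 2 = 1 / v := by rw [hv]; field_simp
    rw [e]
    have : v * (η * σ + J.utt * (1 / v * Q1 + φ₁ * Q2 + Λ * φ₁ * Q3) + 1 / v * J.P -
      C * (7 + 4 * γ * n) * (J.utt * τ)) = σ * (v * η) +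
        J.utt * (Q1 + v * φ₁ * Q2 + v * (Λ * φ₁ * Q3)) + J.P -
        v * (C * (7 + 4 * γ * n)) * (J.utt * τ) := by
      field_simp
    rw [this]
    linarith
  exact le_of_mul_le_mul_left h6 hv0

end MaximumJet

/-- The gradient at a maximum jet is bounded, once the parameters of the test function are chosen
suitably. -/
theorem exists_bound_maximumJet {n k : ℕ} (hkn : k + 1 ≤ n) (s r γ C K : ℝ) (hγ : 0 ≤ γ)
    (hrγ : r ≠ 0 ∨ 0 < γ) (hC : 0 ≤ C) (hK : 0 ≤ K) :
    ∃ Λ ε : ℝ, 0 ≤ Λ ∧ 0 < ε ∧ ε ≤ 1 ∧ ∀ m η : ℝ, 0 < m → 0 < η → η * (8 * (Λ + 1)) ≤ m →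
      ∃ Q : ℝ, 1 ≤ Q ∧ ∀ φ₁ : ℝ, m ≤ φ₁ → φ₁ ≤ ε →
        ∀ J : MaximumJet n k s r γ φ₁ ((2 * Λ + 2) * φ₁) η C K, J.q < Q := by
  obtain ⟨Λ, ε, c, hΛ, hε, hε1, hc, hcone⟩ := cone_inequality n s r γ C hγ hrγ hC
  refine ⟨Λ, ε, hΛ, hε, hε1, fun m η hm hη hηm => ?_⟩
  obtain ⟨q₀, hq₀, hcone⟩ := hcone m hm
  set C₂ := C * (7 + 4 * γ * n) with hC₂
  have hC₂0 : 0 ≤ C₂ := by positivity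
  -- The smaller of the coefficients of σ and u_tt τ that survive after half of the lower bound c m
  -- has been reserved.
  set c₃ := min η (c * m / 2) with hc₃
  have hc₃0 : 0 < c₃ := by positivity
  have hp1 : 0 ≤ 2 * C₂ / (c * m) := by positivity
  have hp2 : 0 ≤ 2 * (k + 2) * K / c₃ := by positivity
  -- The summands serve, in this order, the cone inequality, the curvature errors and the derivative
  -- of f.
  refine ⟨q₀ + 2 * C₂ / (c * m) + 2 * (k + 2) * K / c₃ + 1, by linarith, ?_⟩
  intro φ₁ hφm hφε J
  by_contra hcon
  push Not at hcon
  have hφ : 0 < φ₁ := by linarith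
  have hq := J.q_pos
  have hu := J.utt_pos
  have hq1 : 1 ≤ J.q := by linarith
  have hmain := J.main_inequality hΛ hγ hC hφ (hφε.trans hε1) rfl hη (hηm.trans hφm)
  set σ := esymmOn Finset.univ J.l (k + 1) with hσ
  have hσ0 : 0 < σ := J.cone (k + 1) le_rfl
  set τ := ∑ i, J.T i with hτ
  -- The trace is (n - k) e_k, and n - k ≥ 1.
  have hτe : esymmOn Finset.univ J.l k ≤ τ := by
    have h1 : τ = (n - k) * esymmOn Finset.univ J.l k := by
      have := sum_erase_esymmOn Finset.univ J.l k
      rwa [Finset.card_univ, Fintype.card_fin] at this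
    have h2 : (1 : ℝ) ≤ n - k := by
      have : ((k + 1 : ℕ) : ℝ) ≤ n := by exact_mod_cast hkn
      push_cast at this
      linarith
    rw [h1]
    have := J.cone k (by omega)
    nlinarith
  have hτ0 : 0 < τ := (J.cone k (by omega)).trans_le hτe
  have hcon1 := hcone φ₁ J.q (∑ m, J.h m m) J.T J.l J.a J.w J.A J.B hφm hφε (by linarith) J.sum_sq
    (fun i => (J.T_pos i).le)
    (fun i j hij => esymmOn_erase_anti J.cone (Finset.mem_univ i) (Finset.mem_univ j) hij)
    (by rw [J.sum_T_mul_l]; positivity) J.A_le J.B_eq (J.B_mul_a hφ) (J.sq_le_sum_w_mul_a hφ)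
  have h1 := mul_le_mul_of_nonneg_left hcon1 hu.le
  have h2 : η * σ + J.utt * (c * φ₁ * J.q ^ 2 * τ) + 2 / J.q ^ 2 * J.P - C₂ * (J.utt * τ) ≤ 0 := by
    linarith
  have hqq : J.q ≤ J.q ^ 2 := by nlinarith
  have h3 : c * m / 2 * (J.utt * τ) + C₂ * (J.utt * τ) ≤ J.utt * (c * φ₁ * J.q ^ 2 * τ) := by
    have h4 : 2 * C₂ ≤ c * m * J.q ^ 2 := by
      have : 2 * C₂ / (c * m) ≤ J.q ^ 2 := by linarith
      rw [div_le_iff₀ (by positivity)] at this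
      linarith
    have h5 : c * m * J.q ^ 2 ≤ c * φ₁ * J.q ^ 2 := by gcongr
    have h6 : c * m * 1 ≤ c * m * J.q ^ 2 := by
      have : (1 : ℝ) ≤ J.q ^ 2 := by linarith
      gcongr
    have h7 : c * m / 2 + C₂ ≤ c * φ₁ * J.q ^ 2 := by linarith
    have h8 := mul_le_mul_of_nonneg_right h7 (by positivity : 0 ≤ J.utt * τ)
    linarith
  have h4 : c₃ * J.f ^ (k + 1) ≤ η * σ + c * m / 2 * (J.utt * τ) := by
    have h5 : J.f ^ (k + 1) ≤ σ + J.utt * τ := by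
      have h6 := pow_le_sigma_add hσ0 (J.cone k (by omega)) hu J.f_pos J.f_pow
        (esymmOn_maclaurin J.cone k (by omega))
      have h7 := mul_le_mul_of_nonneg_left hτe hu.le
      linarith
    have h8 : c₃ * J.f ^ (k + 1) ≤ c₃ * (σ + J.utt * τ) := mul_le_mul_of_nonneg_left h5 hc₃0.le
    have h9 : c₃ * σ ≤ η * σ := mul_le_mul_of_nonneg_right (min_le_left _ _) hσ0.le
    have h10 : c₃ * (J.utt * τ) ≤ c * m / 2 * (J.utt * τ) :=
      mul_le_mul_of_nonneg_right (min_le_right _ _) (by positivity)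
    linarith
  have hf := pow_pos J.f_pos (k + 1)
  -- P is linear in q while the test function was divided by q²/2, so a factor 1/q remains to beat
  -- f^(k+1).
  have h5 : -(2 * (k + 2) * K / J.q * J.f ^ (k + 1)) ≤ 2 / J.q ^ 2 * J.P := by
    have := mul_le_mul_of_nonneg_left J.P_ge (by positivity : 0 ≤ 2 / J.q ^ 2)
    have e : 2 / J.q ^ 2 * -((k + 2) * K * J.f ^ (k + 1) * J.q) =
        -(2 * (k + 2) * K / J.q * J.f ^ (k + 1)) := by field_simp
    linarith
  have h6 : 2 * (k + 2) * K / J.q < c₃ := by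
    rw [div_lt_iff₀ hq, mul_comm c₃, ← div_lt_iff₀ hc₃0]
    linarith
  have h7 := mul_lt_mul_of_pos_right h6 hf
  linarith

end JetInequality

/-! ### Calculus of directional derivatives. -/

section DirectionalDerivatives

variable {V : Type*} [NormedAddCommGroup V] [NormedSpace ℝ V]

/-- The derivative of `f` in the direction `v`. -/
noncomputable def dird (v : V) (f : V → ℝ) : V → ℝ := fun p => fderiv ℝ f p v

theorem contDiffAt_dird {f : V → ℝ} {p : V} {m k : WithTop ℕ∞} (hf : ContDiffAt ℝ k f p)
    (hmk : m + 1 ≤ k) (v : V) : ContDiffAt ℝ m (dird v f) p :=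
  (hf.fderiv_right hmk).clm_apply contDiffAt_const

theorem dird_comm {f : V → ℝ} {p : V} (hf : ContDiffAt ℝ 2 f p) (v w : V) :
    dird v (dird w f) p = dird w (dird v f) p := by
  have hs : IsSymmSndFDerivAt ℝ f p := hf.isSymmSndFDerivAt (by simp)
  have hd : DifferentiableAt ℝ (fderiv ℝ f) p :=
    (hf.fderiv_right (m := 1) (by norm_num)).differentiableAt one_ne_zero
  have e : ∀ v w : V, dird v (dird w f) p = fderiv ℝ (fderiv ℝ f) p v w := by
    intro v w
    have : HasFDerivAt (dird w f) ((ContinuousLinearMap.apply ℝ ℝ w).comp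
        (fderiv ℝ (fderiv ℝ f) p)) p :=
      (ContinuousLinearMap.apply ℝ ℝ w).hasFDerivAt.comp p hd.hasFDerivAt
    rw [dird, this.fderiv]; rfl
  rw [e, e]
  exact hs v w

theorem dird_congr {f g : V → ℝ} {p : V} (h : f =ᶠ[𝓝 p] g) (v : V) :
    dird v f =ᶠ[𝓝 p] dird v g := by
  filter_upwards [h.eventuallyEq_nhds] with x hx
  rw [dird, dird, hx.fderiv_eq]

theorem dird_add_smul (f : V → ℝ) (v w : V) (c : ℝ) :
    dird (v + c • w) f = fun p => dird v f p + c * dird w f p := by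
  funext p
  simp [dird]

theorem hasDerivAt_line {f : V → ℝ} {p v : V} {τ : ℝ} (hf : DifferentiableAt ℝ f (p + τ • v)) :
    HasDerivAt (fun τ : ℝ => f (p + τ • v)) (dird v f (p + τ • v)) τ := by
  have h1 : HasDerivAt (fun τ : ℝ => p + τ • v) v τ := by
    simpa using ((hasDerivAt_id τ).smul_const v).const_add p
  exact hf.hasFDerivAt.comp_hasDerivAt τ h1

theorem dird_mul {f g : V → ℝ} {p : V} (hf : DifferentiableAt ℝ f p) (hg : DifferentiableAt ℝ g p)
    (v : V) : dird v (fun x => f x * g x) p = f p * dird v g p + dird v f p * g p := by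
  rw [dird, fderiv_fun_mul hf hg]
  simp [dird, mul_comm]

theorem dird_sum {ι : Type*} {s : Finset ι} {f : ι → V → ℝ} {p : V}
    (hf : ∀ i ∈ s, DifferentiableAt ℝ (f i) p) (v : V) :
    dird v (fun x => ∑ i ∈ s, f i x) p = ∑ i ∈ s, dird v (f i) p := by
  rw [dird, fderiv_fun_sum hf]
  simp [dird]

end DirectionalDerivatives

/-! ### Second order Taylor data on a line and the second derivative test. -/

section TwoJet

/-- `f` has value `a`, first derivative `b` and second derivative `c` at `0`. -/
def TwoJet (f : ℝ → ℝ) (a b c : ℝ) : Prop :=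
  f 0 = a ∧ ∃ f' : ℝ → ℝ, (∀ᶠ τ in 𝓝 (0 : ℝ), HasDerivAt f (f' τ) τ) ∧ f' 0 = b ∧
    HasDerivAt f' c 0

namespace TwoJet

variable {f g : ℝ → ℝ} {a b c a' b' c' : ℝ}

theorem const (a : ℝ) : TwoJet (fun _ => a) a 0 0 :=
  ⟨rfl, fun _ => 0, .of_forall fun τ => hasDerivAt_const τ a, rfl, hasDerivAt_const 0 0⟩

theorem affine (a b : ℝ) : TwoJet (fun τ => a + τ * b) a b 0 :=
  ⟨by simp, fun _ => b, .of_forall fun τ => by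
    simpa using ((hasDerivAt_id τ).mul_const b).const_add a, rfl, hasDerivAt_const 0 b⟩

theorem add (hf : TwoJet f a b c) (hg : TwoJet g a' b' c') :
    TwoJet (fun τ => f τ + g τ) (a + a') (b + b') (c + c') := by
  obtain ⟨h0, f', h1, h2, h3⟩ := hf
  obtain ⟨k0, g', k1, k2, k3⟩ := hg
  exact ⟨by simp [h0, k0], fun τ => f' τ + g' τ, by
    filter_upwards [h1, k1] with τ h k using h.add k, by simp [h2, k2], h3.add k3⟩

theorem mul (hf : TwoJet f a b c) (hg : TwoJet g a' b' c') :
    TwoJet (fun τ => f τ * g τ) (a * a') (b * a' + a * b') (c * a' + 2 * b * b' + a * c') := by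
  obtain ⟨h0, f', h1, h2, h3⟩ := hf
  obtain ⟨k0, g', k1, k2, k3⟩ := hg
  refine ⟨by simp [h0, k0], fun τ => f' τ * g τ + f τ * g' τ, by
    filter_upwards [h1, k1] with τ h k using h.mul k, by simp [h2, k2, h0, k0], ?_⟩
  convert! (h3.mul k1.self_of_nhds).add (h1.self_of_nhds.mul k3) using 1
  rw [h0, k0, h2, k2]; ring

theorem const_mul (hf : TwoJet f a b c) (r : ℝ) :
    TwoJet (fun τ => r * f τ) (r * a) (r * b) (r * c) := by
  simpa using (const r).mul hf

theorem sum {ι : Type*} (s : Finset ι) {f : ι → ℝ → ℝ} {a b c : ι → ℝ}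
    (h : ∀ i ∈ s, TwoJet (f i) (a i) (b i) (c i)) :
    TwoJet (fun τ => ∑ i ∈ s, f i τ) (∑ i ∈ s, a i) (∑ i ∈ s, b i) (∑ i ∈ s, c i) := by
  classical
  induction s using Finset.induction_on with
  | empty => simpa using const 0
  | insert i s hi ih =>
    simp only [Finset.sum_insert hi]
    exact (h i (Finset.mem_insert_self i s)).add
      (ih fun j hj => h j (Finset.mem_insert_of_mem hj))

theorem exp (hf : TwoJet f a b c) :
    TwoJet (fun τ => Real.exp (f τ)) (Real.exp a) (Real.exp a * b)
      (Real.exp a * b ^ 2 + Real.exp a * c) := by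
  obtain ⟨h0, f', h1, h2, h3⟩ := hf
  refine ⟨by simp [h0], fun τ => Real.exp (f τ) * f' τ, by
    filter_upwards [h1] with τ h using h.exp, by simp [h2, h0], ?_⟩
  convert! h1.self_of_nhds.exp.mul h3 using 1
  rw [h0, h2]; ring

/-- The second derivative test at a maximum. -/
theorem of_isLocalMax (hf : TwoJet f a b c) (hmax : IsLocalMax f 0) : b = 0 ∧ c ≤ 0 := by
  obtain ⟨_, f', h1, h2, h3⟩ := hf
  have hb : f' 0 = 0 := hmax.hasDerivAt_eq_zero h1.self_of_nhds
  refine ⟨h2 ▸ hb, ?_⟩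
  by_contra hc
  push Not at hc
  have hf'' : deriv (deriv f) 0 = c := by
    have : deriv f =ᶠ[𝓝 0] f' := by
      filter_upwards [h1] with τ h using h.deriv
    rw [this.deriv_eq, h3.deriv]
  have hd0 : deriv f 0 = 0 := by rw [h1.self_of_nhds.deriv, hb]
  -- If c > 0 the point is also a local minimum, so f is locally constant and its second derivative
  -- is zero.
  have hmin := isLocalMin_of_deriv_deriv_pos (by rw [hf'']; exact hc) hd0
    h1.self_of_nhds.continuousAt
  have hconst : f =ᶠ[𝓝 0] fun _ => f 0 := by
    filter_upwards [hmax, hmin] with τ k1 k2 using le_antisymm k1 k2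
  have : deriv (deriv f) 0 = 0 := by
    have h := hconst.deriv
    rw [h.deriv_eq]; simp
  rw [hf''] at this
  exact hc.ne' this

/-- The second derivative test for a maximum of `f exp g` with `f > 0`. -/
theorem of_isLocalMax_mul_exp (hf : TwoJet f a b c) (hg : TwoJet g a' b' c')
    (hmax : IsLocalMax (fun τ => f τ * Real.exp (g τ)) 0) :
    b = -a * b' ∧ c + a * c' - a * b' ^ 2 ≤ 0 := by
  have h := (hf.mul hg.exp).of_isLocalMax hmax
  have he := Real.exp_pos a'
  obtain ⟨h1, h2⟩ := h
  have e1 : b = -a * b' := by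
    have : (b + a * b') * Real.exp a' = 0 := by linear_combination h1
    have := (mul_eq_zero.1 this).resolve_right he.ne'
    linear_combination this
  refine ⟨e1, ?_⟩
  have : (c + a * c' - a * b' ^ 2) * Real.exp a' ≤ 0 := by
    -- The cross term becomes -2 a b'², which changes the sign of the a b'² coming from the
    -- exponential.
    rw [e1] at h2
    linarith
  by_contra hcon
  push Not at hcon
  exact absurd this (not_le.2 (mul_pos hcon he))

variable {V : Type*} [NormedAddCommGroup V] [NormedSpace ℝ V]

theorem of_contDiffAt {F : V → ℝ} {p : V} (hF : ContDiffAt ℝ 2 F p) (v : V) :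
    TwoJet (fun τ => F (p + τ • v)) (F p) (dird v F p) (dird v (dird v F) p) := by
  have hcont : Filter.Tendsto (fun τ : ℝ => p + τ • v) (𝓝 0) (𝓝 p) := by
    have : Continuous fun τ : ℝ => p + τ • v := by fun_prop
    simpa using this.tendsto 0
  refine ⟨by simp, fun τ => dird v F (p + τ • v), ?_, by simp, ?_⟩
  · have := hcont.eventually (hF.eventually (by simp))
    filter_upwards [this] with τ hτ
    exact hasDerivAt_line (hτ.differentiableAt two_ne_zero)
  · have h1 : DifferentiableAt ℝ (dird v F) (p + (0 : ℝ) • v) := by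
      simpa using (contDiffAt_dird (m := 1) hF (by norm_num) v).differentiableAt one_ne_zero
    simpa using hasDerivAt_line h1

end TwoJet

end TwoJet

/-! ### The equation in coordinates and its derivative at the center of normal coordinates. -/

section NormalCoordinates

variable {n : ℕ}

/-- The `i`-th space direction in space-time. -/
noncomputable def ex (i : Fin n) : EuclideanSpace ℝ (Fin n) × ℝ := (EuclideanSpace.single i 1, 0)

/-- The time direction in space-time. -/
noncomputable def et : EuclideanSpace ℝ (Fin n) × ℝ := (0, 1)

/-- The space derivatives `u_i`. -/
noncomputable def gradN (u : EuclideanSpace ℝ (Fin n) × ℝ → ℝ)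
    (p : EuclideanSpace ℝ (Fin n) × ℝ) : Fin n → ℝ := fun i => dird (ex i) u p

/-- The mixed derivatives `u_{ti}`. -/
noncomputable def gradtN (u : EuclideanSpace ℝ (Fin n) × ℝ → ℝ)
    (p : EuclideanSpace ℝ (Fin n) × ℝ) : Fin n → ℝ := fun i => dird (ex i) (dird et u) p

/-- The second covariant derivatives with connection coefficients `Γ`. -/
noncomputable def hessN (Γ : Fin n → Fin n → Fin n → EuclideanSpace ℝ (Fin n) → ℝ)
    (u : EuclideanSpace ℝ (Fin n) × ℝ → ℝ) (p : EuclideanSpace ℝ (Fin n) × ℝ) :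
    Matrix (Fin n) (Fin n) ℝ :=
  Matrix.of fun i j => dird (ex i) (dird (ex j) u) p - ∑ m, Γ m i j p.1 * dird (ex m) u p

/-- The matrix `W[u]` for the inverse metric `H`. -/
noncomputable def WN (H : EuclideanSpace ℝ (Fin n) → Matrix (Fin n) (Fin n) ℝ)
    (Γ : Fin n → Fin n → Fin n → EuclideanSpace ℝ (Fin n) → ℝ)
    (A : EuclideanSpace ℝ (Fin n) → Matrix (Fin n) (Fin n) ℝ) (s r γ : ℝ)
    (u : EuclideanSpace ℝ (Fin n) × ℝ → ℝ) (p : EuclideanSpace ℝ (Fin n) × ℝ) :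
    Matrix (Fin n) (Fin n) ℝ :=
  H p.1 * (hessN Γ u p + s • Matrix.vecMulVec (gradN u p) (gradN u p) + A p.1) +
    (γ * (H p.1 * hessN Γ u p).trace - r / 2 * (gradN u p ⬝ᵥ (H p.1 *ᵥ gradN u p))) • 1

/-- The matrix `W[u] - u_tt⁻¹ du_t ⊗ du_t`. -/
noncomputable def SN (H : EuclideanSpace ℝ (Fin n) → Matrix (Fin n) (Fin n) ℝ)
    (Γ : Fin n → Fin n → Fin n → EuclideanSpace ℝ (Fin n) → ℝ)
    (A : EuclideanSpace ℝ (Fin n) → Matrix (Fin n) (Fin n) ℝ) (s r γ : ℝ)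
    (u : EuclideanSpace ℝ (Fin n) × ℝ → ℝ) (p : EuclideanSpace ℝ (Fin n) × ℝ) :
    Matrix (Fin n) (Fin n) ℝ :=
  WN H Γ A s r γ u p -
    (dird et (dird et u) p)⁻¹ • (H p.1 * Matrix.vecMulVec (gradtN u p) (gradtN u p))

/-- The inverse metric equals 1 to first order at the center, so multiplying by it does not affect
first derivatives. -/
theorem hasDerivAt_mul_of_flat {H N : ℝ → Matrix (Fin n) (Fin n) ℝ}
    {N' : Matrix (Fin n) (Fin n) ℝ} (H0 : H 0 = 1)
    (hH : ∀ i j, HasDerivAt (fun τ => H τ i j) 0 0)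
    (hN : ∀ i j, HasDerivAt (fun τ => N τ i j) (N' i j) 0) (i j : Fin n) :
    HasDerivAt (fun τ => (H τ * N τ) i j) (N' i j) 0 := by
  simp only [Matrix.mul_apply]
  have h : HasDerivAt (fun τ => ∑ x, H τ i x * N τ x j)
      (∑ x, (0 * N 0 x j + H 0 i x * N' x j)) 0 :=
    HasDerivAt.fun_sum fun x _ => (hH i x).mul (hN x j)
  convert! h using 1
  simp [H0, Matrix.one_apply]

variable {H : EuclideanSpace ℝ (Fin n) → Matrix (Fin n) (Fin n) ℝ}
  {Γ : Fin n → Fin n → Fin n → EuclideanSpace ℝ (Fin n) → ℝ}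
  {A : EuclideanSpace ℝ (Fin n) → Matrix (Fin n) (Fin n) ℝ} {s r γ : ℝ}
  {u : EuclideanSpace ℝ (Fin n) × ℝ → ℝ} {t₀ : ℝ}

theorem hasDerivAt_space_line {F : EuclideanSpace ℝ (Fin n) → ℝ} (hF : DifferentiableAt ℝ F 0)
    (a : Fin n) : HasDerivAt (fun τ : ℝ => F (((0 : EuclideanSpace ℝ (Fin n)), t₀) + τ • ex a).1)
      (fderiv ℝ F 0 (EuclideanSpace.single a 1)) 0 := by
  have h := hasDerivAt_line (f := F) (p := 0) (v := EuclideanSpace.single a (1 : ℝ)) (τ := 0)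
    (by simpa using hF)
  simpa [ex, dird] using h

theorem hasDerivAt_spacetime_line {F : EuclideanSpace ℝ (Fin n) × ℝ → ℝ}
    (hF : DifferentiableAt ℝ F (0, t₀)) (v : EuclideanSpace ℝ (Fin n) × ℝ) :
    HasDerivAt (fun τ : ℝ => F (((0 : EuclideanSpace ℝ (Fin n)), t₀) + τ • v))
      (dird v F (0, t₀)) 0 := by
  have h := hasDerivAt_line (f := F) (p := (0, t₀)) (v := v) (τ := 0)
    (by rw [zero_smul, add_zero]; exact hF)
  rwa [zero_smul, add_zero] at h

/-- The space derivatives of the diagonal entries of `SN` at the center of normal coordinates. -/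
theorem hasDerivAt_SN (hu : ContDiffAt ℝ 3 u (0, t₀)) (hutt : dird et (dird et u) (0, t₀) ≠ 0)
    (H0 : H 0 = 1) (hH : ∀ i j, HasFDerivAt (fun z => H z i j) (0 : _ →L[ℝ] ℝ) 0)
    (Γ0 : ∀ m i j, Γ m i j 0 = 0) (hΓ : ∀ m i j, DifferentiableAt ℝ (Γ m i j) 0)
    (hA : ∀ i j, DifferentiableAt ℝ (fun z => A z i j) 0) (a : Fin n) :
    ∃ S' : Matrix (Fin n) (Fin n) ℝ,
      (∀ i j, HasDerivAt
        (fun τ : ℝ => SN H Γ A s r γ u (((0 : EuclideanSpace ℝ (Fin n)), t₀) + τ • ex a) i j)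
        (S' i j) 0) ∧
      ∀ m, S' m m = dird (ex a) (dird (ex m) (dird (ex m) u)) (0, t₀) -
          ∑ b, fderiv ℝ (Γ b m m) 0 (EuclideanSpace.single a 1) * gradN u (0, t₀) b +
          2 * s * gradN u (0, t₀) m * dird (ex a) (dird (ex m) u) (0, t₀) +
          fderiv ℝ (fun z => A z m m) 0 (EuclideanSpace.single a 1) +
          γ * ∑ j, (dird (ex a) (dird (ex j) (dird (ex j) u)) (0, t₀) -
            ∑ b, fderiv ℝ (Γ b j j) 0 (EuclideanSpace.single a 1) * gradN u (0, t₀) b) -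
          r * ∑ i, gradN u (0, t₀) i * dird (ex a) (dird (ex i) u) (0, t₀) -
          2 * (gradtN u (0, t₀) m / dird et (dird et u) (0, t₀)) *
            dird (ex a) (dird (ex m) (dird et u)) (0, t₀) +
          (gradtN u (0, t₀) m / dird et (dird et u) (0, t₀)) ^ 2 *
            dird (ex a) (dird et (dird et u)) (0, t₀) := by
  set p₀ : EuclideanSpace ℝ (Fin n) × ℝ := (0, t₀) with hp₀
  have hu2 : ∀ v, ContDiffAt ℝ 2 (dird v u) p₀ := fun v => contDiffAt_dird hu (by norm_num) v
  have hu1 : ∀ v w, ContDiffAt ℝ 1 (dird v (dird w u)) p₀ := fun v w =>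
    contDiffAt_dird (hu2 w) (by norm_num) v
  have d1 : ∀ v, HasDerivAt (fun τ : ℝ => dird v u (p₀ + τ • ex a))
      (dird (ex a) (dird v u) p₀) 0 := fun v =>
    hasDerivAt_spacetime_line ((hu2 v).differentiableAt two_ne_zero) _
  have d2 : ∀ v w, HasDerivAt (fun τ : ℝ => dird v (dird w u) (p₀ + τ • ex a))
      (dird (ex a) (dird v (dird w u)) p₀) 0 := fun v w =>
    hasDerivAt_spacetime_line ((hu1 v w).differentiableAt one_ne_zero) _
  have dH : ∀ i j, HasDerivAt (fun τ : ℝ => H (p₀ + τ • ex a).1 i j) 0 0 := by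
    intro i j
    have := hasDerivAt_space_line (t₀ := t₀) (hH i j).differentiableAt a
    rw [(hH i j).fderiv] at this
    exact this
  have hH0 : H (p₀ + (0 : ℝ) • ex a).1 = 1 := by simp [hp₀, H0]
  have dΓ : ∀ m i j, HasDerivAt (fun τ : ℝ => Γ m i j (p₀ + τ • ex a).1)
      (fderiv ℝ (Γ m i j) 0 (EuclideanSpace.single a 1)) 0 := fun m i j =>
    hasDerivAt_space_line (hΓ m i j) a
  have dA : ∀ i j, HasDerivAt (fun τ : ℝ => A (p₀ + τ • ex a).1 i j)
      (fderiv ℝ (fun z => A z i j) 0 (EuclideanSpace.single a 1)) 0 := fun i j =>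
    hasDerivAt_space_line (F := fun z => A z i j) (hA i j) a
  -- derivatives of the building blocks
  let h' : Matrix (Fin n) (Fin n) ℝ := Matrix.of fun i j =>
    dird (ex a) (dird (ex i) (dird (ex j) u)) p₀ -
      ∑ m, fderiv ℝ (Γ m i j) 0 (EuclideanSpace.single a 1) * gradN u p₀ m
  have dhess : ∀ i j, HasDerivAt (fun τ : ℝ => hessN Γ u (p₀ + τ • ex a) i j) (h' i j) 0 := by
    intro i j
    simp only [hessN, Matrix.of_apply]
    have h : HasDerivAt (fun τ : ℝ => ∑ m, Γ m i j (p₀ + τ • ex a).1 * dird (ex m) u (p₀ + τ • ex a))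
        (∑ m, (fderiv ℝ (Γ m i j) 0 (EuclideanSpace.single a 1) *
          dird (ex m) u (p₀ + (0 : ℝ) • ex a) +
          Γ m i j (p₀ + (0 : ℝ) • ex a).1 * dird (ex a) (dird (ex m) u) p₀)) 0 :=
      HasDerivAt.fun_sum fun m _ => (dΓ m i j).mul (d1 (ex m))
    convert! (d2 (ex i) (ex j)).sub h using 1
    simp [h', gradN, hp₀, Γ0]
  let g' : Fin n → ℝ := fun i => dird (ex a) (dird (ex i) u) p₀
  have dvec : ∀ i j, HasDerivAt (fun τ : ℝ => (s • Matrix.vecMulVec (gradN u (p₀ + τ • ex a))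
      (gradN u (p₀ + τ • ex a))) i j) (s * (g' i * gradN u p₀ j + gradN u p₀ i * g' j)) 0 := by
    intro i j
    simp only [Matrix.smul_apply, Matrix.vecMulVec_apply, smul_eq_mul, gradN]
    convert! ((d1 (ex i)).mul (d1 (ex j))).const_mul s using 1
    simp [g']
  let N' : Matrix (Fin n) (Fin n) ℝ := Matrix.of fun i j =>
    h' i j + s * (g' i * gradN u p₀ j + gradN u p₀ i * g' j) +
      fderiv ℝ (fun z => A z i j) 0 (EuclideanSpace.single a 1)
  have dN := hasDerivAt_mul_of_flat (H := fun τ : ℝ => H (p₀ + τ • ex a).1)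
    (N := fun τ : ℝ => hessN Γ u (p₀ + τ • ex a) +
      s • Matrix.vecMulVec (gradN u (p₀ + τ • ex a)) (gradN u (p₀ + τ • ex a)) +
      A (p₀ + τ • ex a).1) (N' := N') hH0 dH
    (fun i j => ((dhess i j).add (dvec i j)).add (dA i j))
  have dtr : HasDerivAt (fun τ : ℝ => (H (p₀ + τ • ex a).1 * hessN Γ u (p₀ + τ • ex a)).trace)
      (∑ i, h' i i) 0 := by
    simp only [Matrix.trace, Matrix.diag_apply]
    exact HasDerivAt.fun_sum fun i _ => hasDerivAt_mul_of_flat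
      (H := fun τ : ℝ => H (p₀ + τ • ex a).1) hH0 dH dhess i i
  have dnorm : HasDerivAt (fun τ : ℝ => gradN u (p₀ + τ • ex a) ⬝ᵥ
      (H (p₀ + τ • ex a).1 *ᵥ gradN u (p₀ + τ • ex a)))
      (2 * ∑ i, gradN u p₀ i * g' i) 0 := by
    simp only [dotProduct, Matrix.mulVec]
    have h : HasDerivAt (fun τ : ℝ => ∑ i, gradN u (p₀ + τ • ex a) i *
        ∑ j, H (p₀ + τ • ex a).1 i j * gradN u (p₀ + τ • ex a) j)
        (∑ i, (g' i * (∑ j, H (p₀ + (0 : ℝ) • ex a).1 i j * gradN u (p₀ + (0 : ℝ) • ex a) j) +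
          gradN u (p₀ + (0 : ℝ) • ex a) i *
            ∑ j, (0 * gradN u (p₀ + (0 : ℝ) • ex a) j + H (p₀ + (0 : ℝ) • ex a).1 i j * g' j))) 0 :=
      HasDerivAt.fun_sum fun i _ => (d1 (ex i)).mul
        (HasDerivAt.fun_sum fun j _ => (dH i j).mul (d1 (ex j)))
    convert! h using 1
    rw [hH0, Finset.mul_sum]
    refine Finset.sum_congr rfl fun i _ => ?_
    simp [Matrix.one_apply]
    ring
  let b' : Fin n → ℝ := fun i => dird (ex a) (dird (ex i) (dird et u)) p₀
  have db := hasDerivAt_mul_of_flat (H := fun τ : ℝ => H (p₀ + τ • ex a).1)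
    (N := fun τ : ℝ => Matrix.vecMulVec (gradtN u (p₀ + τ • ex a)) (gradtN u (p₀ + τ • ex a)))
    (N' := Matrix.of fun i j => b' i * gradtN u p₀ j + gradtN u p₀ i * b' j) hH0 dH
    (fun i j => by
      simp only [Matrix.vecMulVec_apply, gradtN, Matrix.of_apply]
      convert! (d2 (ex i) et).mul (d2 (ex j) et) using 1
      simp [b'])
  have dinv := (d2 et et).inv (by simpa using hutt)
  let S' : Matrix (Fin n) (Fin n) ℝ := Matrix.of fun i j =>
    N' i j + (γ * (∑ i, h' i i) - r / 2 * (2 * ∑ i, gradN u p₀ i * g' i)) *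
      (1 : Matrix (Fin n) (Fin n) ℝ) i j -
    (-dird (ex a) (dird et (dird et u)) p₀ / dird et (dird et u) p₀ ^ 2 *
      (gradtN u p₀ i * gradtN u p₀ j) +
      (dird et (dird et u) p₀)⁻¹ * (b' i * gradtN u p₀ j + gradtN u p₀ i * b' j))
  refine ⟨S', fun i j => ?_, fun m => ?_⟩
  · simp only [SN, WN, Matrix.sub_apply, Matrix.add_apply, Matrix.smul_apply, smul_eq_mul]
    have h1 := ((dN i j).add (((dtr.const_mul γ).sub (dnorm.const_mul (r / 2))).mul_const
      ((1 : Matrix (Fin n) (Fin n) ℝ) i j))).sub (dinv.mul (db i j))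
    convert! h1 using 1
    simp [S', H0, hp₀, Matrix.vecMulVec_apply]
  · simp only [S', N', h', g', b', Matrix.of_apply, Matrix.one_apply_eq, gradtN]
    field_simp
    ring

end NormalCoordinates

/-! ### Symmetry of second and third derivatives. -/

section MoreDirectionalDerivatives

variable {V : Type*} [NormedAddCommGroup V] [NormedSpace ℝ V]

/-- Moves the direction in which the equation is differentiated innermost, where the second order
conditions for |∇u|² produce it. -/
theorem dird_comm_three {f : V → ℝ} {p : V} (hf : ContDiffAt ℝ 3 f p) (v w x : V) :
    dird v (dird w (dird x f)) p = dird w (dird x (dird v f)) p := by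
  rw [dird_comm (contDiffAt_dird hf (by norm_num) x) v w]
  have : ∀ᶠ y in 𝓝 p, dird v (dird x f) y = dird x (dird v f) y := by
    filter_upwards [(hf.of_le (m := 2) (by norm_num)).eventually (by simp)] with y hy
    exact dird_comm hy v x
  exact (dird_congr this w).self_of_nhds

/-- Needed along e_m - (u_tm/u_tt) e_t, where the space-time Hessian becomes its Schur complement.
-/
theorem dird_dird_add_smul {f : V → ℝ} {p : V} (hf : ContDiffAt ℝ 2 f p) (v w : V) (c : ℝ) :
    dird (v + c • w) (dird (v + c • w) f) p =
      dird v (dird v f) p + 2 * c * dird v (dird w f) p + c ^ 2 * dird w (dird w f) p := by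
  have hd : ∀ v, DifferentiableAt ℝ (dird v f) p := fun v =>
    (contDiffAt_dird (m := 1) hf (by norm_num) v).differentiableAt one_ne_zero
  have e : ∀ x, dird x (dird (v + c • w) f) p = dird x (dird v f) p + c * dird x (dird w f) p := by
    intro x
    rw [dird_add_smul, dird, fderiv_fun_add (hd v) ((hd w).const_mul c),
      fderiv_const_mul (hd w)]
    simp [dird]
  rw [dird_add_smul]
  beta_reduce
  rw [e, e, dird_comm hf w v]
  ring

end MoreDirectionalDerivatives

/-! ### First and second order conditions for the test function. -/

section MaximumPrinciple

variable {n : ℕ}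

/-- Inverse metric, connection coefficients and tensor in coordinates that are normal at `0`, with
the bounds that enter the estimates. -/
structure NormalData (H : EuclideanSpace ℝ (Fin n) → Matrix (Fin n) (Fin n) ℝ)
    (Γ : Fin n → Fin n → Fin n → EuclideanSpace ℝ (Fin n) → ℝ)
    (A : EuclideanSpace ℝ (Fin n) → Matrix (Fin n) (Fin n) ℝ) (C : ℝ) : Prop where
  H_zero : H 0 = 1
  H_contDiffAt : ∀ i j, ContDiffAt ℝ 2 (fun z => H z i j) 0
  H_fderiv : ∀ i j, fderiv ℝ (fun z => H z i j) 0 = 0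
  H_second : ∀ i j m, |dird (EuclideanSpace.single m 1)
    (dird (EuclideanSpace.single m 1) (fun z => H z i j)) 0| ≤ C
  Γ_zero : ∀ m i j, Γ m i j 0 = 0
  Γ_differentiableAt : ∀ m i j, DifferentiableAt ℝ (Γ m i j) 0
  Γ_fderiv : ∀ m i j a, |fderiv ℝ (Γ m i j) 0 (EuclideanSpace.single a 1)| ≤ C
  A_le : ∀ i j, |A 0 i j| ≤ C
  A_differentiableAt : ∀ i j, DifferentiableAt ℝ (fun z => A z i j) 0
  A_fderiv : ∀ i j a, |fderiv ℝ (fun z => A z i j) 0 (EuclideanSpace.single a 1)| ≤ C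

variable {H : EuclideanSpace ℝ (Fin n) → Matrix (Fin n) (Fin n) ℝ}
  {Γ : Fin n → Fin n → Fin n → EuclideanSpace ℝ (Fin n) → ℝ}
  {A : EuclideanSpace ℝ (Fin n) → Matrix (Fin n) (Fin n) ℝ} {C : ℝ}
  {u : EuclideanSpace ℝ (Fin n) × ℝ → ℝ} {t₀ : ℝ}

theorem NormalData.hasFDerivAt (hN : NormalData H Γ A C) (i j : Fin n) :
    HasFDerivAt (fun z => H z i j) (0 : _ →L[ℝ] ℝ) 0 := by
  have := ((hN.H_contDiffAt i j).differentiableAt two_ne_zero).hasFDerivAt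
  rwa [hN.H_fderiv] at this

/-- The two-jet of `|∇u|² / 2` along a line through the center of normal coordinates. -/
theorem NormalData.twoJet_energy (hN : NormalData H Γ A C) (hu : ContDiffAt ℝ 3 u (0, t₀))
    (v : EuclideanSpace ℝ (Fin n) × ℝ) :
    TwoJet (fun τ => 1 / 2 * (gradN u ((0, t₀) + τ • v) ⬝ᵥ
        (H ((0, t₀) + τ • v : EuclideanSpace ℝ (Fin n) × ℝ).1 *ᵥ gradN u ((0, t₀) + τ • v))))
      (1 / 2 * ∑ i, gradN u (0, t₀) i ^ 2)
      (∑ i, gradN u (0, t₀) i * dird v (dird (ex i) u) (0, t₀))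
      (∑ i, dird v (dird (ex i) u) (0, t₀) ^ 2 +
        ∑ i, gradN u (0, t₀) i * dird v (dird v (dird (ex i) u)) (0, t₀) +
        1 / 2 * ∑ i, ∑ j, dird v.1 (dird v.1 (fun z => H z i j)) 0 * gradN u (0, t₀) i *
          gradN u (0, t₀) j) := by
  have hg : ∀ i, TwoJet (fun τ => gradN u ((0, t₀) + τ • v) i) (gradN u (0, t₀) i)
      (dird v (dird (ex i) u) (0, t₀)) (dird v (dird v (dird (ex i) u)) (0, t₀)) := fun i =>
    TwoJet.of_contDiffAt (contDiffAt_dird hu (by norm_num) (ex i)) v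
  have hH : ∀ i j, TwoJet (fun τ => H ((0, t₀) + τ • v : EuclideanSpace ℝ (Fin n) × ℝ).1 i j)
      ((1 : Matrix (Fin n) (Fin n) ℝ) i j) 0 (dird v.1 (dird v.1 (fun z => H z i j)) 0) := by
    intro i j
    have h := TwoJet.of_contDiffAt (hN.H_contDiffAt i j) v.1
    rwa [hN.H_zero, show dird v.1 (fun z => H z i j) 0 = 0 by simp [dird, hN.H_fderiv]] at h
  have h := ((TwoJet.sum Finset.univ fun i _ => (hg i).mul
    (TwoJet.sum Finset.univ fun j _ => (hH i j).mul (hg j)))).const_mul (1 / 2)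
  simp only [dotProduct, Matrix.mulVec]
  convert! h using 1
  · congr 1
    refine Finset.sum_congr rfl fun i _ => ?_
    simp [Matrix.one_apply, sq]
  · rw [Finset.mul_sum]
    refine Finset.sum_congr rfl fun i _ => ?_
    simp [Matrix.one_apply]
    ring
  · rw [Finset.mul_sum, Finset.mul_sum, ← Finset.sum_add_distrib, ← Finset.sum_add_distrib]
    refine Finset.sum_congr rfl fun i _ => ?_
    have e : ∀ j, dird v.1 (dird v.1 fun z => H z i j) 0 * gradN u (0, t₀) i * gradN u (0, t₀) j =
      gradN u (0, t₀) i * (dird v.1 (dird v.1 fun z => H z i j) 0 * gradN u (0, t₀) j) := by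
      intro j; ring
    simp only [e, ← Finset.mul_sum, Finset.sum_add_distrib]
    simp [Matrix.one_apply]
    ring

/-- The exponential form of the weight gives φ'' = L φ', so a single constant L fixes the ratio of
the two derivatives wherever u takes its value. -/
theorem twoJet_weight (hu : ContDiffAt ℝ 2 u (0, t₀)) (ε₀ L η : ℝ)
    (v : EuclideanSpace ℝ (Fin n) × ℝ) :
    TwoJet (fun τ => ε₀ * Real.exp (L * u ((0, t₀) + τ • v)) +
        η * ((0, t₀) + τ • v : EuclideanSpace ℝ (Fin n) × ℝ).2 ^ 2)
      (ε₀ * Real.exp (L * u (0, t₀)) + η * t₀ ^ 2)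
      (ε₀ * L * Real.exp (L * u (0, t₀)) * dird v u (0, t₀) + 2 * η * t₀ * v.2)
      (L * (ε₀ * L * Real.exp (L * u (0, t₀))) * dird v u (0, t₀) ^ 2 +
        ε₀ * L * Real.exp (L * u (0, t₀)) * dird v (dird v u) (0, t₀) + 2 * η * v.2 ^ 2) := by
  have h1 := (((TwoJet.of_contDiffAt hu v).const_mul L).exp).const_mul ε₀
  have h2 := ((TwoJet.affine t₀ v.2).mul (TwoJet.affine t₀ v.2)).const_mul η
  convert! h1.add h2 using 1
  · funext τ; simp [sq]
  · ring
  · ring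
  · ring

/-- First and second order conditions at a maximum of the test function. -/
theorem NormalData.maximum_conditions (hN : NormalData H Γ A C) (hu : ContDiffAt ℝ 3 u (0, t₀))
    {ε₀ L η φ₁ q : ℝ} (hφ : φ₁ = ε₀ * L * Real.exp (L * u (0, t₀)))
    (hq : ∑ i, gradN u (0, t₀) i ^ 2 = q ^ 2)
    (hmax : IsLocalMax (fun p : EuclideanSpace ℝ (Fin n) × ℝ =>
      1 / 2 * (gradN u p ⬝ᵥ (H p.1 *ᵥ gradN u p)) *
        Real.exp (ε₀ * Real.exp (L * u p) + η * p.2 ^ 2)) (0, t₀))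
    (v : EuclideanSpace ℝ (Fin n) × ℝ) :
    ∑ i, gradN u (0, t₀) i * dird v (dird (ex i) u) (0, t₀) =
        -(q ^ 2 / 2) * (φ₁ * dird v u (0, t₀) + 2 * η * t₀ * v.2) ∧
      ∑ i, dird v (dird (ex i) u) (0, t₀) ^ 2 +
        ∑ i, gradN u (0, t₀) i * dird v (dird v (dird (ex i) u)) (0, t₀) +
        1 / 2 * ∑ i, ∑ j, dird v.1 (dird v.1 (fun z => H z i j)) 0 * gradN u (0, t₀) i *
          gradN u (0, t₀) j +
        q ^ 2 / 2 * (L * φ₁ * dird v u (0, t₀) ^ 2 + φ₁ * dird v (dird v u) (0, t₀) +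
          2 * η * v.2 ^ 2) -
        q ^ 2 / 2 * (φ₁ * dird v u (0, t₀) + 2 * η * t₀ * v.2) ^ 2 ≤ 0 := by
  have hline : IsLocalMax (fun τ : ℝ => 1 / 2 * (gradN u ((0, t₀) + τ • v) ⬝ᵥ
        (H ((0, t₀) + τ • v : EuclideanSpace ℝ (Fin n) × ℝ).1 *ᵥ gradN u ((0, t₀) + τ • v))) *
      Real.exp (ε₀ * Real.exp (L * u ((0, t₀) + τ • v)) +
        η * ((0, t₀) + τ • v : EuclideanSpace ℝ (Fin n) × ℝ).2 ^ 2)) 0 := by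
    have hc : ContinuousAt (fun τ : ℝ => ((0, t₀) + τ • v : EuclideanSpace ℝ (Fin n) × ℝ)) 0 := by
      fun_prop
    exact IsLocalMax.comp_continuous (b := (0 : ℝ))
      (g := fun τ : ℝ => ((0, t₀) + τ • v : EuclideanSpace ℝ (Fin n) × ℝ))
      (by rw [zero_smul, add_zero]; exact hmax) hc
  have h := (hN.twoJet_energy hu v).of_isLocalMax_mul_exp
    (twoJet_weight (hu.of_le (by norm_num)) ε₀ L η v) hline
  rw [hq, ← hφ] at h
  constructor
  · linear_combination h.1
  · linarith [h.2]

end MaximumPrinciple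

/-! ### The differentiated equation and the construction of a maximum jet. -/

section MaximumJet

variable {n : ℕ} {H : EuclideanSpace ℝ (Fin n) → Matrix (Fin n) (Fin n) ℝ}
  {Γ : Fin n → Fin n → Fin n → EuclideanSpace ℝ (Fin n) → ℝ}
  {A : EuclideanSpace ℝ (Fin n) → Matrix (Fin n) (Fin n) ℝ} {C : ℝ}
  {u : EuclideanSpace ℝ (Fin n) × ℝ → ℝ} {t₀ : ℝ}

theorem abs_sum_sum_mul_le {M : Fin n → Fin n → ℝ} {a : Fin n → ℝ} {C q : ℝ} (hC : 0 ≤ C)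
    (hM : ∀ i j, |M i j| ≤ C) (ha : ∀ i, |a i| ≤ q) :
    |∑ i, ∑ j, M i j * a i * a j| ≤ n ^ 2 * C * q ^ 2 := by
  have h : ∀ i j, |M i j * a i * a j| ≤ C * q ^ 2 := by
    intro i j
    have hq : 0 ≤ q := (abs_nonneg _).trans (ha i)
    rw [abs_mul, abs_mul, sq, ← mul_assoc]
    exact mul_le_mul (mul_le_mul (hM i j) (ha i) (abs_nonneg _) hC) (ha j) (abs_nonneg _)
      (mul_nonneg hC hq)
  calc _ ≤ ∑ i, ∑ j, |M i j * a i * a j| :=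
        (Finset.abs_sum_le_sum_abs _ _).trans
          (Finset.sum_le_sum fun i _ => Finset.abs_sum_le_sum_abs _ _)
    _ ≤ ∑ i : Fin n, ∑ j : Fin n, C * q ^ 2 :=
        Finset.sum_le_sum fun i _ => Finset.sum_le_sum fun j _ => h i j
    _ = _ := by simp; ring

/-- The hypothesis 1 ≤ q turns the linear growth into q², and n into n², so that all error terms
share one constant. -/
theorem abs_sum_mul_le {M : Fin n → ℝ} {a : Fin n → ℝ} {C q : ℝ} (hC : 0 ≤ C) (hq : 1 ≤ q)
    (hM : ∀ i, |M i| ≤ C) (ha : ∀ i, |a i| ≤ q) :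
    |∑ i, a i * M i| ≤ n ^ 2 * C * q ^ 2 := by
  have h : ∀ i, |a i * M i| ≤ C * q ^ 2 := by
    intro i
    rw [abs_mul, mul_comm]
    refine mul_le_mul (hM i) ((ha i).trans ?_) (abs_nonneg _) hC
    nlinarith
  calc _ ≤ ∑ i, |a i * M i| := Finset.abs_sum_le_sum_abs _ _
    _ ≤ ∑ i : Fin n, C * q ^ 2 := Finset.sum_le_sum fun i _ => h i
    _ = n * (C * q ^ 2) := by simp
    _ ≤ (n : ℝ) ^ 2 * (C * q ^ 2) := by
        refine mul_le_mul_of_nonneg_right ?_ (by positivity)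
        exact_mod_cast Nat.le_self_pow two_ne_zero n
    _ = _ := by ring

/-- The differentiated equation at the center of normal coordinates. -/
theorem NormalData.differentiated_equation {k : ℕ} (hkn : k + 1 ≤ n) (hN : NormalData H Γ A C)
    {s r γ : ℝ} (hu : ContDiffAt ℝ 3 u (0, t₀)) (hutt : 0 < dird et (dird et u) (0, t₀))
    {l : Fin n → ℝ} (hS : SN H Γ A s r γ u (0, t₀) = Matrix.diagonal l)
    {f : EuclideanSpace ℝ (Fin n) → ℝ} (hf : DifferentiableAt ℝ f 0)
    (heq : ∀ᶠ z in 𝓝 (0 : EuclideanSpace ℝ (Fin n)),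
      dird et (dird et u) (z, t₀) * sigma (k + 1) (SN H Γ A s r γ u (z, t₀)) = f z ^ (k + 2))
    (a : Fin n) :
    (k + 2) * f 0 ^ (k + 1) * fderiv ℝ f 0 (EuclideanSpace.single a 1) =
      esymmOn Finset.univ l (k + 1) * dird et (dird et (dird (ex a) u)) (0, t₀) +
      dird et (dird et u) (0, t₀) * ∑ m, esymmOn (Finset.univ.erase m) l k *
        (dird (ex m) (dird (ex m) (dird (ex a) u)) (0, t₀) -
          2 * (gradtN u (0, t₀) m / dird et (dird et u) (0, t₀)) *
            dird (ex m) (dird et (dird (ex a) u)) (0, t₀) +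
          (gradtN u (0, t₀) m / dird et (dird et u) (0, t₀)) ^ 2 *
            dird et (dird et (dird (ex a) u)) (0, t₀) -
          ∑ b, fderiv ℝ (Γ b m m) 0 (EuclideanSpace.single a 1) * gradN u (0, t₀) b +
          2 * s * gradN u (0, t₀) m * dird (ex m) (dird (ex a) u) (0, t₀) +
          fderiv ℝ (fun z => A z m m) 0 (EuclideanSpace.single a 1) +
          γ * ∑ j, (dird (ex j) (dird (ex j) (dird (ex a) u)) (0, t₀) -
            ∑ b, fderiv ℝ (Γ b j j) 0 (EuclideanSpace.single a 1) * gradN u (0, t₀) b) -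
          r * ∑ i, gradN u (0, t₀) i * dird (ex i) (dird (ex a) u) (0, t₀)) := by
  obtain ⟨S', h1, h2⟩ := hasDerivAt_SN (s := s) (r := r) (γ := γ) hu hutt.ne' hN.H_zero
    hN.hasFDerivAt hN.Γ_zero hN.Γ_differentiableAt hN.A_differentiableAt a
  have hS0 : SN H Γ A s r γ u ((0, t₀) + (0 : ℝ) • ex a) = Matrix.diagonal l := by
    rw [zero_smul, add_zero, hS]
  have dσ := hasDerivAt_sigma_diagonal hkn hS0 h1
  have hu1 : ContDiffAt ℝ 1 (dird et (dird et u)) (0, t₀) :=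
    contDiffAt_dird (contDiffAt_dird (m := 2) hu (by norm_num) et) (by norm_num) et
  have dutt := hasDerivAt_spacetime_line (hu1.differentiableAt one_ne_zero) (ex a)
  have hL := dutt.mul dσ
  have hR := (hasDerivAt_space_line (t₀ := t₀) hf a).pow (k + 2)
  have hev : (fun τ : ℝ => dird et (dird et u) ((0, t₀) + τ • ex a) *
      sigma (k + 1) (SN H Γ A s r γ u ((0, t₀) + τ • ex a))) =ᶠ[𝓝 0]
      fun τ => f ((0, t₀) + τ • ex a : EuclideanSpace ℝ (Fin n) × ℝ).1 ^ (k + 2) := by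
    have hc : Filter.Tendsto (fun τ : ℝ => ((0, t₀) + τ • ex a : EuclideanSpace ℝ (Fin n) × ℝ).1)
        (𝓝 0) (𝓝 0) := by
      have : Continuous (fun τ : ℝ => ((0, t₀) + τ • ex a : EuclideanSpace ℝ (Fin n) × ℝ).1) := by
        fun_prop
      simpa using this.tendsto 0
    filter_upwards [hc.eventually heq] with τ hτ
    have e : ((0, t₀) + τ • ex a : EuclideanSpace ℝ (Fin n) × ℝ) =
        (((0, t₀) + τ • ex a : EuclideanSpace ℝ (Fin n) × ℝ).1, t₀) := by
      ext <;> simp [ex]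
    rw [← e] at hτ
    exact hτ
  have huniq := (hR.congr_of_eventuallyEq hev).unique hL
  have hu2 : ContDiffAt ℝ 2 u (0, t₀) := hu.of_le (by norm_num)
  have e1 : ∀ v w, dird (ex a) (dird v (dird w u)) (0, t₀) =
      dird v (dird w (dird (ex a) u)) (0, t₀) := fun v w => dird_comm_three hu _ _ _
  have e2 : ∀ m, dird (ex a) (dird (ex m) u) (0, t₀) = dird (ex m) (dird (ex a) u) (0, t₀) :=
    fun m => dird_comm hu2 _ _
  simp only [h2, e1, e2] at huniq
  have hz : ((0, t₀) + (0 : ℝ) • ex a : EuclideanSpace ℝ (Fin n) × ℝ) = (0, t₀) := by simp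
  rw [hz, hS, sigma_diagonal hkn] at huniq
  have hcast : ((k + 2 : ℕ) : ℝ) = k + 2 := by push_cast; ring
  rw [hcast, show k + 2 - 1 = k + 1 from rfl] at huniq
  rw [huniq]
  have e3 : ∀ m, dird (ex m) (dird (ex m) (dird (ex a) u)) (0, t₀) -
        ∑ b, fderiv ℝ (Γ b m m) 0 (EuclideanSpace.single a 1) * gradN u (0, t₀) b +
        2 * s * gradN u (0, t₀) m * dird (ex m) (dird (ex a) u) (0, t₀) +
        fderiv ℝ (fun z => A z m m) 0 (EuclideanSpace.single a 1) +
        γ * ∑ j, (dird (ex j) (dird (ex j) (dird (ex a) u)) (0, t₀) -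
          ∑ b, fderiv ℝ (Γ b j j) 0 (EuclideanSpace.single a 1) * gradN u (0, t₀) b) -
        r * ∑ i, gradN u (0, t₀) i * dird (ex i) (dird (ex a) u) (0, t₀) -
        2 * (gradtN u (0, t₀) m / dird et (dird et u) (0, t₀)) *
          dird (ex m) (dird et (dird (ex a) u)) (0, t₀) +
        (gradtN u (0, t₀) m / dird et (dird et u) (0, t₀)) ^ 2 *
          dird et (dird et (dird (ex a) u)) (0, t₀) =
      dird (ex m) (dird (ex m) (dird (ex a) u)) (0, t₀) -
        2 * (gradtN u (0, t₀) m / dird et (dird et u) (0, t₀)) *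
          dird (ex m) (dird et (dird (ex a) u)) (0, t₀) +
        (gradtN u (0, t₀) m / dird et (dird et u) (0, t₀)) ^ 2 *
          dird et (dird et (dird (ex a) u)) (0, t₀) -
        ∑ b, fderiv ℝ (Γ b m m) 0 (EuclideanSpace.single a 1) * gradN u (0, t₀) b +
        2 * s * gradN u (0, t₀) m * dird (ex m) (dird (ex a) u) (0, t₀) +
        fderiv ℝ (fun z => A z m m) 0 (EuclideanSpace.single a 1) +
        γ * ∑ j, (dird (ex j) (dird (ex j) (dird (ex a) u)) (0, t₀) -
          ∑ b, fderiv ℝ (Γ b j j) 0 (EuclideanSpace.single a 1) * gradN u (0, t₀) b) -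
        r * ∑ i, gradN u (0, t₀) i * dird (ex i) (dird (ex a) u) (0, t₀) := fun m => by ring
  simp only [e3]
  ring

end MaximumJet

section MaximumJet

variable {n : ℕ} {H : EuclideanSpace ℝ (Fin n) → Matrix (Fin n) (Fin n) ℝ}
  {Γ : Fin n → Fin n → Fin n → EuclideanSpace ℝ (Fin n) → ℝ}
  {A : EuclideanSpace ℝ (Fin n) → Matrix (Fin n) (Fin n) ℝ} {C : ℝ}
  {u : EuclideanSpace ℝ (Fin n) × ℝ → ℝ} {t₀ : ℝ}

/-- An interior maximum of the test function produces a `MaximumJet`. -/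
theorem NormalData.exists_maximumJet {k : ℕ} (hkn : k + 1 ≤ n) (hN : NormalData H Γ A C)
    (hC : 0 ≤ C) {s r γ : ℝ} (hu : ContDiffAt ℝ 3 u (0, t₀)) (ht₀ : t₀ ^ 2 ≤ 1)
    (hutt : 0 < dird et (dird et u) (0, t₀))
    {l : Fin n → ℝ} (hS : SN H Γ A s r γ u (0, t₀) = Matrix.diagonal l)
    (hl : ∀ j ≤ k + 1, 0 < esymmOn Finset.univ l j)
    {f : EuclideanSpace ℝ (Fin n) → ℝ} (hf : DifferentiableAt ℝ f 0) (hfpos : 0 < f 0) {K : ℝ}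
    (hfK : √(∑ i, fderiv ℝ f 0 (EuclideanSpace.single i 1) ^ 2) ≤ K)
    (heq : ∀ᶠ z in 𝓝 (0 : EuclideanSpace ℝ (Fin n)),
      dird et (dird et u) (z, t₀) * sigma (k + 1) (SN H Γ A s r γ u (z, t₀)) = f z ^ (k + 2))
    (hgrad : 1 ≤ ∑ i, gradN u (0, t₀) i ^ 2) {ε₀ L η φ₁ : ℝ}
    (hφ : φ₁ = ε₀ * L * Real.exp (L * u (0, t₀)))
    (hmax : IsLocalMax (fun p : EuclideanSpace ℝ (Fin n) × ℝ =>
      1 / 2 * (gradN u p ⬝ᵥ (H p.1 *ᵥ gradN u p)) *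
        Real.exp (ε₀ * Real.exp (L * u p) + η * p.2 ^ 2)) (0, t₀)) :
    ∃ J : MaximumJet n k s r γ φ₁ (L * φ₁) η ((n ^ 2 + 1) * C) K,
      J.q = √(∑ i, gradN u (0, t₀) i ^ 2) := by
  set a : Fin n → ℝ := gradN u (0, t₀) with ha_def
  set q := √(∑ i, a i ^ 2) with hq_def
  have hqsq : ∑ i, a i ^ 2 = q ^ 2 := (Real.sq_sqrt (by positivity)).symm
  have hq1 : 1 ≤ q := Real.one_le_sqrt.2 hgrad
  have haq : ∀ i, |a i| ≤ q := fun i => Real.abs_le_sqrt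
    (Finset.single_le_sum (f := fun i => a i ^ 2) (fun j _ => sq_nonneg (a j)) (Finset.mem_univ i))
  have hu2 : ContDiffAt ℝ 2 u (0, t₀) := hu.of_le (by norm_num)
  have hui2 : ∀ v, ContDiffAt ℝ 2 (dird v u) (0, t₀) := fun v => contDiffAt_dird hu (by norm_num) v
  set utt := dird et (dird et u) (0, t₀) with hutt_def
  set b : Fin n → ℝ := gradtN u (0, t₀) with hb_def
  have hb : ∀ i, dird et (dird (ex i) u) (0, t₀) = b i := fun i => dird_comm hu2 _ _
  have hbm : ∀ i, dird (ex i) (dird et u) (0, t₀) = b i := fun i => rfl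
  have ha : ∀ i, dird (ex i) u (0, t₀) = a i := fun i => rfl
  have hmc := hN.maximum_conditions hu hφ hqsq hmax
  have het1 : (et : EuclideanSpace ℝ (Fin n) × ℝ).1 = 0 := rfl
  have het2 : (et : EuclideanSpace ℝ (Fin n) × ℝ).2 = 1 := rfl
  have hex1 : ∀ m : Fin n, (ex m).1 = EuclideanSpace.single m 1 := fun m => rfl
  have hex2 : ∀ m : Fin n, (ex m).2 = 0 := fun m => rfl
  -- The extra 1 in n² + 1 lets the bound |A i j| ≤ C use the same constant.
  have hmul : ∀ {x : ℝ}, |x| ≤ n ^ 2 * C * q ^ 2 → |x| ≤ (n ^ 2 + 1) * C * q ^ 2 := by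
    intro x hx
    have : 0 ≤ C * q ^ 2 := by positivity
    linarith
  have hdeq := hN.differentiated_equation hkn hu hutt hS hf heq
  refine ⟨{
    q := q
    ut := dird et u (0, t₀)
    utt := utt
    t := t₀
    f := f 0
    P := ∑ i, a i * ((k + 2) * f 0 ^ (k + 1) * fderiv ℝ f 0 (EuclideanSpace.single i 1))
    l := l
    a := a
    b := b
    Z := fun m => ∑ i, a i * (dird (ex m) (dird (ex m) (dird (ex i) u)) (0, t₀) -
      2 * (b m / utt) * dird (ex m) (dird et (dird (ex i) u)) (0, t₀) +
      (b m / utt) ^ 2 * dird et (dird et (dird (ex i) u)) (0, t₀))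
    X := fun m => ∑ i, a i * dird (ex m) (dird (ex m) (dird (ex i) u)) (0, t₀)
    E := fun m => 1 / 2 * ∑ i, ∑ j, dird (EuclideanSpace.single m 1)
      (dird (EuclideanSpace.single m 1) (fun z => H z i j)) 0 * a i * a j
    G := fun m => ∑ i, a i * ∑ j, fderiv ℝ (Γ j m m) 0 (EuclideanSpace.single i 1) * a j
    N := fun m => ∑ i, a i * fderiv ℝ (fun z => A z m m) 0 (EuclideanSpace.single i 1)
    Y := ∑ i, a i * dird et (dird et (dird (ex i) u)) (0, t₀)
    h := fun i j => dird (ex i) (dird (ex j) u) (0, t₀)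
    A := fun i j => A 0 i j
    q_pos := by linarith
    f_pos := hfpos
    utt_pos := hutt
    t_sq_le := ht₀
    sum_sq := hqsq
    cone := hl
    A_le := fun i j => (hN.A_le i j).trans (by nlinarith [sq_nonneg (n : ℝ)])
    S_eq := ?_
    crit_space := ?_
    crit_time := ?_
    E_le := ?_
    G_le := ?_
    N_le := fun m => hmul (abs_sum_mul_le hC hq1 (fun i => hN.A_fderiv m m i) haq)
    f_pow := ?_
    P_ge := ?_
    eq_deriv := ?_
    second_time := ?_
    second_mixed := ?_
    second_space := ?_ }, rfl⟩
  · intro i j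
    have h := congrFun (congrFun hS i) j
    rw [Matrix.diagonal_apply] at h
    rw [← h]
    have hess0 : hessN Γ u (0, t₀) = Matrix.of fun i j => dird (ex i) (dird (ex j) u) (0, t₀) := by
      ext i j; simp [hessN, hN.Γ_zero]
    simp only [SN, WN, hN.H_zero, one_mul, hess0, Matrix.one_mulVec, ← hutt_def, ← ha_def, ← hb_def]
    have hdot : a ⬝ᵥ a = q ^ 2 := by rw [← hqsq, dotProduct]; simp [sq]
    rw [hdot]
    simp only [Matrix.sub_apply, Matrix.add_apply, Matrix.smul_apply, Matrix.of_apply, smul_eq_mul,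
      Matrix.vecMulVec_apply, Matrix.trace, Matrix.diag_apply, Matrix.one_apply]
    split_ifs <;> ring
  · intro i
    have h := (hmc (ex i)).1
    simp only [hex2, ha] at h
    simp only [mul_comm _ (a _)] at h ⊢
    rw [h]; ring
  · have h := (hmc et).1
    simp only [hb, het2] at h
    simp only [mul_comm _ (a _)] at h ⊢
    rw [h]; ring
  · intro m
    have h := abs_sum_sum_mul_le hC (fun i j => hN.H_second i j m) haq
    rw [abs_mul, abs_of_pos (by norm_num : (0 : ℝ) < 1 / 2)]
    refine le_trans ?_ (hmul h)
    linarith [abs_nonneg (∑ i, ∑ j, dird (EuclideanSpace.single m 1)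
      (dird (EuclideanSpace.single m 1) (fun z => H z i j)) 0 * a i * a j)]
  · intro m
    have h := abs_sum_sum_mul_le hC (fun i j => hN.Γ_fderiv j m m i) haq
    refine hmul (le_trans (le_of_eq ?_) h)
    congr 1
    refine Finset.sum_congr rfl fun i _ => ?_
    rw [Finset.mul_sum]
    exact Finset.sum_congr rfl fun j _ => by ring
  · have h := heq.self_of_nhds
    rw [hS, sigma_diagonal hkn] at h
    exact h.symm
  · have hcs : |∑ i, a i * fderiv ℝ f 0 (EuclideanSpace.single i 1)| ≤ q * K := by
      have h1 := Finset.sum_mul_sq_le_sq_mul_sq Finset.univ a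
        (fun i => fderiv ℝ f 0 (EuclideanSpace.single i 1))
      have h2 := Real.abs_le_sqrt h1
      rw [Real.sqrt_mul (by positivity)] at h2
      exact h2.trans (mul_le_mul_of_nonneg_left hfK (by positivity))
    have e : ∑ i, a i * ((k + 2) * f 0 ^ (k + 1) * fderiv ℝ f 0 (EuclideanSpace.single i 1)) =
        (k + 2) * f 0 ^ (k + 1) * ∑ i, a i * fderiv ℝ f 0 (EuclideanSpace.single i 1) := by
      rw [Finset.mul_sum]; exact Finset.sum_congr rfl fun i _ => by ring
    rw [e]
    have hpos : 0 ≤ (k + 2 : ℝ) * f 0 ^ (k + 1) := by positivity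
    have := mul_le_mul_of_nonneg_left (abs_le.1 hcs).1 hpos
    refine le_trans (le_of_eq ?_) this
    ring
  · simp only [hdeq, ← hutt_def, ← ha_def, ← hb_def]
    have key : ∀ m, ∑ i, a i * (dird (ex m) (dird (ex m) (dird (ex i) u)) (0, t₀) -
          2 * (b m / utt) * dird (ex m) (dird et (dird (ex i) u)) (0, t₀) +
          (b m / utt) ^ 2 * dird et (dird et (dird (ex i) u)) (0, t₀) -
          ∑ j, fderiv ℝ (Γ j m m) 0 (EuclideanSpace.single i 1) * a j +
          2 * s * a m * dird (ex m) (dird (ex i) u) (0, t₀) +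
          fderiv ℝ (fun z => A z m m) 0 (EuclideanSpace.single i 1) +
          γ * ∑ j, (dird (ex j) (dird (ex j) (dird (ex i) u)) (0, t₀) -
            ∑ b, fderiv ℝ (Γ b j j) 0 (EuclideanSpace.single i 1) * a b) -
          r * ∑ j, a j * dird (ex j) (dird (ex i) u) (0, t₀)) =
        ∑ i, a i * (dird (ex m) (dird (ex m) (dird (ex i) u)) (0, t₀) -
          2 * (b m / utt) * dird (ex m) (dird et (dird (ex i) u)) (0, t₀) +
          (b m / utt) ^ 2 * dird et (dird et (dird (ex i) u)) (0, t₀)) -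
        ∑ i, a i * ∑ j, fderiv ℝ (Γ j m m) 0 (EuclideanSpace.single i 1) * a j +
        2 * s * a m * ∑ j, dird (ex m) (dird (ex j) u) (0, t₀) * a j +
        ∑ i, a i * fderiv ℝ (fun z => A z m m) 0 (EuclideanSpace.single i 1) +
        γ * ∑ j, (∑ i, a i * dird (ex j) (dird (ex j) (dird (ex i) u)) (0, t₀) -
          ∑ i, a i * ∑ b, fderiv ℝ (Γ b j j) 0 (EuclideanSpace.single i 1) * a b) -
        r * ∑ i, a i * ∑ j, dird (ex i) (dird (ex j) u) (0, t₀) * a j := by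
      intro m
      have e1 : γ * ∑ j, (∑ i, a i * dird (ex j) (dird (ex j) (dird (ex i) u)) (0, t₀) -
          ∑ i, a i * ∑ b, fderiv ℝ (Γ b j j) 0 (EuclideanSpace.single i 1) * a b) =
          ∑ i, a i * (γ * ∑ j, (dird (ex j) (dird (ex j) (dird (ex i) u)) (0, t₀) -
            ∑ b, fderiv ℝ (Γ b j j) 0 (EuclideanSpace.single i 1) * a b)) := by
        simp only [← Finset.sum_sub_distrib, ← mul_sub]
        rw [Finset.sum_comm, Finset.mul_sum]
        refine Finset.sum_congr rfl fun i _ => ?_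
        rw [← Finset.mul_sum]; ring
      have e2 : r * ∑ i, a i * ∑ j, dird (ex i) (dird (ex j) u) (0, t₀) * a j =
          ∑ i, a i * (r * ∑ j, a j * dird (ex j) (dird (ex i) u) (0, t₀)) := by
        simp only [Finset.mul_sum]
        rw [Finset.sum_comm]
        exact Finset.sum_congr rfl fun i _ => Finset.sum_congr rfl fun j _ => by ring
      rw [e1, e2, Finset.mul_sum]
      simp only [← Finset.sum_sub_distrib, ← Finset.sum_add_distrib]
      exact Finset.sum_congr rfl fun i _ => by ring
    simp only [← key]
    have swap : ∀ (σ : ℝ) (T y : Fin n → ℝ) (R : Fin n → Fin n → ℝ),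
        ∑ i, a i * (σ * y i + utt * ∑ m, T m * R m i) =
          σ * ∑ i, a i * y i + utt * ∑ m, T m * ∑ i, a i * R m i := by
      intro σ T y R
      simp only [mul_add, Finset.sum_add_distrib, Finset.mul_sum]
      rw [Finset.sum_comm (γ := Fin n)]
      congr 1
      · exact Finset.sum_congr rfl fun i _ => by ring
      · exact Finset.sum_congr rfl fun i _ => Finset.sum_congr rfl fun j _ => by ring
    exact swap _ _ _ _
  · have h := (hmc et).2
    -- The metric does not depend on time, so the time direction has no metric error term.
    have e0 : ∀ i j, dird (0 : EuclideanSpace ℝ (Fin n)) (dird 0 (fun z => H z i j)) 0 = 0 := by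
      intro i j; simp [dird]
    simp only [hb, het1, het2, e0, zero_mul, Finset.sum_const_zero, mul_zero, add_zero] at h
    linarith
  · intro m
    -- Along this direction the third derivatives appear in exactly the combination that multiplies
    -- u_tt T_m in the differentiated equation.
    have h := (hmc (ex m + (-(b m / utt)) • et)).2
    have e0 : (ex m + (-(b m / utt)) • et : EuclideanSpace ℝ (Fin n) × ℝ).1 =
        EuclideanSpace.single m 1 := by simp [ex, et]
    have e1 : (ex m + (-(b m / utt)) • et : EuclideanSpace ℝ (Fin n) × ℝ).2 = -(b m / utt) := by
      simp [ex, et]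
    rw [e0, e1] at h
    simp only [dird_dird_add_smul hu2, dird_dird_add_smul (hui2 _), hbm, ← hutt_def] at h
    simp only [dird_add_smul, hb, ha] at h
    refine le_trans (le_of_eq ?_) h
    have e2 : ∀ i, dird (ex m) (dird (ex i) u) (0, t₀) + -(b m / utt) * b i =
      dird (ex m) (dird (ex i) u) (0, t₀) - b m / utt * b i := fun i => by ring
    have e3 : ∀ i, dird (ex m) (dird (ex m) (dird (ex i) u)) (0, t₀) +
        2 * -(b m / utt) * dird (ex m) (dird et (dird (ex i) u)) (0, t₀) +
        (-(b m / utt)) ^ 2 * dird et (dird et (dird (ex i) u)) (0, t₀) =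
        dird (ex m) (dird (ex m) (dird (ex i) u)) (0, t₀) -
        2 * (b m / utt) * dird (ex m) (dird et (dird (ex i) u)) (0, t₀) +
        (b m / utt) ^ 2 * dird et (dird et (dird (ex i) u)) (0, t₀) := fun i => by ring
    simp only [e2, e3]
    ring
  · intro m
    have h := (hmc (ex m)).2
    simp only [hex1, hex2, ha] at h
    linarith

end MaximumJet

/-! ### Transformation of the equation under quadratic changes of coordinates. -/

section QuadraticCoordinates

variable {n : ℕ}

/-- The coordinate functions as linear forms. -/
noncomputable def coordL (j : Fin n) : EuclideanSpace ℝ (Fin n) →L[ℝ] ℝ :=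
  EuclideanSpace.proj j

@[simp]
theorem coordL_apply (j : Fin n) (z : EuclideanSpace ℝ (Fin n)) : coordL j z = z j := rfl

/-- The quadratic change of coordinates `z ↦ y + P z - Q(z, z) / 2`. -/
noncomputable def quadMap (y : EuclideanSpace ℝ (Fin n)) (P : Fin n → Fin n → ℝ)
    (Q : Fin n → Fin n → Fin n → ℝ) (z : EuclideanSpace ℝ (Fin n)) : EuclideanSpace ℝ (Fin n) :=
  WithLp.toLp 2 fun c => y c + ∑ j, P c j * z j - 1 / 2 * ∑ i, ∑ j, Q c i j * z i * z j

/-- The Jacobian of `quadMap`, for `Q` symmetric. -/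
def quadJac (P : Fin n → Fin n → ℝ) (Q : Fin n → Fin n → Fin n → ℝ)
    (z : EuclideanSpace ℝ (Fin n)) : Matrix (Fin n) (Fin n) ℝ :=
  Matrix.of fun c j => P c j - ∑ i, Q c i j * z i

/-- The pull-back of a field of bilinear forms by `quadMap`. -/
noncomputable def pullForm (T : EuclideanSpace ℝ (Fin n) → Matrix (Fin n) (Fin n) ℝ)
    (y : EuclideanSpace ℝ (Fin n)) (P : Fin n → Fin n → ℝ) (Q : Fin n → Fin n → Fin n → ℝ)
    (z : EuclideanSpace ℝ (Fin n)) : Matrix (Fin n) (Fin n) ℝ :=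
  (quadJac P Q z)ᵀ * T (quadMap y P Q z) * quadJac P Q z

/-- The connection coefficients in the coordinates given by `quadMap`. -/
noncomputable def pullConn (Γ : Fin n → Fin n → Fin n → EuclideanSpace ℝ (Fin n) → ℝ)
    (y : EuclideanSpace ℝ (Fin n)) (P : Fin n → Fin n → ℝ) (Q : Fin n → Fin n → Fin n → ℝ)
    (m i j : Fin n) (z : EuclideanSpace ℝ (Fin n)) : ℝ :=
  ∑ c, (quadJac P Q z)⁻¹ m c * (-Q c i j + ∑ a, ∑ b, quadJac P Q z a i * quadJac P Q z b j *
    Γ c a b (quadMap y P Q z))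

variable {y : EuclideanSpace ℝ (Fin n)} {P : Fin n → Fin n → ℝ} {Q : Fin n → Fin n → Fin n → ℝ}

theorem quadMap_zero : quadMap y P Q 0 = y := by
  ext c; simp [quadMap]

theorem quadJac_zero : quadJac P Q 0 = Matrix.of P := by
  ext i j; simp [quadJac]

theorem hasFDerivAt_quadMap_apply (hQ : ∀ c i j, Q c i j = Q c j i) (z : EuclideanSpace ℝ (Fin n))
    (c : Fin n) : HasFDerivAt (fun z => quadMap y P Q z c)
      (∑ j, quadJac P Q z c j • coordL j) z := by
  have hp : ∀ j : Fin n, HasFDerivAt (fun z : EuclideanSpace ℝ (Fin n) => z j)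
      (coordL j) z := fun j =>
    (coordL j).hasFDerivAt
  have h1 : HasFDerivAt (fun z : EuclideanSpace ℝ (Fin n) => ∑ j, P c j * z j)
      (∑ j, P c j • coordL j) z :=
    HasFDerivAt.fun_sum fun j _ => (hp j).const_mul (P c j)
  have h2 := (HasFDerivAt.fun_sum (u := Finset.univ) fun i _ =>
    HasFDerivAt.fun_sum (u := Finset.univ) fun j _ =>
      ((hp i).const_mul (Q c i j)).mul (hp j)).const_mul (1 / 2 : ℝ)
  have h3 := (h1.const_add (y c)).sub h2
  convert! h3 using 1
  ext v
  simp only [sum_apply, smul_apply, smul_eq_mul,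
    sub_apply, add_apply, quadJac, Matrix.of_apply,
    coordL_apply, sub_mul, Finset.sum_sub_distrib, Finset.sum_add_distrib,
    Finset.sum_mul]
  congr 1
  rw [Finset.sum_comm]
  have e : ∑ i, ∑ j, Q c i j * z i * v j = ∑ i, ∑ j, z j * (Q c i j * v i) := by
    rw [Finset.sum_comm]
    exact Finset.sum_congr rfl fun i _ => Finset.sum_congr rfl fun j _ => by rw [hQ c j i]; ring
  rw [← e]
  ring

/-- `quadMap` in the space variables, the identity in time. -/
noncomputable def quadMapT (y : EuclideanSpace ℝ (Fin n)) (P : Fin n → Fin n → ℝ)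
    (Q : Fin n → Fin n → Fin n → ℝ) (p : EuclideanSpace ℝ (Fin n) × ℝ) :
    EuclideanSpace ℝ (Fin n) × ℝ := (quadMap y P Q p.1, p.2)

theorem contDiff_quadMap {m : WithTop ℕ∞} : ContDiff ℝ m (quadMap y P Q) := by
  rw [contDiff_euclidean]
  intro i
  simp only [quadMap]
  fun_prop

theorem contDiff_quadMapT {m : WithTop ℕ∞} : ContDiff ℝ m (quadMapT y P Q) :=
  (contDiff_quadMap.comp contDiff_fst).prodMk contDiff_snd

theorem fderiv_quadMap_single (hQ : ∀ c i j, Q c i j = Q c j i) (z : EuclideanSpace ℝ (Fin n))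
    (i : Fin n) : fderiv ℝ (quadMap y P Q) z (EuclideanSpace.single i 1) =
      ∑ c, quadJac P Q z c i • EuclideanSpace.single c (1 : ℝ) := by
  have hd : DifferentiableAt ℝ (quadMap y P Q) z :=
    (contDiff_quadMap (m := 1)).contDiffAt.differentiableAt one_ne_zero
  ext c
  have h := ((coordL c).hasFDerivAt.comp z hd.hasFDerivAt).unique
    (hasFDerivAt_quadMap_apply hQ z c)
  have h2 := congrArg (fun l => l (EuclideanSpace.single i 1)) h
  simp only [ContinuousLinearMap.comp_apply, sum_apply,
    smul_apply, coordL_apply] at h2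
  rw [h2]
  simp [Pi.single_apply]

theorem dird_ex_comp_quadMapT (hQ : ∀ c i j, Q c i j = Q c j i)
    {F : EuclideanSpace ℝ (Fin n) × ℝ → ℝ} {p : EuclideanSpace ℝ (Fin n) × ℝ}
    (hF : DifferentiableAt ℝ F (quadMapT y P Q p)) (i : Fin n) :
    dird (ex i) (fun p => F (quadMapT y P Q p)) p =
      ∑ c, quadJac P Q p.1 c i * dird (ex c) F (quadMapT y P Q p) := by
  have hq : HasFDerivAt (quadMap y P Q) (fderiv ℝ (quadMap y P Q) p.1) p.1 :=
    ((contDiff_quadMap (m := 1)).contDiffAt.differentiableAt one_ne_zero).hasFDerivAt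
  have hΦ : HasFDerivAt (quadMapT y P Q) (((fderiv ℝ (quadMap y P Q) p.1).comp
      (ContinuousLinearMap.fst ℝ _ _)).prod (ContinuousLinearMap.snd ℝ _ _)) p :=
    (hq.comp p hasFDerivAt_fst).prodMk hasFDerivAt_snd
  have h := hF.hasFDerivAt.comp p hΦ
  have h' : fderiv ℝ (fun p => F (quadMapT y P Q p)) p = _ := h.fderiv
  rw [dird, h', ContinuousLinearMap.comp_apply]
  have e : (((fderiv ℝ (quadMap y P Q) p.1).comp
      (ContinuousLinearMap.fst ℝ _ _)).prod (ContinuousLinearMap.snd ℝ _ _)) (ex i) =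
      ∑ c, quadJac P Q p.1 c i • ex c := by
    have e1 : (∑ c, quadJac P Q p.1 c i • ex c : EuclideanSpace ℝ (Fin n) × ℝ) =
      (∑ c, quadJac P Q p.1 c i • EuclideanSpace.single c (1 : ℝ), 0) := by
      apply Prod.ext
      · simp [ex, Prod.fst_sum]
      · simp [ex, Prod.snd_sum]
    rw [e1, ← fderiv_quadMap_single hQ (y := y)]
    simp [ex]
  rw [e, map_sum]
  simp [dird]

theorem dird_et_comp_quadMapT {F : EuclideanSpace ℝ (Fin n) × ℝ → ℝ}
    {p : EuclideanSpace ℝ (Fin n) × ℝ} (hF : DifferentiableAt ℝ F (quadMapT y P Q p)) :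
    dird et (fun p => F (quadMapT y P Q p)) p = dird et F (quadMapT y P Q p) := by
  have hq : HasFDerivAt (quadMap y P Q) (fderiv ℝ (quadMap y P Q) p.1) p.1 :=
    ((contDiff_quadMap (m := 1)).contDiffAt.differentiableAt one_ne_zero).hasFDerivAt
  have hΦ : HasFDerivAt (quadMapT y P Q) (((fderiv ℝ (quadMap y P Q) p.1).comp
      (ContinuousLinearMap.fst ℝ _ _)).prod (ContinuousLinearMap.snd ℝ _ _)) p :=
    (hq.comp p hasFDerivAt_fst).prodMk hasFDerivAt_snd
  have h := hF.hasFDerivAt.comp p hΦ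
  have h' : fderiv ℝ (fun p => F (quadMapT y P Q p)) p = _ := h.fderiv
  rw [dird, h', ContinuousLinearMap.comp_apply]
  simp [et, dird]

variable {u : EuclideanSpace ℝ (Fin n) × ℝ → ℝ} {p : EuclideanSpace ℝ (Fin n) × ℝ}

theorem eventually_quadMapT {q : EuclideanSpace ℝ (Fin n) × ℝ → Prop}
    (h : ∀ᶠ x in 𝓝 (quadMapT y P Q p), q x) : ∀ᶠ x in 𝓝 p, q (quadMapT y P Q x) :=
  ((contDiff_quadMapT (m := 0)).continuous.tendsto p).eventually h

theorem gradN_comp_quadMapT (hQ : ∀ c i j, Q c i j = Q c j i)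
    (hu : DifferentiableAt ℝ u (quadMapT y P Q p)) :
    gradN (fun p => u (quadMapT y P Q p)) p =
      (quadJac P Q p.1)ᵀ *ᵥ gradN u (quadMapT y P Q p) := by
  funext i
  rw [gradN, dird_ex_comp_quadMapT hQ hu]
  simp [Matrix.mulVec, dotProduct, gradN]

theorem dird_et_comp_eventually (hu : ContDiffAt ℝ 2 u (quadMapT y P Q p)) :
    dird et (fun p => u (quadMapT y P Q p)) =ᶠ[𝓝 p] fun p => dird et u (quadMapT y P Q p) := by
  filter_upwards [eventually_quadMapT (hu.eventually (by simp))] with x hx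
  exact dird_et_comp_quadMapT (hx.differentiableAt two_ne_zero)

theorem differentiableAt_dird (hu : ContDiffAt ℝ 2 u p) (v : EuclideanSpace ℝ (Fin n) × ℝ) :
    DifferentiableAt ℝ (dird v u) p :=
  (contDiffAt_dird (m := 1) hu (by norm_num) v).differentiableAt one_ne_zero

theorem gradtN_comp_quadMapT (hQ : ∀ c i j, Q c i j = Q c j i)
    (hu : ContDiffAt ℝ 2 u (quadMapT y P Q p)) :
    gradtN (fun p => u (quadMapT y P Q p)) p =
      (quadJac P Q p.1)ᵀ *ᵥ gradtN u (quadMapT y P Q p) := by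
  funext i
  rw [gradtN, (dird_congr (dird_et_comp_eventually hu) (ex i)).self_of_nhds,
    dird_ex_comp_quadMapT hQ (differentiableAt_dird hu et)]
  simp [Matrix.mulVec, dotProduct, gradtN]

theorem dird_et_et_comp_quadMapT (hu : ContDiffAt ℝ 2 u (quadMapT y P Q p)) :
    dird et (dird et (fun p => u (quadMapT y P Q p))) p =
      dird et (dird et u) (quadMapT y P Q p) := by
  rw [(dird_congr (dird_et_comp_eventually hu) et).self_of_nhds,
    dird_et_comp_quadMapT (differentiableAt_dird hu et)]

theorem hasFDerivAt_quadJac_apply (P : Fin n → Fin n → ℝ) (Q : Fin n → Fin n → Fin n → ℝ)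
    (z : EuclideanSpace ℝ (Fin n)) (c j : Fin n) :
    HasFDerivAt (fun z => quadJac P Q z c j)
      (-∑ i, Q c i j • coordL i) z := by
  have hp : ∀ j : Fin n, HasFDerivAt (fun z : EuclideanSpace ℝ (Fin n) => z j)
      (coordL j) z := fun j =>
    (coordL j).hasFDerivAt
  have h := HasFDerivAt.fun_sum (u := Finset.univ) fun i _ => (hp i).const_mul (Q c i j)
  simpa [quadJac] using h.const_sub (P c j)

/-- The second derivatives of the coordinate change are the constants -Q, the source of the first
sum. -/
theorem dird_ex_dird_ex_comp_quadMapT (hQ : ∀ c i j, Q c i j = Q c j i)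
    (hu : ContDiffAt ℝ 2 u (quadMapT y P Q p)) (i j : Fin n) :
    dird (ex i) (dird (ex j) (fun p => u (quadMapT y P Q p))) p =
      ∑ c, -Q c i j * dird (ex c) u (quadMapT y P Q p) +
      ∑ a, ∑ b, quadJac P Q p.1 a i * quadJac P Q p.1 b j *
        dird (ex a) (dird (ex b) u) (quadMapT y P Q p) := by
  have hev : dird (ex j) (fun p => u (quadMapT y P Q p)) =ᶠ[𝓝 p] fun p =>
      ∑ c, quadJac P Q p.1 c j * dird (ex c) u (quadMapT y P Q p) := by
    filter_upwards [eventually_quadMapT (hu.eventually (by simp))] with x hx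
    exact dird_ex_comp_quadMapT hQ (hx.differentiableAt two_ne_zero) j
  rw [(dird_congr hev (ex i)).self_of_nhds]
  have hJ : ∀ c, HasFDerivAt (fun p : EuclideanSpace ℝ (Fin n) × ℝ => quadJac P Q p.1 c j)
      ((-∑ i, Q c i j • coordL i).comp
        (ContinuousLinearMap.fst ℝ _ _)) p := fun c =>
    (hasFDerivAt_quadJac_apply P Q p.1 c j).comp p hasFDerivAt_fst
  have hU : ∀ c, DifferentiableAt ℝ (fun p => dird (ex c) u (quadMapT y P Q p)) p := fun c =>
    (differentiableAt_dird hu (ex c)).comp p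
      ((contDiff_quadMapT (m := 1)).contDiffAt.differentiableAt one_ne_zero)
  rw [dird_sum fun c _ => (hJ c).differentiableAt.fun_mul (hU c)]
  have e : ∀ c, dird (ex i) (fun p => quadJac P Q p.1 c j * dird (ex c) u (quadMapT y P Q p)) p =
      quadJac P Q p.1 c j * (∑ a, quadJac P Q p.1 a i *
        dird (ex a) (dird (ex c) u) (quadMapT y P Q p)) +
      -Q c i j * dird (ex c) u (quadMapT y P Q p) := by
    intro c
    rw [dird_mul (hJ c).differentiableAt (hU c),
      dird_ex_comp_quadMapT hQ (differentiableAt_dird hu (ex c))]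
    congr 2
    rw [dird, (hJ c).fderiv]
    simp [ex]
  simp only [e, Finset.sum_add_distrib]
  rw [add_comm, Finset.sum_comm (γ := Fin n) (f := fun a b => quadJac P Q p.1 a i *
    quadJac P Q p.1 b j * dird (ex a) (dird (ex b) u) (quadMapT y P Q p))]
  congr 1
  refine Finset.sum_congr rfl fun c _ => ?_
  rw [Finset.mul_sum]
  exact Finset.sum_congr rfl fun a _ => by ring

/-- The inhomogeneous term -Q in `pullConn` cancels the first derivatives of u, so the covariant
Hessian transforms as a tensor. -/
theorem hessN_comp_quadMapT (hQ : ∀ c i j, Q c i j = Q c j i)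
    (hu : ContDiffAt ℝ 2 u (quadMapT y P Q p)) (hJ : (quadJac P Q p.1).det ≠ 0)
    (Γ : Fin n → Fin n → Fin n → EuclideanSpace ℝ (Fin n) → ℝ) :
    hessN (pullConn Γ y P Q) (fun p => u (quadMapT y P Q p)) p =
      (quadJac P Q p.1)ᵀ * hessN Γ u (quadMapT y P Q p) * quadJac P Q p.1 := by
  ext i j
  set J := quadJac P Q p.1 with hJdef
  have hJJ : J * J⁻¹ = 1 := Matrix.mul_nonsing_inv J (isUnit_iff_ne_zero.2 hJ)
  have e1 : ∑ m, pullConn Γ y P Q m i j p.1 * dird (ex m) (fun p => u (quadMapT y P Q p)) p =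
      ∑ c, (-Q c i j + ∑ a, ∑ b, J a i * J b j * Γ c a b (quadMap y P Q p.1)) *
        dird (ex c) u (quadMapT y P Q p) := by
    have hu1 := hu.differentiableAt two_ne_zero
    set R : Fin n → ℝ := fun c => -Q c i j + ∑ a, ∑ b, J a i * J b j * Γ c a b (quadMap y P Q p.1)
      with hR
    set U : Fin n → ℝ := fun c => dird (ex c) u (quadMapT y P Q p) with hU
    have h1 : ∀ m, pullConn Γ y P Q m i j p.1 = (J⁻¹ *ᵥ R) m := fun m => rfl
    have h2 : ∀ m, dird (ex m) (fun p => u (quadMapT y P Q p)) p = (Jᵀ *ᵥ U) m := by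
      intro m
      rw [dird_ex_comp_quadMapT hQ hu1]
      rfl
    simp only [h1, h2]
    change (J⁻¹ *ᵥ R) ⬝ᵥ (Jᵀ *ᵥ U) = R ⬝ᵥ U
    rw [Matrix.mulVec_transpose, dotProduct_comm, ← Matrix.dotProduct_mulVec, Matrix.mulVec_mulVec,
      hJJ, Matrix.one_mulVec, dotProduct_comm]
  simp only [hessN, Matrix.of_apply, e1, dird_ex_dird_ex_comp_quadMapT hQ hu, Matrix.mul_apply,
    Matrix.transpose_apply, ← hJdef]
  simp only [add_mul, Finset.sum_add_distrib, mul_sub, sub_mul, Finset.sum_sub_distrib,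
    Finset.sum_mul, Finset.mul_sum]
  rw [add_sub_add_left_eq_sub]
  congr 1
  · rw [Finset.sum_comm]
    exact Finset.sum_congr rfl fun a _ => Finset.sum_congr rfl fun b _ => by ring
  · refine (Finset.sum_comm.trans ?_).trans Finset.sum_comm
    refine Finset.sum_congr rfl fun a _ => Finset.sum_comm.trans ?_
    refine Finset.sum_congr rfl fun b _ => Finset.sum_congr rfl fun m _ => ?_
    simp only [quadMapT]
    ring

variable {G A : EuclideanSpace ℝ (Fin n) → Matrix (Fin n) (Fin n) ℝ}

theorem inv_pullForm :
    (pullForm G y P Q p.1)⁻¹ =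
      (quadJac P Q p.1)⁻¹ * (G (quadMap y P Q p.1))⁻¹ * ((quadJac P Q p.1)⁻¹)ᵀ := by
  rw [pullForm, Matrix.mul_inv_rev, Matrix.mul_inv_rev, Matrix.transpose_nonsing_inv,
    Matrix.mul_assoc]

theorem inv_pullForm_mul (hJ : (quadJac P Q p.1).det ≠ 0) (N : Matrix (Fin n) (Fin n) ℝ) :
    (pullForm G y P Q p.1)⁻¹ * ((quadJac P Q p.1)ᵀ * N * quadJac P Q p.1) =
      (quadJac P Q p.1)⁻¹ * ((G (quadMap y P Q p.1))⁻¹ * N) * quadJac P Q p.1 := by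
  have hJJ : quadJac P Q p.1 * (quadJac P Q p.1)⁻¹ = 1 :=
    Matrix.mul_nonsing_inv _ (isUnit_iff_ne_zero.2 hJ)
  have h2 : ((quadJac P Q p.1)⁻¹)ᵀ * (quadJac P Q p.1)ᵀ = 1 := by
    rw [← Matrix.transpose_mul, hJJ, Matrix.transpose_one]
  rw [inv_pullForm]
  calc _ = (quadJac P Q p.1)⁻¹ * (G (quadMap y P Q p.1))⁻¹ *
        (((quadJac P Q p.1)⁻¹)ᵀ * (quadJac P Q p.1)ᵀ) * N * quadJac P Q p.1 := by
        simp only [Matrix.mul_assoc]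
    _ = _ := by rw [h2]; simp only [Matrix.mul_assoc, Matrix.one_mul]

/-- Invariance of |∇u|²; the Jacobians of the gradient and of the inverse metric cancel. -/
theorem gradN_dotProduct_comp_quadMapT (hQ : ∀ c i j, Q c i j = Q c j i)
    (hu : DifferentiableAt ℝ u (quadMapT y P Q p)) (hJ : (quadJac P Q p.1).det ≠ 0) :
    gradN (fun p => u (quadMapT y P Q p)) p ⬝ᵥ
        ((pullForm G y P Q p.1)⁻¹ *ᵥ gradN (fun p => u (quadMapT y P Q p)) p) =
      gradN u (quadMapT y P Q p) ⬝ᵥ ((G (quadMap y P Q p.1))⁻¹ *ᵥ gradN u (quadMapT y P Q p)) := by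
  have hJJ : quadJac P Q p.1 * (quadJac P Q p.1)⁻¹ = 1 :=
    Matrix.mul_nonsing_inv _ (isUnit_iff_ne_zero.2 hJ)
  have h2 : ((quadJac P Q p.1)⁻¹)ᵀ * (quadJac P Q p.1)ᵀ = 1 := by
    rw [← Matrix.transpose_mul, hJJ, Matrix.transpose_one]
  rw [gradN_comp_quadMapT hQ hu, inv_pullForm, Matrix.mulVec_mulVec, Matrix.mul_assoc, h2,
    Matrix.mul_one, Matrix.mulVec_transpose, ← Matrix.dotProduct_mulVec, Matrix.mulVec_mulVec,
    ← Matrix.mul_assoc, hJJ, Matrix.one_mul]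

theorem vecMulVec_transpose_mulVec (J : Matrix (Fin n) (Fin n) ℝ) (v : Fin n → ℝ) :
    Matrix.vecMulVec (Jᵀ *ᵥ v) (Jᵀ *ᵥ v) = Jᵀ * Matrix.vecMulVec v v * J := by
  rw [Matrix.mul_vecMulVec, Matrix.vecMulVec_mul, Matrix.mulVec_transpose]

/-- `WN` is transformed by conjugation. -/
theorem WN_comp_quadMapT (hQ : ∀ c i j, Q c i j = Q c j i)
    (hu : ContDiffAt ℝ 2 u (quadMapT y P Q p)) (hJ : (quadJac P Q p.1).det ≠ 0)
    (Γ : Fin n → Fin n → Fin n → EuclideanSpace ℝ (Fin n) → ℝ) (s r γ : ℝ) :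
    WN (fun z => (pullForm G y P Q z)⁻¹) (pullConn Γ y P Q) (pullForm A y P Q) s r γ
        (fun p => u (quadMapT y P Q p)) p =
      (quadJac P Q p.1)⁻¹ * WN (fun y => (G y)⁻¹) Γ A s r γ u (quadMapT y P Q p) *
        quadJac P Q p.1 := by
  have hu1 := hu.differentiableAt two_ne_zero
  have hJJ' : (quadJac P Q p.1)⁻¹ * quadJac P Q p.1 = 1 :=
    Matrix.nonsing_inv_mul _ (isUnit_iff_ne_zero.2 hJ)
  rw [WN, WN, gradN_dotProduct_comp_quadMapT hQ hu1 hJ, hessN_comp_quadMapT hQ hu hJ,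
    gradN_comp_quadMapT hQ hu1, vecMulVec_transpose_mulVec, inv_pullForm_mul hJ]
  have e : ∀ N B : Matrix (Fin n) (Fin n) ℝ, (quadJac P Q p.1)ᵀ * N * quadJac P Q p.1 +
      s • ((quadJac P Q p.1)ᵀ * B * quadJac P Q p.1) + pullForm A y P Q p.1 =
      (quadJac P Q p.1)ᵀ * (N + s • B + A (quadMap y P Q p.1)) * quadJac P Q p.1 := by
    intro N B
    rw [pullForm]
    simp only [Matrix.mul_add, Matrix.add_mul, Matrix.mul_smul, Matrix.smul_mul]
  rw [e, inv_pullForm_mul hJ, Matrix.trace_mul_comm,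
    Matrix.mul_nonsing_inv_cancel_left _ _ (isUnit_iff_ne_zero.2 hJ)]
  simp only [Matrix.mul_add, Matrix.add_mul, Matrix.mul_smul, Matrix.smul_mul, Matrix.mul_one, hJJ']
  rfl

/-- `SN` is transformed by conjugation. -/
theorem SN_comp_quadMapT (hQ : ∀ c i j, Q c i j = Q c j i)
    (hu : ContDiffAt ℝ 2 u (quadMapT y P Q p)) (hJ : (quadJac P Q p.1).det ≠ 0)
    (Γ : Fin n → Fin n → Fin n → EuclideanSpace ℝ (Fin n) → ℝ) (s r γ : ℝ) :
    SN (fun z => (pullForm G y P Q z)⁻¹) (pullConn Γ y P Q) (pullForm A y P Q) s r γ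
        (fun p => u (quadMapT y P Q p)) p =
      (quadJac P Q p.1)⁻¹ * SN (fun y => (G y)⁻¹) Γ A s r γ u (quadMapT y P Q p) *
        quadJac P Q p.1 := by
  rw [SN, SN, WN_comp_quadMapT hQ hu hJ, gradtN_comp_quadMapT hQ hu, vecMulVec_transpose_mulVec,
    inv_pullForm_mul hJ, dird_et_et_comp_quadMapT hu]
  simp only [Matrix.mul_sub, Matrix.sub_mul, Matrix.mul_smul, Matrix.smul_mul]
  rfl

end QuadraticCoordinates

/-! ### Smooth dependence of determinants, products and inverses. -/

section MatrixCalculus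

variable {V : Type*} [NormedAddCommGroup V] [NormedSpace ℝ V] {n : ℕ} {m : WithTop ℕ∞}

theorem contDiffAt_det {N : V → Matrix (Fin n) (Fin n) ℝ} {p : V}
    (hN : ∀ i j, ContDiffAt ℝ m (fun x => N x i j) p) : ContDiffAt ℝ m (fun x => (N x).det) p := by
  simp only [Matrix.det_apply]
  refine ContDiffAt.sum fun σ _ => ?_
  exact (contDiffAt_prod fun i _ => hN _ _).const_smul _

theorem contDiffAt_matrix_mul {N N' : V → Matrix (Fin n) (Fin n) ℝ} {p : V}
    (hN : ∀ i j, ContDiffAt ℝ m (fun x => N x i j) p)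
    (hN' : ∀ i j, ContDiffAt ℝ m (fun x => N' x i j) p) (i j : Fin n) :
    ContDiffAt ℝ m (fun x => (N x * N' x) i j) p := by
  simp only [Matrix.mul_apply]
  exact ContDiffAt.sum fun a _ => (hN i a).mul (hN' a j)

/-- Cramer's rule expresses the entries of the inverse as quotients of determinants. -/
theorem contDiffAt_matrix_inv {N : V → Matrix (Fin n) (Fin n) ℝ} {p : V}
    (hN : ∀ i j, ContDiffAt ℝ m (fun x => N x i j) p) (hdet : (N p).det ≠ 0) (i j : Fin n) :
    ContDiffAt ℝ m (fun x => (N x)⁻¹ i j) p := by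
  have e : (fun x => (N x)⁻¹ i j) = fun x => (N x).det⁻¹ * ((N x).updateRow j (Pi.single i 1)).det := by
    funext x
    rw [Matrix.inv_def, Matrix.smul_apply, Matrix.adjugate_apply, Ring.inverse_eq_inv', smul_eq_mul]
  rw [e]
  refine ((contDiffAt_det hN).inv hdet).mul (contDiffAt_det fun a b => ?_)
  by_cases ha : a = j
  · subst ha; simpa using contDiffAt_const
  · simpa [Matrix.updateRow_ne ha] using hN a b

end MatrixCalculus

/-! ### Bounds for derivatives, uniform over compact parameter sets. -/

section ParameterBounds

variable {X Z : Type*} [NormedAddCommGroup X] [NormedSpace ℝ X] [NormedAddCommGroup Z]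
  [NormedSpace ℝ Z]

/-- A partial derivative is a full derivative along (0, v), hence continuous in the parameter as
well. -/
theorem dird_partial {F : X × Z → ℝ} {x : X} {z : Z} (hF : DifferentiableAt ℝ F (x, z)) (v : Z) :
    dird v (fun z => F (x, z)) z = dird ((0 : X), v) F (x, z) := by
  have h : HasFDerivAt (fun z => F (x, z)) ((fderiv ℝ F (x, z)).comp
      (ContinuousLinearMap.inr ℝ X Z)) z :=
    hF.hasFDerivAt.comp z (hasFDerivAt_prodMk_right x z)
  rw [dird, h.fderiv]
  simp [dird]

/-- Derivatives in the second variable are bounded uniformly on compact sets of parameters. -/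
theorem exists_bound_partial {F : X × Z → ℝ} {K : Set X} (hK : IsCompact K)
    (hF : ∀ x ∈ K, ContDiffAt ℝ 2 F (x, 0)) (v : Z) :
    ∃ C, ∀ x ∈ K, |F (x, 0)| ≤ C ∧ |dird v (fun z => F (x, z)) 0| ≤ C ∧
      |dird v (dird v (fun z => F (x, z))) 0| ≤ C := by
  have hcont : ∀ x : X, ContinuousAt (fun x : X => (x, (0 : Z))) x := fun x => by fun_prop
  have hd1 : ∀ x ∈ K, ContDiffAt ℝ 1 (dird ((0 : X), v) F) (x, 0) := fun x hx =>
    contDiffAt_dird (hF x hx) (by norm_num) _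
  have hd2 : ∀ x ∈ K, ContDiffAt ℝ 0 (dird ((0 : X), v) (dird ((0 : X), v) F)) (x, 0) := fun x hx =>
    contDiffAt_dird (hd1 x hx) (by norm_num) _
  obtain ⟨C₀, h₀⟩ := hK.exists_bound_of_continuousOn (f := fun x => F (x, 0)) fun x hx =>
    (ContinuousAt.comp (f := fun x : X => (x, (0 : Z))) (hF x hx).continuousAt
      (hcont x)).continuousWithinAt
  obtain ⟨C₁, h₁⟩ := hK.exists_bound_of_continuousOn (f := fun x => dird ((0 : X), v) F (x, 0))
    fun x hx => (ContinuousAt.comp (f := fun x : X => (x, (0 : Z))) (hd1 x hx).continuousAt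
      (hcont x)).continuousWithinAt
  obtain ⟨C₂, h₂⟩ := hK.exists_bound_of_continuousOn
    (f := fun x => dird ((0 : X), v) (dird ((0 : X), v) F) (x, 0))
    fun x hx => (ContinuousAt.comp (f := fun x : X => (x, (0 : Z))) (hd2 x hx).continuousAt
      (hcont x)).continuousWithinAt
  refine ⟨max C₀ (max C₁ C₂), fun x hx => ⟨?_, ?_, ?_⟩⟩
  · exact (h₀ x hx).trans (le_max_left _ _)
  · rw [dird_partial ((hF x hx).differentiableAt two_ne_zero)]
    exact (h₁ x hx).trans ((le_max_left _ _).trans (le_max_right _ _))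
  · have hev : dird v (fun z => F (x, z)) =ᶠ[𝓝 0] fun z => dird ((0 : X), v) F (x, z) := by
      have hc : Filter.Tendsto (fun z : Z => (x, z)) (𝓝 0) (𝓝 (x, 0)) :=
        (by fun_prop : Continuous fun z : Z => (x, z)).tendsto 0
      filter_upwards [hc.eventually ((hF x hx).eventually (by simp))] with z hz
      exact dird_partial (hz.differentiableAt two_ne_zero) v
    rw [(dird_congr hev v).self_of_nhds,
      dird_partial ((hd1 x hx).differentiableAt one_ne_zero)]
    exact (h₂ x hx).trans ((le_max_right _ _).trans (le_max_right _ _))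

theorem exists_bound_partial_family {ι κ : Type*} [Finite ι] [Finite κ] {F : ι → X × Z → ℝ}
    {K : Set X} (hK : IsCompact K) (hF : ∀ i, ∀ x ∈ K, ContDiffAt ℝ 2 (F i) (x, 0)) (v : κ → Z) :
    ∃ C, 0 ≤ C ∧ ∀ x ∈ K, ∀ i m, |F i (x, 0)| ≤ C ∧ |dird (v m) (fun z => F i (x, z)) 0| ≤ C ∧
      |dird (v m) (dird (v m) (fun z => F i (x, z))) 0| ≤ C := by
  choose C hC using fun i m => exists_bound_partial hK (hF i) (v m)
  have := Fintype.ofFinite ι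
  have := Fintype.ofFinite κ
  refine ⟨∑ i, ∑ m, |C i m|, by positivity, fun x hx i m => ?_⟩
  have hle : C i m ≤ ∑ i, ∑ m, |C i m| :=
    (le_abs_self _).trans ((Finset.single_le_sum (f := fun m => |C i m|)
      (fun _ _ => abs_nonneg _) (Finset.mem_univ m)).trans
      (Finset.single_le_sum (f := fun i => ∑ m, |C i m|)
        (fun _ _ => Finset.sum_nonneg fun _ _ => abs_nonneg _) (Finset.mem_univ i)))
  obtain ⟨h1, h2, h3⟩ := hC i m x hx
  exact ⟨h1.trans hle, h2.trans hle, h3.trans hle⟩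

end ParameterBounds

/-! ### Christoffel symbols and compatibility with the metric. -/

section Christoffel

variable {n : ℕ}

/-- The Christoffel symbols of a metric on the coordinate space. -/
noncomputable def chr (G : EuclideanSpace ℝ (Fin n) → Matrix (Fin n) (Fin n) ℝ) (m i j : Fin n)
    (y : EuclideanSpace ℝ (Fin n)) : ℝ :=
  1 / 2 * ∑ l, (G y)⁻¹ m l *
    (pd i (fun y => G y j l) y + pd j (fun y => G y i l) y - pd l (fun y => G y i j) y)

/-- The quadratic part of coordinates that are normal at `y`. -/
noncomputable def normalQ (G : EuclideanSpace ℝ (Fin n) → Matrix (Fin n) (Fin n) ℝ)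
    (y : EuclideanSpace ℝ (Fin n)) (P : Fin n → Fin n → ℝ) (c i j : Fin n) : ℝ :=
  ∑ a, ∑ b, chr G c a b y * P a i * P b j

variable {G A : EuclideanSpace ℝ (Fin n) → Matrix (Fin n) (Fin n) ℝ}
  {y : EuclideanSpace ℝ (Fin n)} {P : Fin n → Fin n → ℝ}

theorem chr_symm (hG : ∀ y i j, G y i j = G y j i) (m i j : Fin n) (y) :
    chr G m i j y = chr G m j i y := by
  simp only [chr]
  congr 1
  refine Finset.sum_congr rfl fun l _ => ?_
  rw [show (fun y => G y i j) = fun y => G y j i from funext fun y => hG y i j]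
  ring

theorem normalQ_symm (hG : ∀ y i j, G y i j = G y j i) (c i j : Fin n) :
    normalQ G y P c i j = normalQ G y P c j i := by
  simp only [normalQ]
  rw [Finset.sum_comm]
  exact Finset.sum_congr rfl fun a _ => Finset.sum_congr rfl fun b _ => by
    rw [chr_symm hG c b a]; ring

/-- Lowering the upper index removes the inverse metric and leaves the symbols of the first kind. -/
theorem sum_metric_mul_chr (hdet : (G y).det ≠ 0) (b c d : Fin n) :
    ∑ a, G y b a * chr G a c d y =
      1 / 2 * (pd c (fun y => G y d b) y + pd d (fun y => G y c b) y -
        pd b (fun y => G y c d) y) := by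
  set R : Fin n → ℝ := fun l => pd c (fun y => G y d l) y + pd d (fun y => G y c l) y -
    pd l (fun y => G y c d) y with hR
  have h1 : ∀ a, chr G a c d y = 1 / 2 * ((G y)⁻¹ *ᵥ R) a := fun a => rfl
  have h2 : G y *ᵥ ((G y)⁻¹ *ᵥ R) = R := by
    rw [Matrix.mulVec_mulVec, Matrix.mul_nonsing_inv _ (isUnit_iff_ne_zero.2 hdet),
      Matrix.one_mulVec]
  have h3 := congrFun h2 b
  rw [Matrix.mulVec, dotProduct] at h3
  change _ = 1 / 2 * R b
  rw [← h3, Finset.mul_sum]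
  exact Finset.sum_congr rfl fun a _ => by rw [h1]; ring

/-- ∇g = 0 in coordinates. This is why a quadratic part built from the Christoffel symbols removes
the first derivatives of the metric. -/
theorem metric_compat (hG : ∀ y i j, G y i j = G y j i) (hdet : (G y).det ≠ 0) (a b c : Fin n) :
    pd c (fun y => G y a b) y = ∑ d, G y b d * chr G d c a y + ∑ d, G y a d * chr G d c b y := by
  rw [sum_metric_mul_chr hdet, sum_metric_mul_chr hdet]
  rw [show (fun y => G y b a) = fun y => G y a b from funext fun y => hG y b a,
    show (fun y => G y c a) = fun y => G y a c from funext fun y => hG y c a,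
    show (fun y => G y c b) = fun y => G y b c from funext fun y => hG y c b]
  ring

theorem contDiffAt_chr (hG : ∀ i j, ContDiffAt ℝ ∞ (fun y => G y i j) y) (hdet : (G y).det ≠ 0)
    (m i j : Fin n) : ContDiffAt ℝ ∞ (chr G m i j) y := by
  have hpd : ∀ l i j, ContDiffAt ℝ ∞ (pd l (fun y => G y i j)) y := fun l i j =>
    contDiffAt_dird (m := ∞) (hG i j) (by simp) _
  unfold chr
  refine contDiffAt_const.mul (ContDiffAt.sum fun l _ => ?_)
  exact (contDiffAt_matrix_inv hG hdet m l).mul (((hpd _ _ _).add (hpd _ _ _)).sub (hpd _ _ _))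

end Christoffel

/-! ### Normal coordinates at a point, with uniform constants. -/

section NormalCoordinates

variable {n : ℕ} {G A : EuclideanSpace ℝ (Fin n) → Matrix (Fin n) (Fin n) ℝ}
  {y : EuclideanSpace ℝ (Fin n)} {P : Fin n → Fin n → ℝ} {Q : Fin n → Fin n → Fin n → ℝ}

/-- Base point, linear part and quadratic part of a quadratic change of coordinates. -/
abbrev QuadParam (n : ℕ) : Type :=
  EuclideanSpace ℝ (Fin n) × (Fin n → Fin n → ℝ) × (Fin n → Fin n → Fin n → ℝ)

theorem contDiff_quadMap_param {m : WithTop ℕ∞} : ContDiff ℝ m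
    (fun p : QuadParam n × EuclideanSpace ℝ (Fin n) => quadMap p.1.1 p.1.2.1 p.1.2.2 p.2) := by
  rw [contDiff_euclidean]
  intro i
  simp only [quadMap]
  fun_prop

theorem contDiff_quadJac_param {m : WithTop ℕ∞} (i j : Fin n) : ContDiff ℝ m
    (fun p : QuadParam n × EuclideanSpace ℝ (Fin n) => quadJac p.1.2.1 p.1.2.2 p.2 i j) := by
  simp only [quadJac, Matrix.of_apply]
  fun_prop

theorem contDiffAt_comp_quadMap_param {F : EuclideanSpace ℝ (Fin n) → ℝ}
    (hF : ContDiffAt ℝ ∞ F y) : ContDiffAt ℝ ∞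
      (fun p : QuadParam n × EuclideanSpace ℝ (Fin n) => F (quadMap p.1.1 p.1.2.1 p.1.2.2 p.2))
      ((y, P, Q), 0) := by
  refine ContDiffAt.comp (g := F) (f := fun p : QuadParam n × EuclideanSpace ℝ (Fin n) =>
    quadMap p.1.1 p.1.2.1 p.1.2.2 p.2) _ ?_ contDiff_quadMap_param.contDiffAt
  simpa only [quadMap_zero] using hF

theorem contDiffAt_pullForm_param (hG : ∀ i j, ContDiffAt ℝ ∞ (fun y => G y i j) y) (i j : Fin n) :
    ContDiffAt ℝ ∞ (fun p : QuadParam n × EuclideanSpace ℝ (Fin n) =>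
      pullForm G p.1.1 p.1.2.1 p.1.2.2 p.2 i j) ((y, P, Q), 0) := by
  unfold pullForm
  refine contDiffAt_matrix_mul (fun i j => contDiffAt_matrix_mul (fun i j => ?_) (fun i j => ?_) i j)
    (fun i j => (contDiff_quadJac_param i j).contDiffAt) i j
  · exact (contDiff_quadJac_param j i).contDiffAt
  · exact contDiffAt_comp_quadMap_param (hG i j)

theorem pullForm_zero : pullForm G y P Q 0 = (Matrix.of P)ᵀ * G y * Matrix.of P := by
  rw [pullForm, quadJac_zero, quadMap_zero]

theorem det_ne_zero_of_normalized (h : (Matrix.of P)ᵀ * G y * Matrix.of P = 1) :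
    (Matrix.of P).det ≠ 0 := by
  intro h0
  have := congrArg Matrix.det h
  rw [Matrix.det_mul, h0, mul_zero, Matrix.det_one] at this
  exact zero_ne_one this

theorem contDiffAt_inv_pullForm_param (hG : ∀ i j, ContDiffAt ℝ ∞ (fun y => G y i j) y)
    (h : (Matrix.of P)ᵀ * G y * Matrix.of P = 1) (i j : Fin n) :
    ContDiffAt ℝ ∞ (fun p : QuadParam n × EuclideanSpace ℝ (Fin n) =>
      (pullForm G p.1.1 p.1.2.1 p.1.2.2 p.2)⁻¹ i j) ((y, P, Q), 0) := by
  refine contDiffAt_matrix_inv (contDiffAt_pullForm_param hG) ?_ i j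
  simp [pullForm_zero, h]

theorem contDiffAt_pullConn_param {Γ : Fin n → Fin n → Fin n → EuclideanSpace ℝ (Fin n) → ℝ}
    (hΓ : ∀ c i j, ContDiffAt ℝ ∞ (Γ c i j) y) (hP : (Matrix.of P).det ≠ 0) (m i j : Fin n) :
    ContDiffAt ℝ ∞ (fun p : QuadParam n × EuclideanSpace ℝ (Fin n) =>
      pullConn Γ p.1.1 p.1.2.1 p.1.2.2 m i j p.2) ((y, P, Q), 0) := by
  unfold pullConn
  have hJ : ∀ i j, ContDiffAt ℝ ∞ (fun p : QuadParam n × EuclideanSpace ℝ (Fin n) =>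
      quadJac p.1.2.1 p.1.2.2 p.2 i j) ((y, P, Q), 0) := fun i j =>
    (contDiff_quadJac_param i j).contDiffAt
  refine ContDiffAt.sum fun c _ => ContDiffAt.mul ?_ (ContDiffAt.add ?_ ?_)
  · refine contDiffAt_matrix_inv (N := fun p : QuadParam n × EuclideanSpace ℝ (Fin n) =>
      quadJac p.1.2.1 p.1.2.2 p.2) hJ ?_ m c
    simpa [quadJac_zero] using hP
  · exact (by fun_prop : ContDiff ℝ ∞ fun p : QuadParam n × EuclideanSpace ℝ (Fin n) =>
      -p.1.2.2 c i j).contDiffAt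
  · exact ContDiffAt.sum fun a _ => ContDiffAt.sum fun b _ =>
      ((hJ a i).mul (hJ b j)).mul (contDiffAt_comp_quadMap_param (hΓ c a b))

theorem contDiffAt_of_param {F : QuadParam n × EuclideanSpace ℝ (Fin n) → ℝ} {x : QuadParam n}
    (h : ContDiffAt ℝ ∞ F (x, 0)) : ContDiffAt ℝ ∞ (fun z => F (x, z)) 0 :=
  ContDiffAt.comp (g := F) (f := fun z : EuclideanSpace ℝ (Fin n) => (x, z)) 0 h
    (contDiffAt_const.prodMk contDiffAt_id)

/-- At the center the inhomogeneous term and the transformed Christoffel symbols cancel by the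
definition of `normalQ`. -/
theorem pullConn_normal_zero (m i j : Fin n) :
    pullConn (chr G) y P (normalQ G y P) m i j 0 = 0 := by
  simp only [pullConn, quadJac_zero, quadMap_zero, Matrix.of_apply]
  refine Finset.sum_eq_zero fun c _ => ?_
  have : ∑ a, ∑ b, P a i * P b j * chr G c a b y = normalQ G y P c i j :=
    Finset.sum_congr rfl fun a _ => Finset.sum_congr rfl fun b _ => by ring
  rw [this]; ring

/-- In normal coordinates the first derivatives of the metric vanish at the center. -/
theorem fderiv_pullForm_normal (hsymm : ∀ y i j, G y i j = G y j i)
    (hG : ∀ i j, ContDiffAt ℝ ∞ (fun y => G y i j) y) (hdet : (G y).det ≠ 0) (i j : Fin n) :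
    fderiv ℝ (fun z => pullForm G y P (normalQ G y P) z i j) 0 = 0 := by
  have hQ := normalQ_symm (P := P) (y := y) hsymm
  set Q := normalQ G y P with hQdef
  have hJ := hasFDerivAt_quadJac_apply P Q 0
  have hGd : ∀ a b, HasFDerivAt (fun z => G (quadMap y P Q z) a b)
      ((fderiv ℝ (fun y => G y a b) y).comp (fderiv ℝ (quadMap y P Q) 0)) 0 := by
    intro a b
    have h1 : HasFDerivAt (fun y => G y a b) (fderiv ℝ (fun y => G y a b) y) (quadMap y P Q 0) := by
      rw [quadMap_zero]
      exact ((hG a b).differentiableAt (by simp)).hasFDerivAt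
    exact h1.comp 0 ((contDiff_quadMap (m := 1)).contDiffAt.differentiableAt
      one_ne_zero).hasFDerivAt
  have hsum := HasFDerivAt.fun_sum (u := Finset.univ) fun b _ =>
    (HasFDerivAt.fun_sum (u := Finset.univ) fun a _ => (hJ a i).mul (hGd a b)).mul (hJ b j)
  have hfun : (fun z => pullForm G y P Q z i j) = fun z => ∑ b, (∑ a, quadJac P Q z a i *
      G (quadMap y P Q z) a b) * quadJac P Q z b j := by
    funext z
    simp only [pullForm, Matrix.mul_apply, Matrix.transpose_apply]
  rw [hfun]
  refine Eq.trans hsum.fderiv ?_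
  refine ContinuousLinearMap.coe_injective
    ((EuclideanSpace.basisFun (Fin n) ℝ).toBasis.ext fun m => ?_)
  have eJ : ∀ a i, (-∑ l, Q a l i • coordL l) (EuclideanSpace.single m (1 : ℝ)) = -Q a m i := by
    intro a i; simp
  have eG : ∀ a b, fderiv ℝ (fun y => G y a b) y
      (fderiv ℝ (quadMap y P Q) 0 (EuclideanSpace.single m 1)) =
      ∑ c, P c m * (∑ d, G y b d * chr G d c a y + ∑ d, G y a d * chr G d c b y) := by
    intro a b
    rw [fderiv_quadMap_single hQ, map_sum, quadJac_zero]
    refine Finset.sum_congr rfl fun c _ => ?_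
    rw [← metric_compat hsymm hdet, map_smul]
    rfl
  -- Contracting the Christoffel symbols with the frame gives back Q, so each half of ∇g = 0 cancels
  -- one derivative of the Jacobian.
  have q1 : ∀ b i, ∑ a, P a i * ∑ c, P c m * ∑ d, G y b d * chr G d c a y =
      ∑ d, G y b d * Q d m i := by
    intro b i
    simp only [hQdef, normalQ, Finset.mul_sum]
    rw [Finset.sum_comm]
    refine (Finset.sum_congr rfl fun c _ => Finset.sum_comm).trans ?_
    rw [Finset.sum_comm]
    exact Finset.sum_congr rfl fun d _ => Finset.sum_congr rfl fun c _ =>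
      Finset.sum_congr rfl fun a _ => by ring
  simp only [OrthonormalBasis.coe_toBasis, EuclideanSpace.basisFun_apply,
    ContinuousLinearMap.coe_coe, Pi.mul_apply, sum_apply, add_apply, smul_apply,
    ContinuousLinearMap.comp_apply, eJ, eG, quadJac_zero, quadMap_zero, Matrix.of_apply,
    smul_eq_mul, LinearMap.zero_apply, ContinuousLinearMap.toLinearMap_zero]
  have e1 : ∀ b, (∑ a, P a i * G y a b) * -Q b m j +
      P b j * ∑ a, (P a i * ∑ c, P c m * (∑ d, G y b d * chr G d c a y +
        ∑ d, G y a d * chr G d c b y) + G y a b * -Q a m i) =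
      P b j * (∑ a, P a i * ∑ c, P c m * ∑ d, G y a d * chr G d c b y) -
        (∑ a, P a i * G y a b) * Q b m j := by
    intro b
    have : ∑ a, G y a b * -Q a m i = -∑ d, G y b d * Q d m i := by
      rw [← Finset.sum_neg_distrib]
      exact Finset.sum_congr rfl fun a _ => by rw [hsymm y a b]; ring
    rw [Finset.sum_add_distrib, this, ← q1 b i]
    simp only [mul_add, Finset.sum_add_distrib]
    ring
  simp only [e1, Finset.sum_sub_distrib]
  rw [sub_eq_zero]
  have swap : ∀ (v w : Fin n → ℝ) (R : Fin n → Fin n → ℝ),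
      ∑ b, v b * ∑ a, w a * R a b = ∑ a, w a * ∑ b, v b * R a b := by
    intro v w R
    simp only [Finset.mul_sum]
    rw [Finset.sum_comm]
    exact Finset.sum_congr rfl fun a _ => Finset.sum_congr rfl fun b _ => by ring
  rw [swap]
  simp only [q1]
  simp only [Finset.mul_sum, Finset.sum_mul]
  rw [Finset.sum_comm]
  exact Finset.sum_congr rfl fun a _ => Finset.sum_congr rfl fun b _ => by ring

/-- Differentiating F⁻¹ F = 1 at the center, where F = 1 and its derivative vanishes. -/
theorem fderiv_inv_pullForm_normal (hsymm : ∀ y i j, G y i j = G y j i)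
    (hG : ∀ i j, ContDiffAt ℝ ∞ (fun y => G y i j) y) (hdet : (G y).det ≠ 0)
    (h : (Matrix.of P)ᵀ * G y * Matrix.of P = 1) (i j : Fin n) :
    fderiv ℝ (fun z => (pullForm G y P (normalQ G y P) z)⁻¹ i j) 0 = 0 := by
  set F := pullForm G y P (normalQ G y P) with hF
  have hF0 : F 0 = 1 := by rw [hF, pullForm_zero, h]
  have hFd : ∀ i j, ContDiffAt ℝ ∞ (fun z => F z i j) 0 := fun i j =>
    contDiffAt_of_param (contDiffAt_pullForm_param hG i j)
  have hFd' : ∀ i j, HasFDerivAt (fun z => F z i j) (0 : _ →L[ℝ] ℝ) 0 := by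
    intro i j
    have := ((hFd i j).differentiableAt (by simp)).hasFDerivAt
    rwa [fderiv_pullForm_normal hsymm hG hdet] at this
  have hI : ∀ i j, HasFDerivAt (fun z => (F z)⁻¹ i j) (fderiv ℝ (fun z => (F z)⁻¹ i j) 0) 0 :=
    fun i j => ((contDiffAt_of_param (contDiffAt_inv_pullForm_param hG h i j)).differentiableAt
      (by simp)).hasFDerivAt
  have hprod := HasFDerivAt.fun_sum (u := Finset.univ) fun l _ => (hI i l).mul (hFd' l j)
  have hone : (fun z => ∑ l, (F z)⁻¹ i l * F z l j) =ᶠ[𝓝 0]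
      fun _ => (1 : Matrix (Fin n) (Fin n) ℝ) i j := by
    have hc : ContinuousAt (fun z => (F z).det) 0 := (contDiffAt_det hFd).continuousAt
    have hne : ∀ᶠ z in 𝓝 0, (F z).det ≠ 0 := hc.eventually_ne (by simp [hF0])
    filter_upwards [hne] with z hz
    rw [← Matrix.mul_apply, Matrix.nonsing_inv_mul _ (isUnit_iff_ne_zero.2 hz)]
  have := (hprod.congr_of_eventuallyEq hone.symm).unique
    (hasFDerivAt_const ((1 : Matrix (Fin n) (Fin n) ℝ) i j) 0)
  rw [← this]
  simp [hF0, Matrix.one_apply]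

/-- A normalized frame satisfies P Pᵀ = G⁻¹, whose diagonal entries are sums of squares of the rows.
This bounds the frames over a compact set. -/
theorem sq_le_inv_of_normalized (hdet : (G y).det ≠ 0)
    (h : (Matrix.of P)ᵀ * G y * Matrix.of P = 1) (i j : Fin n) : P i j ^ 2 ≤ (G y)⁻¹ i i := by
  have h1 : Matrix.of P * ((Matrix.of P)ᵀ * G y) = 1 := mul_eq_one_comm.1 h
  have h2 : Matrix.of P * (Matrix.of P)ᵀ = (G y)⁻¹ := by
    rw [← Matrix.mul_nonsing_inv_cancel_right (G y) (Matrix.of P * (Matrix.of P)ᵀ)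
      (isUnit_iff_ne_zero.2 hdet), Matrix.mul_assoc (Matrix.of P), h1, Matrix.one_mul]
  rw [← h2, Matrix.mul_apply]
  refine le_trans (le_of_eq ?_) (Finset.single_le_sum (f := fun l => Matrix.of P i l *
    (Matrix.of P)ᵀ l i) (fun l _ => mul_self_nonneg _) (Finset.mem_univ j))
  simp [sq]

/-- Normalized frames over a compact set form a compact set. -/
theorem isCompact_normalized {K : Set (EuclideanSpace ℝ (Fin n))} (hK : IsCompact K)
    (hG : ∀ y ∈ K, ∀ i j, ContDiffAt ℝ ∞ (fun y => G y i j) y) (hdet : ∀ y ∈ K, (G y).det ≠ 0) :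
    IsCompact {p : EuclideanSpace ℝ (Fin n) × (Fin n → Fin n → ℝ) | p.1 ∈ K ∧
      (Matrix.of p.2)ᵀ * G p.1 * Matrix.of p.2 = 1} := by
  have hb : ∀ i, ∃ C, ∀ y ∈ K, ‖(G y)⁻¹ i i‖ ≤ C := fun i =>
    hK.exists_bound_of_continuousOn fun y hy =>
      (contDiffAt_matrix_inv (hG y hy) (hdet y hy) i i).continuousAt.continuousWithinAt
  choose C hC using hb
  set R := 1 + ∑ i, |C i| with hR
  have hR0 : 0 ≤ R := by positivity
  have hball : ∀ p : EuclideanSpace ℝ (Fin n) × (Fin n → Fin n → ℝ), p.1 ∈ K →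
      (Matrix.of p.2)ᵀ * G p.1 * Matrix.of p.2 = 1 →
      p.2 ∈ Metric.closedBall (0 : Fin n → Fin n → ℝ) R := by
    intro p hp h
    rw [mem_closedBall_zero_iff, pi_norm_le_iff_of_nonneg hR0]
    intro i
    rw [pi_norm_le_iff_of_nonneg hR0]
    intro j
    have h1 := sq_le_inv_of_normalized (hdet p.1 hp) h i j
    have h2 := (le_abs_self _).trans (hC i p.1 hp)
    have h3 : |C i| ≤ ∑ i, |C i| :=
      Finset.single_le_sum (f := fun i => |C i|) (fun _ _ => abs_nonneg _) (Finset.mem_univ i)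
    rw [Real.norm_eq_abs]
    refine abs_le_of_sq_le_sq ?_ hR0
    have h4 := le_abs_self (C i)
    have h5 : 0 ≤ ∑ i, |C i| := by positivity
    nlinarith
  have hcomp : IsCompact (K ×ˢ Metric.closedBall (0 : Fin n → Fin n → ℝ) R) :=
    hK.prod (isCompact_closedBall _ _)
  have hcont : ContinuousOn (fun p : EuclideanSpace ℝ (Fin n) × (Fin n → Fin n → ℝ) =>
      (Matrix.of p.2)ᵀ * G p.1 * Matrix.of p.2) (K ×ˢ Metric.closedBall 0 R) := by
    refine continuousOn_pi.2 fun i => continuousOn_pi.2 fun j => ?_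
    have hP : ∀ i j, ContDiff ℝ ∞ (fun p : EuclideanSpace ℝ (Fin n) × (Fin n → Fin n → ℝ) =>
      p.2 i j) := fun i j => by fun_prop
    intro p hp
    refine (contDiffAt_matrix_mul (m := ∞) (fun i j => contDiffAt_matrix_mul (fun i j => ?_)
      (fun i j => ?_) i j) (fun i j => ?_) i j).continuousAt.continuousWithinAt
    · exact (hP j i).contDiffAt
    · exact ContDiffAt.comp (g := fun y => G y i j) p (hG p.1 hp.1 i j) contDiffAt_fst
    · exact (hP i j).contDiffAt
  have hclosed := hcont.preimage_isClosed_of_isClosed hcomp.isClosed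
    (isClosed_singleton (x := (1 : Matrix (Fin n) (Fin n) ℝ)))
  refine hcomp.of_isClosed_subset ?_ ?_
  · convert! hclosed using 1
    ext p
    simp only [mem_ofPred_eq, mem_inter_iff, mem_prod, mem_preimage, mem_singleton_iff]
    exact ⟨fun h => ⟨⟨h.1, hball p h.1 h.2⟩, h.2⟩, fun h => ⟨h.1.1, h.2⟩⟩
  · exact fun p h => ⟨h.1, hball p h.1 h.2⟩

/-- Uniform bounds in normal coordinates centered in a compact set. -/
theorem exists_normalData {K : Set (EuclideanSpace ℝ (Fin n))} (hK : IsCompact K)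
    (hsymm : ∀ y i j, G y i j = G y j i)
    (hG : ∀ y ∈ K, ∀ i j, ContDiffAt ℝ ∞ (fun y => G y i j) y) (hdet : ∀ y ∈ K, (G y).det ≠ 0)
    (hA : ∀ y ∈ K, ∀ i j, ContDiffAt ℝ ∞ (fun y => A y i j) y) :
    ∃ C, 0 ≤ C ∧ ∀ y ∈ K, ∀ P : Fin n → Fin n → ℝ, (Matrix.of P)ᵀ * G y * Matrix.of P = 1 →
      NormalData (fun z => (pullForm G y P (normalQ G y P) z)⁻¹)
        (pullConn (chr G) y P (normalQ G y P)) (pullForm A y P (normalQ G y P)) C := by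
  have h2 : (2 : WithTop ℕ∞) ≤ ∞ := by norm_cast
  have hΓ : ∀ y ∈ K, ∀ m i j, ContDiffAt ℝ ∞ (chr G m i j) y := fun y hy =>
    contDiffAt_chr (hG y hy) (hdet y hy)
  have hcomp := isCompact_normalized hK hG hdet
  set S := {p : EuclideanSpace ℝ (Fin n) × (Fin n → Fin n → ℝ) | p.1 ∈ K ∧
      (Matrix.of p.2)ᵀ * G p.1 * Matrix.of p.2 = 1} with hS
  have hcont : ContinuousOn (fun p : EuclideanSpace ℝ (Fin n) × (Fin n → Fin n → ℝ) =>
      ((p.1, p.2, normalQ G p.1 p.2) : QuadParam n)) S := by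
    refine continuousOn_fst.prodMk (continuousOn_snd.prodMk ?_)
    refine continuousOn_pi.2 fun c => continuousOn_pi.2 fun i => continuousOn_pi.2 fun j => ?_
    intro p hp
    refine ContinuousAt.continuousWithinAt ?_
    simp only [normalQ]
    refine tendsto_finsetSum _ fun a _ => tendsto_finsetSum _ fun b _ => ?_
    have h1 : ContinuousAt (fun p : EuclideanSpace ℝ (Fin n) × (Fin n → Fin n → ℝ) =>
        chr G c a b p.1) p :=
      ContinuousAt.comp (g := chr G c a b) (hΓ p.1 hp.1 c a b).continuousAt continuousAt_fst
    exact (h1.mul (by fun_prop : Continuous fun p : EuclideanSpace ℝ (Fin n) ×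
      (Fin n → Fin n → ℝ) => p.2 a i).continuousAt).mul (by fun_prop : Continuous fun p :
        EuclideanSpace ℝ (Fin n) × (Fin n → Fin n → ℝ) => p.2 b j).continuousAt
  -- The quadratic part depends continuously on the point and the frame, so all parameters of normal
  -- coordinates range over a compact set.
  have hX := hcomp.image_of_continuousOn hcont
  have hv : ∀ x ∈ (fun p : EuclideanSpace ℝ (Fin n) × (Fin n → Fin n → ℝ) =>
      ((p.1, p.2, normalQ G p.1 p.2) : QuadParam n)) '' S, x.1 ∈ K ∧
      (Matrix.of x.2.1)ᵀ * G x.1 * Matrix.of x.2.1 = 1 := by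
    rintro _ ⟨p, hp, rfl⟩; exact hp
  obtain ⟨C₁, hC₁, b₁⟩ := exists_bound_partial_family (ι := Fin n × Fin n) (κ := Fin n)
    (F := fun ij (p : QuadParam n × EuclideanSpace ℝ (Fin n)) =>
      (pullForm G p.1.1 p.1.2.1 p.1.2.2 p.2)⁻¹ ij.1 ij.2) hX
    (fun ij x hx => (contDiffAt_inv_pullForm_param (hG _ (hv x hx).1) (hv x hx).2 _ _).of_le h2)
    (fun m => EuclideanSpace.single m 1)
  obtain ⟨C₂, hC₂, b₂⟩ := exists_bound_partial_family (ι := Fin n × Fin n × Fin n) (κ := Fin n)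
    (F := fun ij (p : QuadParam n × EuclideanSpace ℝ (Fin n)) =>
      pullConn (chr G) p.1.1 p.1.2.1 p.1.2.2 ij.1 ij.2.1 ij.2.2 p.2) hX
    (fun ij x hx => (contDiffAt_pullConn_param (hΓ _ (hv x hx).1)
      (det_ne_zero_of_normalized (hv x hx).2) _ _ _).of_le h2)
    (fun m => EuclideanSpace.single m 1)
  obtain ⟨C₃, hC₃, b₃⟩ := exists_bound_partial_family (ι := Fin n × Fin n) (κ := Fin n)
    (F := fun ij (p : QuadParam n × EuclideanSpace ℝ (Fin n)) =>
      pullForm A p.1.1 p.1.2.1 p.1.2.2 p.2 ij.1 ij.2) hX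
    (fun ij x hx => (contDiffAt_pullForm_param (hA _ (hv x hx).1) _ _).of_le h2)
    (fun m => EuclideanSpace.single m 1)
  refine ⟨C₁ + C₂ + C₃, by positivity, fun y hy P hP => ?_⟩
  have hmem : ((y, P, normalQ G y P) : QuadParam n) ∈
      (fun p : EuclideanSpace ℝ (Fin n) × (Fin n → Fin n → ℝ) =>
      ((p.1, p.2, normalQ G p.1 p.2) : QuadParam n)) '' S := ⟨(y, P), ⟨hy, hP⟩, rfl⟩
  constructor
  · simp only [pullForm_zero, hP, inv_one]
  · exact fun i j => (contDiffAt_of_param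
      (contDiffAt_inv_pullForm_param (hG y hy) hP i j)).of_le h2
  · exact fderiv_inv_pullForm_normal hsymm (hG y hy) (hdet y hy) hP
  · exact fun i j m => ((b₁ _ hmem (i, j) m).2.2).trans (by linarith)
  · exact pullConn_normal_zero
  · exact fun m i j => (contDiffAt_of_param (contDiffAt_pullConn_param (hΓ y hy)
      (det_ne_zero_of_normalized hP) m i j)).differentiableAt (by simp)
  · exact fun m i j a => ((b₂ _ hmem (m, i, j) a).2.1).trans (by linarith)
  · exact fun i j => ((b₃ _ hmem (i, j) i).1).trans (by linarith)
  · exact fun i j => (contDiffAt_of_param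
      (contDiffAt_pullForm_param (hA y hy) i j)).differentiableAt (by simp)
  · exact fun i j a => ((b₃ _ hmem (i, j) a).2.1).trans (by linarith)

end NormalCoordinates

/-! ### Metric, tensors and gradients of the manifold in a chart. -/

section Charts

variable {n : ℕ} {M : Type*} [TopologicalSpace M] [ChartedSpace (EuclideanSpace ℝ (Fin n)) M]

theorem symm_mem_source (c : M) {y : EuclideanSpace ℝ (Fin n)}
    (hy : y ∈ (extChartAt (𝓡 n) c).target) :
    (extChartAt (𝓡 n) c).symm y ∈ (chartAt (EuclideanSpace ℝ (Fin n)) c).source := by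
  have := (extChartAt (𝓡 n) c).map_target hy
  rwa [extChartAt_source] at this

variable [IsManifold (𝓡 n) ∞ M]

theorem contMDiffAt_coordVec (c : M) (i : Fin n) {x : M}
    (hx : x ∈ (chartAt (EuclideanSpace ℝ (Fin n)) c).source) :
    ContMDiffAt (𝓡 n) ((𝓡 n).prod 𝓘(ℝ, EuclideanSpace ℝ (Fin n))) ∞
      (fun x => Bundle.TotalSpace.mk' (EuclideanSpace ℝ (Fin n))
        (E := fun x : M => TangentSpace (𝓡 n) x) x (coordVec c x i)) x := by
  set e := trivializationAt (EuclideanSpace ℝ (Fin n)) (TangentSpace (𝓡 n) : M → Type _) c with he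
  have hb : e.baseSet = (chartAt (EuclideanSpace ℝ (Fin n)) c).source := by
    simp [he]
  have h1 := e.contMDiffOn_symm (IB := 𝓡 n) (n := ∞)
  have h2 : ContMDiffOn (𝓡 n) ((𝓡 n).prod 𝓘(ℝ, EuclideanSpace ℝ (Fin n))) ∞
      (fun x : M => (x, EuclideanSpace.single i (1 : ℝ))) e.baseSet :=
    contMDiffOn_id.prodMk contMDiffOn_const
  have h3 := h1.comp h2 (fun x hx => by simpa [Bundle.Trivialization.mem_target] using hx)
  have h4 := h3.congr (f₁ := fun x => Bundle.TotalSpace.mk' (EuclideanSpace ℝ (Fin n))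
        (E := fun x : M => TangentSpace (𝓡 n) x) x (coordVec c x i)) (fun x hx => by
      simp only [Function.comp]
      rw [coordVec, Bundle.Trivialization.symmL_apply _ hx]
      exact e.mk_symm hx (EuclideanSpace.single i (1 : ℝ)))
  exact (h4 x (hb ▸ hx)).contMDiffAt (hb ▸ (chartAt _ c).open_source.mem_nhds hx)

/-- Components of a `(0,2)`-tensor as functions on the coordinate space. -/
noncomputable def chartForm (T : TwoTensor n M) (c : M) (y : EuclideanSpace ℝ (Fin n)) :
    Matrix (Fin n) (Fin n) ℝ := tensorCoord T c ((extChartAt (𝓡 n) c).symm y)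

theorem contMDiffAt_tensorCoord {T : TwoTensor n M} (hT : SmoothTwoTensor T) (c : M) (i j : Fin n)
    {x : M} (hx : x ∈ (chartAt (EuclideanSpace ℝ (Fin n)) c).source) :
    ContMDiffAt (𝓡 n) 𝓘(ℝ, ℝ) ∞ (fun x => tensorCoord T c x i j) x := by
  have h := ContMDiffAt.clm_bundle_apply₂ (E₃ := fun _ : M => ℝ) (hT x)
    (contMDiffAt_coordVec c i hx) (contMDiffAt_coordVec c j hx)
  rw [Bundle.contMDiffAt_totalSpace] at h
  exact h.2

theorem smoothTwoTensor_metric (g : RiemMetric n M) : SmoothTwoTensor (g.inner : TwoTensor n M) :=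
  g.contMDiff

theorem contMDiffAt_extChartAt_symm' (c : M) {y : EuclideanSpace ℝ (Fin n)}
    (hy : y ∈ (extChartAt (𝓡 n) c).target) :
    ContMDiffAt 𝓘(ℝ, EuclideanSpace ℝ (Fin n)) (𝓡 n) ∞ (extChartAt (𝓡 n) c).symm y :=
  (contMDiffOn_extChartAt_symm c y hy).contMDiffAt ((isOpen_extChartAt_target c).mem_nhds hy)

theorem contDiffAt_chartForm {T : TwoTensor n M} (hT : SmoothTwoTensor T) (c : M)
    {y : EuclideanSpace ℝ (Fin n)} (hy : y ∈ (extChartAt (𝓡 n) c).target) (i j : Fin n) :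
    ContDiffAt ℝ ∞ (fun y => chartForm T c y i j) y := by
  rw [← contMDiffAt_iff_contDiffAt]
  exact ContMDiffAt.comp (g := fun x => tensorCoord T c x i j) y
    (contMDiffAt_tensorCoord hT c i j (symm_mem_source c hy)) (contMDiffAt_extChartAt_symm' c hy)

/-- The coordinate vectors are images of the standard basis under the derivative of the inverse
chart, so this is the chain rule. -/
theorem mvfderiv_coordVec {f : M → ℝ} {c x : M}
    (hx : x ∈ (chartAt (EuclideanSpace ℝ (Fin n)) c).source)
    (hf : MDifferentiableAt (𝓡 n) 𝓘(ℝ, ℝ) f x) (i : Fin n) :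
    mvfderiv (𝓡 n) f x (coordVec c x i) = dCoord f c x i := by
  have hx' : x ∈ (extChartAt (𝓡 n) c).source := by rwa [extChartAt_source]
  have hy := (extChartAt (𝓡 n) c).map_source hx'
  have hs : MDifferentiableAt 𝓘(ℝ, EuclideanSpace ℝ (Fin n)) (𝓡 n) (extChartAt (𝓡 n) c).symm
      (extChartAt (𝓡 n) c x) := (contMDiffAt_extChartAt_symm' c hy).mdifferentiableAt (by simp)
  have hl := (extChartAt (𝓡 n) c).left_inv hx'
  have hcomp := mfderiv_comp (I := 𝓘(ℝ, EuclideanSpace ℝ (Fin n))) (I' := 𝓡 n) (I'' := 𝓘(ℝ, ℝ))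
    (extChartAt (𝓡 n) c x) (g := f) (f := (extChartAt (𝓡 n) c).symm) (by rw [hl]; exact hf) hs
  rw [dCoord, pd]
  have h2 : fderiv ℝ (inChart c f) (extChartAt (𝓡 n) c x) = mfderiv 𝓘(ℝ, EuclideanSpace ℝ (Fin n))
    𝓘(ℝ, ℝ) (f ∘ (extChartAt (𝓡 n) c).symm) (extChartAt (𝓡 n) c x) := by
    rw [mfderiv_eq_fderiv]; rfl
  rw [h2, hcomp, coordVec, TangentBundle.symmL_trivializationAt hx]
  simp only [modelWithCornersSelf_coe, range_id, mfderivWithin_univ]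
  rw [hl]
  rfl

theorem exists_basis_coordVec {c x : M}
    (hx : x ∈ (chartAt (EuclideanSpace ℝ (Fin n)) c).source) :
    ∃ b : Module.Basis (Fin n) ℝ (TangentSpace (𝓡 n) x), ∀ i, b i = coordVec c x i := by
  set e := trivializationAt (EuclideanSpace ℝ (Fin n)) (TangentSpace (𝓡 n) : M → Type _) c with he
  have hb : x ∈ e.baseSet := by simpa [he] using hx
  refine ⟨(EuclideanSpace.basisFun (Fin n) ℝ).toBasis.map
    (e.continuousLinearEquivAt ℝ x hb).symm.toLinearEquiv, fun i => ?_⟩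
  simp only [Module.Basis.map_apply, OrthonormalBasis.coe_toBasis, EuclideanSpace.basisFun_apply,
    coordVec]
  rw [Bundle.Trivialization.symmL_apply _ hb]
  rfl

theorem quadratic_tensorCoord (T : TwoTensor n M) (c x : M) (v w : Fin n → ℝ) :
    v ⬝ᵥ (tensorCoord T c x *ᵥ w) =
      T x (∑ i, v i • coordVec c x i) (∑ j, w j • coordVec c x j) := by
  simp only [map_sum, map_smul, sum_apply, smul_apply, dotProduct, Matrix.mulVec, tensorCoord,
    Matrix.of_apply, smul_eq_mul, Finset.mul_sum]
  rw [Finset.sum_comm]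
  exact Finset.sum_congr rfl fun i _ => Finset.sum_congr rfl fun j _ => by ring

theorem quadratic_metric_pos (g : RiemMetric n M) {c x : M}
    (hx : x ∈ (chartAt (EuclideanSpace ℝ (Fin n)) c).source) {v : Fin n → ℝ} (hv : v ≠ 0) :
    0 < v ⬝ᵥ (tensorCoord g.inner c x *ᵥ v) := by
  rw [quadratic_tensorCoord]
  refine g.pos x _ fun h0 => hv ?_
  obtain ⟨b, hb⟩ := exists_basis_coordVec hx
  simp only [← hb] at h0
  exact funext (Fintype.linearIndependent_iff.1 b.linearIndependent v h0)

theorem det_metric_ne_zero (g : RiemMetric n M) {c x : M}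
    (hx : x ∈ (chartAt (EuclideanSpace ℝ (Fin n)) c).source) :
    (tensorCoord g.inner c x).det ≠ 0 := by
  intro h
  obtain ⟨v, hv, h0⟩ := Matrix.exists_mulVec_eq_zero_iff.2 h
  have := quadratic_metric_pos g hx hv
  rw [h0, dotProduct_zero] at this
  exact this.false

/-- The components X of the gradient solve G X = df, whence |∇f|² = X · G X = df · G⁻¹ df. -/
theorem gradNorm_sq (g : RiemMetric n M) {f : M → ℝ} {c x : M}
    (hx : x ∈ (chartAt (EuclideanSpace ℝ (Fin n)) c).source)
    (hf : MDifferentiableAt (𝓡 n) 𝓘(ℝ, ℝ) f x) :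
    gradNorm g f x ^ 2 =
      dCoord f c x ⬝ᵥ ((tensorCoord g.inner c x)⁻¹ *ᵥ dCoord f c x) := by
  have hgrad : ∀ v, g.inner x (grad g f x) v = mvfderiv (𝓡 n) f x v := fun v =>
    LinearMap.BilinForm.apply_toDual_symm_apply (hB := metricForm_nondegenerate g x) _ _
  have hnn : 0 ≤ g.inner x (grad g f x) (grad g f x) := by
    by_cases h0 : grad g f x = 0
    · simp [h0]
    · exact (g.pos x _ h0).le
  rw [gradNorm, Real.sq_sqrt hnn]
  obtain ⟨b, hb⟩ := exists_basis_coordVec hx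
  set X : Fin n → ℝ := fun i => b.repr (grad g f x) i with hX
  have hsum : grad g f x = ∑ i, X i • coordVec c x i := by
    simp only [← hb]; exact (b.sum_repr _).symm
  have hd : tensorCoord g.inner c x *ᵥ X = dCoord f c x := by
    funext j
    rw [← mvfderiv_coordVec hx hf, ← hgrad, g.symm, hsum]
    simp [Matrix.mulVec, dotProduct, tensorCoord, mul_comm]
  have hinv : (tensorCoord g.inner c x)⁻¹ *ᵥ dCoord f c x = X := by
    rw [← hd, Matrix.mulVec_mulVec, Matrix.nonsing_inv_mul _
      (isUnit_iff_ne_zero.2 (det_metric_ne_zero g hx)), Matrix.one_mulVec]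
  rw [hinv, ← hd, hsum, ← quadratic_tensorCoord, dotProduct_comm]

end Charts

/-! ### Space-time directional derivatives as iterated partial derivatives. -/

section Partial

variable {n : ℕ}

theorem dird_ex_eq_pd {F : EuclideanSpace ℝ (Fin n) × ℝ → ℝ} {y : EuclideanSpace ℝ (Fin n)} {t : ℝ}
    (hF : DifferentiableAt ℝ F (y, t)) (i : Fin n) :
    dird (ex i) F (y, t) = pd i (fun y => F (y, t)) y := by
  have h : HasFDerivAt (fun y => F (y, t)) ((fderiv ℝ F (y, t)).comp
      (ContinuousLinearMap.inl ℝ (EuclideanSpace ℝ (Fin n)) ℝ)) y :=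
    hF.hasFDerivAt.comp y (hasFDerivAt_prodMk_left y t)
  rw [pd, h.fderiv]
  simp [dird, ex]

theorem pd_congr {f g : EuclideanSpace ℝ (Fin n) → ℝ} {y : EuclideanSpace ℝ (Fin n)}
    (h : f =ᶠ[𝓝 y] g) (i : Fin n) : pd i f y = pd i g y := by
  rw [pd, pd, h.fderiv_eq]

theorem eventually_slice {q : EuclideanSpace ℝ (Fin n) × ℝ → Prop} {y : EuclideanSpace ℝ (Fin n)}
    {t : ℝ} (h : ∀ᶠ p in 𝓝 (y, t), q p) : ∀ᶠ z in 𝓝 y, q (z, t) :=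
  ((by fun_prop : Continuous fun z : EuclideanSpace ℝ (Fin n) => (z, t)).tendsto y).eventually h

theorem eventually_slice_right {q : EuclideanSpace ℝ (Fin n) × ℝ → Prop}
    {y : EuclideanSpace ℝ (Fin n)} {t : ℝ} (h : ∀ᶠ p in 𝓝 (y, t), q p) :
    ∀ᶠ τ in 𝓝 t, q (y, τ) :=
  ((by fun_prop : Continuous fun τ : ℝ => (y, τ)).tendsto t).eventually h

theorem dird_ex_ex_eq_pd {F : EuclideanSpace ℝ (Fin n) × ℝ → ℝ} {y : EuclideanSpace ℝ (Fin n)}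
    {t : ℝ} (hF : ContDiffAt ℝ 2 F (y, t)) (i j : Fin n) :
    dird (ex i) (dird (ex j) F) (y, t) = pd i (pd j (fun y => F (y, t))) y := by
  rw [dird_ex_eq_pd (differentiableAt_dird hF (ex j))]
  refine pd_congr ?_ i
  filter_upwards [eventually_slice (hF.eventually (by simp))] with z hz
  exact dird_ex_eq_pd (hz.differentiableAt two_ne_zero) j

theorem dird_et_eq_deriv {F : EuclideanSpace ℝ (Fin n) × ℝ → ℝ} {y : EuclideanSpace ℝ (Fin n)}
    {t : ℝ} (hF : DifferentiableAt ℝ F (y, t)) :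
    dird et F (y, t) = deriv (fun τ => F (y, τ)) t := by
  have h : HasFDerivAt (fun τ => F (y, τ)) ((fderiv ℝ F (y, t)).comp
      (ContinuousLinearMap.inr ℝ (EuclideanSpace ℝ (Fin n)) ℝ)) t :=
    hF.hasFDerivAt.comp t (hasFDerivAt_prodMk_right y t)
  rw [h.hasDerivAt.deriv]
  simp [dird, et]

theorem dird_et_et_eq_deriv {F : EuclideanSpace ℝ (Fin n) × ℝ → ℝ} {y : EuclideanSpace ℝ (Fin n)}
    {t : ℝ} (hF : ContDiffAt ℝ 2 F (y, t)) :
    dird et (dird et F) (y, t) = deriv (deriv fun τ => F (y, τ)) t := by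
  rw [dird_et_eq_deriv (differentiableAt_dird hF et)]
  refine Filter.EventuallyEq.deriv_eq ?_
  filter_upwards [eventually_slice_right (hF.eventually (by simp))] with τ hτ
  exact dird_et_eq_deriv (hτ.differentiableAt two_ne_zero)

end Partial

/-! ### The invariant operators agree with their coordinate forms. -/

section Correspondence

variable {n : ℕ} {M : Type*} [TopologicalSpace M] [ChartedSpace (EuclideanSpace ℝ (Fin n)) M]

/-- A function on space-time in the chart at `c`. -/
noncomputable def chartFun (u : M → ℝ → ℝ) (c : M) (p : EuclideanSpace ℝ (Fin n) × ℝ) : ℝ :=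
  u ((extChartAt (𝓡 n) c).symm p.1) p.2

variable {u : M → ℝ → ℝ} {c x : M} {t : ℝ}

theorem mdifferentiableAt_slice {J : Set ℝ} (hu : RegOn (n := n) 1 u J) (x : M) {t : ℝ}
    (ht : t ∈ J) : MDifferentiableAt (𝓡 n) 𝓘(ℝ, ℝ) (fun y => u y t) x := by
  have h1 : ContMDiff (𝓡 n) 𝓘(ℝ, ℝ) 1 (fun y => u y t) := by
    rw [← contMDiffOn_univ]
    exact hu.comp (t := univ ×ˢ J) (contMDiff_id.prodMk contMDiff_const).contMDiffOn
      (fun y _ => ⟨mem_univ _, ht⟩)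
  exact (h1 x).mdifferentiableAt one_ne_zero

theorem dCoord_eq_gradN (hU : DifferentiableAt ℝ (chartFun u c) (extChartAt (𝓡 n) c x, t)) :
    dCoord (fun y => u y t) c x = gradN (chartFun u c) (extChartAt (𝓡 n) c x, t) := by
  funext i
  rw [gradN, dird_ex_eq_pd hU]
  rfl

theorem dtt_eq (hx : x ∈ (chartAt (EuclideanSpace ℝ (Fin n)) c).source)
    (hU : ContDiffAt ℝ 2 (chartFun u c) (extChartAt (𝓡 n) c x, t)) :
    dtt u t x = dird et (dird et (chartFun u c)) (extChartAt (𝓡 n) c x, t) := by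
  rw [dird_et_et_eq_deriv hU]
  simp only [chartFun, (extChartAt (𝓡 n) c).left_inv (by rwa [extChartAt_source])]
  rfl

theorem dCoord_dt_eq_gradtN (hU : ContDiffAt ℝ 2 (chartFun u c) (extChartAt (𝓡 n) c x, t)) :
    dCoord (dt u t) c x = gradtN (chartFun u c) (extChartAt (𝓡 n) c x, t) := by
  funext i
  rw [gradtN, dird_ex_eq_pd (differentiableAt_dird hU et), dCoord]
  refine pd_congr ?_ i
  filter_upwards [eventually_slice (hU.eventually (by simp))] with z hz
  rw [dird_et_eq_deriv (hz.differentiableAt two_ne_zero)]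
  rfl

variable [IsManifold (𝓡 n) ∞ M] {g : RiemMetric n M} {A : TwoTensor n M}

theorem contDiffAt_chartFun {m : WithTop ℕ∞} (hm : m ≤ ∞) {J : Set ℝ} (hu : RegOn (n := n) m u J)
    {c : M} {y : EuclideanSpace ℝ (Fin n)} (hy : y ∈ (extChartAt (𝓡 n) c).target) {t : ℝ}
    (ht : J ∈ 𝓝 t) : ContDiffAt ℝ m (chartFun u c) (y, t) := by
  rw [← contMDiffAt_iff_contDiffAt]
  have h1 : ContMDiffAt ((𝓡 n).prod 𝓘(ℝ, ℝ)) 𝓘(ℝ, ℝ) m (fun p : M × ℝ => u p.1 p.2)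
      ((extChartAt (𝓡 n) c).symm y, t) :=
    (hu _ ⟨mem_univ _, mem_of_mem_nhds ht⟩).contMDiffAt (prod_mem_nhds Filter.univ_mem ht)
  have h2 : ContMDiffAt 𝓘(ℝ, EuclideanSpace ℝ (Fin n) × ℝ) ((𝓡 n).prod 𝓘(ℝ, ℝ)) m
      (fun p : EuclideanSpace ℝ (Fin n) × ℝ => ((extChartAt (𝓡 n) c).symm p.1, p.2)) (y, t) := by
    refine ContMDiffAt.prodMk ?_ contDiffAt_snd.contMDiffAt
    exact ContMDiffAt.comp (g := (extChartAt (𝓡 n) c).symm)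
      (f := (Prod.fst : EuclideanSpace ℝ (Fin n) × ℝ → EuclideanSpace ℝ (Fin n))) (y, t)
      ((contMDiffAt_extChartAt_symm' c hy).of_le hm) contDiffAt_fst.contMDiffAt
  exact ContMDiffAt.comp (g := fun p : M × ℝ => u p.1 p.2) (y, t) h1 h2

theorem chartForm_extChartAt (T : TwoTensor n M)
    (hx : x ∈ (chartAt (EuclideanSpace ℝ (Fin n)) c).source) :
    chartForm T c (extChartAt (𝓡 n) c x) = tensorCoord T c x := by
  rw [chartForm, (extChartAt (𝓡 n) c).left_inv (by rwa [extChartAt_source])]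

theorem christoffel_eq_chr (hx : x ∈ (chartAt (EuclideanSpace ℝ (Fin n)) c).source)
    (m i j : Fin n) :
    christoffel g c x m i j = chr (chartForm g.inner c) m i j (extChartAt (𝓡 n) c x) := by
  rw [chr, chartForm_extChartAt _ hx]
  rfl

theorem hessCoord_eq_hessN (hx : x ∈ (chartAt (EuclideanSpace ℝ (Fin n)) c).source)
    (hU : ContDiffAt ℝ 2 (chartFun u c) (extChartAt (𝓡 n) c x, t)) :
    hessCoord g (fun y => u y t) c x =
      hessN (chr (chartForm g.inner c)) (chartFun u c) (extChartAt (𝓡 n) c x, t) := by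
  ext i j
  simp only [hessCoord, hessN, Matrix.of_apply, christoffel_eq_chr hx,
    dCoord_eq_gradN (hU.differentiableAt two_ne_zero), dird_ex_ex_eq_pd hU]
  rfl

/-- Multiplication by g⁻¹ turns the multiple of g into the same multiple of the identity. -/
theorem W_eq_WN (hx : x ∈ (chartAt (EuclideanSpace ℝ (Fin n)) c).source)
    (hU : ContDiffAt ℝ 2 (chartFun u c) (extChartAt (𝓡 n) c x, t))
    (hu : MDifferentiableAt (𝓡 n) 𝓘(ℝ, ℝ) (fun y => u y t) x) (s r γ : ℝ) :
    W g A s r γ (fun y => u y t) c x =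
      WN (fun y => (chartForm g.inner c y)⁻¹) (chr (chartForm g.inner c)) (chartForm A c) s r γ
        (chartFun u c) (extChartAt (𝓡 n) c x, t) := by
  have hdet := isUnit_iff_ne_zero.2 (det_metric_ne_zero g hx)
  rw [W, WN, laplace, gradNorm_sq g hx hu, hessCoord_eq_hessN hx hU,
    dCoord_eq_gradN (hU.differentiableAt two_ne_zero)]
  simp only [chartForm_extChartAt _ hx, Matrix.mul_add, Matrix.mul_smul,
    Matrix.nonsing_inv_mul _ hdet]
  abel

theorem Eu_eq_smul_SN (hx : x ∈ (chartAt (EuclideanSpace ℝ (Fin n)) c).source)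
    (hU : ContDiffAt ℝ 2 (chartFun u c) (extChartAt (𝓡 n) c x, t))
    (hu : MDifferentiableAt (𝓡 n) 𝓘(ℝ, ℝ) (fun y => u y t) x) (hutt : dtt u t x ≠ 0) (s r γ : ℝ) :
    Eu g A s r γ u t c x = dtt u t x •
      SN (fun y => (chartForm g.inner c y)⁻¹) (chr (chartForm g.inner c)) (chartForm A c) s r γ
        (chartFun u c) (extChartAt (𝓡 n) c x, t) := by
  rw [Eu, SN, W_eq_WN hx hU hu, dutSq, dCoord_dt_eq_gradtN hU, ← dtt_eq hx hU, smul_sub, smul_smul,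
    mul_inv_cancel₀ hutt, one_smul]
  simp only [chartForm_extChartAt _ hx]

/-- `sigma_add_smul_vecMulVec` with τ = -1/u_tt: the contraction in the operator is the rank one
term in the expansion of σ_k(S). -/
theorem operator_eq {k : ℕ} (hk : k ≤ n) (hx : x ∈ (chartAt (EuclideanSpace ℝ (Fin n)) c).source)
    (hU : ContDiffAt ℝ 2 (chartFun u c) (extChartAt (𝓡 n) c x, t))
    (hu : MDifferentiableAt (𝓡 n) 𝓘(ℝ, ℝ) (fun y => u y t) x) (hutt : dtt u t x ≠ 0) (s r γ : ℝ) :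
    operator g A s r γ k u t c x = dtt u t x * sigma k
      (SN (fun y => (chartForm g.inner c y)⁻¹) (chr (chartForm g.inner c)) (chartForm A c) s r γ
        (chartFun u c) (extChartAt (𝓡 n) c x, t)) := by
  rw [operator, SN, ← W_eq_WN hx hU hu, ← dtt_eq hx hU, dutSq, dCoord_dt_eq_gradtN hU]
  simp only [chartForm_extChartAt _ hx]
  rw [Matrix.mul_vecMulVec, sub_eq_add_neg (W _ _ _ _ _ _ _ _), ← neg_smul,
    sigma_add_smul_vecMulVec hk]
  field_simp
  ring

end Correspondence

/-! ### Frames that normalize the metric and diagonalize a symmetric form. -/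

section Diagonalization

variable {n : ℕ}

theorem exists_normalized_frame {G : Matrix (Fin n) (Fin n) ℝ} (hG : Gᵀ = G)
    (hpos : ∀ v : Fin n → ℝ, v ≠ 0 → 0 < v ⬝ᵥ (G *ᵥ v)) :
    ∃ P : Matrix (Fin n) (Fin n) ℝ, Pᵀ * G * P = 1 := by
  obtain ⟨O, d, h1, h2, h3⟩ := exists_orthogonal_diagonalization hG
  have hd : ∀ i, 0 < d i := by
    intro i
    have hv : O *ᵥ Pi.single i 1 ≠ 0 := by
      intro h0
      have : Oᵀ *ᵥ (O *ᵥ Pi.single i (1 : ℝ)) = 0 := by rw [h0, Matrix.mulVec_zero]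
      rw [Matrix.mulVec_mulVec, h1, Matrix.one_mulVec] at this
      simpa using congrFun this i
    have h := hpos _ hv
    have e : (O *ᵥ Pi.single i 1) ⬝ᵥ (G *ᵥ (O *ᵥ Pi.single i (1 : ℝ))) = d i := by
      rw [← Matrix.vecMul_transpose, ← Matrix.dotProduct_mulVec, Matrix.mulVec_mulVec,
        Matrix.vecMul_transpose, Matrix.mulVec_mulVec, h3]
      simp
    rwa [e] at h
  refine ⟨O * Matrix.diagonal fun i => (√(d i))⁻¹, ?_⟩
  rw [Matrix.transpose_mul, Matrix.diagonal_transpose]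
  calc _ = Matrix.diagonal (fun i => (√(d i))⁻¹) * (Oᵀ * G * O) *
        Matrix.diagonal (fun i => (√(d i))⁻¹) := by simp only [Matrix.mul_assoc]
    _ = 1 := by
      rw [h3, Matrix.diagonal_mul_diagonal, Matrix.diagonal_mul_diagonal, ← Matrix.diagonal_one]
      congr 1
      funext i
      have h := Real.mul_self_sqrt (hd i).le
      have h0 : √(d i) ≠ 0 := (Real.sqrt_pos.2 (hd i)).ne'
      field_simp
      rw [sq, h]

/-- Simultaneous normalization of a metric and diagonalization of a symmetric form. -/
theorem exists_normalized_diagonalization {G B : Matrix (Fin n) (Fin n) ℝ} (hG : Gᵀ = G)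
    (hpos : ∀ v : Fin n → ℝ, v ≠ 0 → 0 < v ⬝ᵥ (G *ᵥ v)) (hB : Bᵀ = B) (τ : ℝ) :
    ∃ (P : Matrix (Fin n) (Fin n) ℝ) (l : Fin n → ℝ), Pᵀ * G * P = 1 ∧
      P⁻¹ * (G⁻¹ * B + τ • 1) * P = Matrix.diagonal l := by
  obtain ⟨P₀, hP₀⟩ := exists_normalized_frame hG hpos
  have hN : (P₀ᵀ * B * P₀)ᵀ = P₀ᵀ * B * P₀ := by
    rw [Matrix.transpose_mul, Matrix.transpose_mul, Matrix.transpose_transpose, hB,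
      Matrix.mul_assoc]
  -- A rotation of the normalized frame preserves the normalization and is free to diagonalize B.
  obtain ⟨O, l, h1, h2, h3⟩ := exists_orthogonal_diagonalization hN
  have hGu : IsUnit G.det := by
    refine isUnit_iff_ne_zero.2 fun h0 => ?_
    have := congrArg Matrix.det hP₀
    simp [Matrix.det_mul, h0] at this
  have hP : (P₀ * O)ᵀ * G * (P₀ * O) = 1 := by
    calc _ = Oᵀ * (P₀ᵀ * G * P₀) * O := by
          rw [Matrix.transpose_mul]; simp only [Matrix.mul_assoc]
      _ = 1 := by rw [hP₀, Matrix.mul_one, h1]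
  have hinv : (P₀ * O)⁻¹ = (P₀ * O)ᵀ * G := Matrix.inv_eq_left_inv hP
  have hu : IsUnit (P₀ * O).det := by
    refine isUnit_iff_ne_zero.2 fun h0 => ?_
    have := congrArg Matrix.det hP
    rw [Matrix.det_mul, h0, mul_zero, Matrix.det_one] at this
    exact zero_ne_one this
  refine ⟨P₀ * O, fun i => l i + τ, hP, ?_⟩
  rw [Matrix.mul_add, Matrix.add_mul, Matrix.mul_smul, Matrix.smul_mul, Matrix.mul_one,
    Matrix.nonsing_inv_mul _ hu, hinv, Matrix.mul_assoc ((P₀ * O)ᵀ) G,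
    Matrix.mul_nonsing_inv_cancel_left _ _ hGu]
  have : (P₀ * O)ᵀ * B * (P₀ * O) = Matrix.diagonal l := by
    rw [← h3, Matrix.transpose_mul]; simp only [Matrix.mul_assoc]
  rw [this]
  ext i j
  by_cases h : i = j
  · subst h; simp
  · simp [h]

end Diagonalization

/-! ### The solution at an interior point, in adapted coordinates. -/

section InteriorMaximum

variable {n : ℕ} {M : Type*} [TopologicalSpace M] [ChartedSpace (EuclideanSpace ℝ (Fin n)) M]
  [IsManifold (𝓡 n) ∞ M] {g : RiemMetric n M} {A : TwoTensor n M}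

theorem chartForm_symm (T : TwoTensor n M)
    (hT : ∀ (x : M) (v w : TangentSpace (𝓡 n) x), T x v w = T x w v) (c : M)
    (y : EuclideanSpace ℝ (Fin n)) (i j : Fin n) : chartForm T c y i j = chartForm T c y j i :=
  hT _ _ _

/-- The symmetric form whose endomorphism is `SN`, up to multiples of the identity. -/
theorem exists_SN_eq {H A : EuclideanSpace ℝ (Fin n) → Matrix (Fin n) (Fin n) ℝ}
    {Γ : Fin n → Fin n → Fin n → EuclideanSpace ℝ (Fin n) → ℝ} {s r γ : ℝ}
    {u : EuclideanSpace ℝ (Fin n) × ℝ → ℝ} {p : EuclideanSpace ℝ (Fin n) × ℝ}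
    (hu : ContDiffAt ℝ 2 u p) (hA : (A p.1)ᵀ = A p.1) (hΓ : ∀ m i j, Γ m i j p.1 = Γ m j i p.1) :
    ∃ (B : Matrix (Fin n) (Fin n) ℝ) (τ : ℝ), Bᵀ = B ∧ SN H Γ A s r γ u p = H p.1 * B + τ • 1 := by
  refine ⟨hessN Γ u p + s • Matrix.vecMulVec (gradN u p) (gradN u p) + A p.1 -
    (dird et (dird et u) p)⁻¹ • Matrix.vecMulVec (gradtN u p) (gradtN u p),
    γ * (H p.1 * hessN Γ u p).trace - r / 2 * (gradN u p ⬝ᵥ (H p.1 *ᵥ gradN u p)), ?_, ?_⟩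
  · have h1 : (hessN Γ u p)ᵀ = hessN Γ u p := by
      ext i j
      simp only [hessN, Matrix.transpose_apply, Matrix.of_apply]
      rw [dird_comm hu (ex j) (ex i)]
      simp only [hΓ _ i j]
    simp only [Matrix.transpose_sub, Matrix.transpose_add, Matrix.transpose_smul,
      Matrix.transpose_vecMulVec, hA, h1]
  · rw [SN, WN]
    simp only [Matrix.mul_sub, Matrix.mul_smul]
    abel

variable {k : ℕ} {s r γ : ℝ} {ψ : M → ℝ → ℝ} {u₀ u₁ : M → ℝ} {u : M → ℝ → ℝ} {c x : M} {t : ℝ}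

theorem IsAdmissibleSolution.contDiffAt (sol : IsAdmissibleSolution g A s r γ k ψ u₀ u₁ u)
    (ht : t ∈ Ioo (0 : ℝ) 1) {y : EuclideanSpace ℝ (Fin n)}
    (hy : y ∈ (extChartAt (𝓡 n) c).target) : ContDiffAt ℝ 3 (chartFun u c) (y, t) :=
  contDiffAt_chartFun (by norm_cast) sol.reg_interior hy (Ioo_mem_nhds ht.1 ht.2)

theorem IsAdmissibleSolution.mdifferentiableAt
    (sol : IsAdmissibleSolution g A s r γ k ψ u₀ u₁ u) (x : M) (ht : t ∈ Icc (0 : ℝ) 1) :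
    MDifferentiableAt (𝓡 n) 𝓘(ℝ, ℝ) (fun y => u y t) x :=
  mdifferentiableAt_slice sol.reg_closed x ht

/-- The equation and the admissibility conditions in the chart at `c`. -/
theorem IsAdmissibleSolution.equation_chart (hk : k ≤ n)
    (sol : IsAdmissibleSolution g A s r γ k ψ u₀ u₁ u) (ht : t ∈ Ioo (0 : ℝ) 1)
    {y : EuclideanSpace ℝ (Fin n)} (hy : y ∈ (extChartAt (𝓡 n) c).target) :
    0 < dird et (dird et (chartFun u c)) (y, t) ∧
    dird et (dird et (chartFun u c)) (y, t) * sigma k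
      (SN (fun y => (chartForm g.inner c y)⁻¹) (chr (chartForm g.inner c)) (chartForm A c) s r γ
        (chartFun u c) (y, t)) = ψ ((extChartAt (𝓡 n) c).symm y) t ∧
    InGamma k (WN (fun y => (chartForm g.inner c y)⁻¹) (chr (chartForm g.inner c)) (chartForm A c)
      s r γ (chartFun u c) (y, t)) ∧
    0 < sigma k (SN (fun y => (chartForm g.inner c y)⁻¹) (chr (chartForm g.inner c))
      (chartForm A c) s r γ (chartFun u c) (y, t)) := by
  have hx := symm_mem_source c hy
  have hr := (extChartAt (𝓡 n) c).right_inv hy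
  have hU : ContDiffAt ℝ 2 (chartFun u c)
      (extChartAt (𝓡 n) c ((extChartAt (𝓡 n) c).symm y), t) := by
    rw [hr]; exact (sol.contDiffAt ht hy).of_le (by norm_num)
  have hmd := sol.mdifferentiableAt ((extChartAt (𝓡 n) c).symm y) (Ioo_subset_Icc_self ht)
  have hutt := sol.dtt_pos t ht ((extChartAt (𝓡 n) c).symm y)
  have h1 := sol.equation t ht c _ hx
  have h2 := sol.gamma t ht c _ hx
  have h3 := sol.sigma_pos t ht c _ hx
  rw [operator_eq hk hx hU hmd hutt.ne', dtt_eq hx hU, hr] at h1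
  rw [W_eq_WN hx hU hmd, hr] at h2
  rw [Eu_eq_smul_SN hx hU hmd hutt.ne', sigma_smul hk, hr] at h3
  refine ⟨?_, h1, h2, ?_⟩
  · rwa [dtt_eq hx hU, hr] at hutt
  · exact (mul_pos_iff_of_pos_left (pow_pos hutt k)).1 h3

theorem chartForm_det_ne_zero (g : RiemMetric n M) {y : EuclideanSpace ℝ (Fin n)}
    (hy : y ∈ (extChartAt (𝓡 n) c).target) : (chartForm g.inner c y).det ≠ 0 :=
  det_metric_ne_zero g (symm_mem_source c hy)

/-- Normal coordinates in which the linearized equation is diagonal. -/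
theorem IsAdmissibleSolution.exists_diagonal_frame (hk : k ≤ n)
    (hA_symm : ∀ (x : M) (v w : TangentSpace (𝓡 n) x), A x v w = A x w v)
    (sol : IsAdmissibleSolution g A s r γ k ψ u₀ u₁ u) (ht : t ∈ Ioo (0 : ℝ) 1)
    {y : EuclideanSpace ℝ (Fin n)} (hy : y ∈ (extChartAt (𝓡 n) c).target) :
    ∃ (P : Fin n → Fin n → ℝ) (l : Fin n → ℝ),
      (Matrix.of P)ᵀ * chartForm g.inner c y * Matrix.of P = 1 ∧
      ∀ Q : Fin n → Fin n → Fin n → ℝ, (∀ c i j, Q c i j = Q c j i) →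
      SN (fun z => (pullForm (chartForm g.inner c) y P Q z)⁻¹)
        (pullConn (chr (chartForm g.inner c)) y P Q) (pullForm (chartForm A c) y P Q) s r γ
        (fun p => chartFun u c (quadMapT y P Q p)) (0, t) = Matrix.diagonal l ∧
      ∀ j ≤ k, 0 < esymmOn Finset.univ l j := by
  have hU2 : ContDiffAt ℝ 2 (chartFun u c) (y, t) := (sol.contDiffAt ht hy).of_le (by norm_num)
  obtain ⟨hutt, heq, hW, hS⟩ := sol.equation_chart hk ht hy
  have hGs : (chartForm g.inner c y)ᵀ = chartForm g.inner c y := by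
    ext i j; exact chartForm_symm g.inner g.symm c y j i
  obtain ⟨B, τ, hB, hSN⟩ := exists_SN_eq (H := fun y => (chartForm g.inner c y)⁻¹)
    (A := chartForm A c) (Γ := chr (chartForm g.inner c)) (s := s) (r := r) (γ := γ) hU2
    (by ext i j; exact chartForm_symm A hA_symm c y j i)
    (fun m i j => chr_symm (chartForm_symm g.inner g.symm c) m i j y)
  obtain ⟨P, l, hP, hl⟩ := exists_normalized_diagonalization hGs
    (fun v hv => quadratic_metric_pos g (symm_mem_source c hy) hv) hB τ
  -- At the center the Jacobian is P whatever Q is, so one frame serves every symmetric quadratic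
  -- part.
  refine ⟨fun i j => P i j, l, hP, fun Q hQ => ?_⟩
  have hdet : (Matrix.of fun i j => P i j).det ≠ 0 := det_ne_zero_of_normalized (y := y) hP
  have hJ : (quadJac (fun i j => P i j) Q ((0 : EuclideanSpace ℝ (Fin n)), t).1).det ≠ 0 := by
    rw [quadJac_zero]; exact hdet
  have hΦ : quadMapT y (fun i j => P i j) Q (0, t) = (y, t) := by
    rw [quadMapT, quadMap_zero]
  have hUΦ : ContDiffAt ℝ 2 (chartFun u c) (quadMapT y (fun i j => P i j) Q (0, t)) := by
    rw [hΦ]; exact hU2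
  have hdiag := SN_comp_quadMapT (G := chartForm g.inner c) (A := chartForm A c) hQ hUΦ hJ
    (chr (chartForm g.inner c)) s r γ
  rw [hΦ, quadJac_zero] at hdiag
  have hdl : (Matrix.of fun i j => P i j)⁻¹ *
      SN (fun y => (chartForm g.inner c y)⁻¹) (chr (chartForm g.inner c)) (chartForm A c) s r γ
        (chartFun u c) (y, t) * (Matrix.of fun i j => P i j) = Matrix.diagonal l := by
    rw [hSN]; exact hl
  refine ⟨hdiag.trans hdl, ?_⟩
  have hPP : (Matrix.of fun i j => P i j) * (Matrix.of fun i j => P i j)⁻¹ = 1 :=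
    Matrix.mul_nonsing_inv _ (isUnit_iff_ne_zero.2 hdet)
  have hWd := WN_comp_quadMapT (G := chartForm g.inner c) (A := chartForm A c) hQ hUΦ hJ
    (chr (chartForm g.inner c)) s r γ
  rw [hΦ, quadJac_zero] at hWd
  have hWΓ := hW.conj hPP
  have hσ : 0 < sigma k (Matrix.diagonal l) := by
    rw [← hdl, sigma_conj _ _ _ hPP]; exact hS
  refine InGamma.esymmOn_pos hk ?_
  set b := gradtN (fun p => chartFun u c (quadMapT y (fun i j => P i j) Q p)) (0, t) with hb
  set utt := dird et (dird et (fun p => chartFun u c (quadMapT y (fun i j => P i j) Q p))) (0, t)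
    with hutt_def
  have hutt' : 0 < utt := by
    rw [hutt_def, dird_et_et_comp_quadMapT hUΦ, hΦ]; exact hutt
  -- With this scaling the added rank one matrix is du_t ⊗ du_t / u_tt and the sum is W, known to
  -- lie in Γ_k.
  refine InGamma.of_add_vecMulVec hk (Matrix.diagonal_transpose l)
    (a := (√utt)⁻¹ • b) ?_ hσ
  have hSW : SN (fun z => (pullForm (chartForm g.inner c) y (fun i j => P i j) Q z)⁻¹)
        (pullConn (chr (chartForm g.inner c)) y (fun i j => P i j) Q)
        (pullForm (chartForm A c) y (fun i j => P i j) Q) s r γ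
        (fun p => chartFun u c (quadMapT y (fun i j => P i j) Q p)) (0, t) +
        Matrix.vecMulVec ((√utt)⁻¹ • b) ((√utt)⁻¹ • b) =
      WN (fun z => (pullForm (chartForm g.inner c) y (fun i j => P i j) Q z)⁻¹)
        (pullConn (chr (chartForm g.inner c)) y (fun i j => P i j) Q)
        (pullForm (chartForm A c) y (fun i j => P i j) Q) s r γ
        (fun p => chartFun u c (quadMapT y (fun i j => P i j) Q p)) (0, t) := by
    have hone : (pullForm (chartForm g.inner c) y (fun i j => P i j) Q 0)⁻¹ = 1 := by
      rw [pullForm_zero]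
      exact (congrArg (·⁻¹) hP).trans inv_one
    have hvv : Matrix.vecMulVec ((√utt)⁻¹ • b) ((√utt)⁻¹ • b) = utt⁻¹ • Matrix.vecMulVec b b := by
      rw [Matrix.smul_vecMulVec, Matrix.vecMulVec_smul, smul_smul, ← mul_inv,
        Real.mul_self_sqrt hutt'.le]
    rw [SN, hvv]
    simp only [hone, one_mul, ← hb, ← hutt_def]
    abel
  rw [hdiag.trans hdl, hWd] at hSW
  rw [hSW]
  exact hWΓ

end InteriorMaximum

section InteriorMaximum

variable {n : ℕ} {M : Type*} [TopologicalSpace M] [ChartedSpace (EuclideanSpace ℝ (Fin n)) M]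
  [IsManifold (𝓡 n) ∞ M] {g : RiemMetric n M} {A : TwoTensor n M} {k : ℕ} {s r γ : ℝ}
  {ψ : M → ℝ → ℝ} {u₀ u₁ : M → ℝ} {u : M → ℝ → ℝ} {c x₀ : M} {t₀ : ℝ}

/-- `|∇f|²` in normal coordinates. -/
theorem gradN_dotProduct_eq_gradNorm_sq {v : M → ℝ → ℝ} {y : EuclideanSpace ℝ (Fin n)}
    {P : Fin n → Fin n → ℝ} {Q : Fin n → Fin n → Fin n → ℝ} (hQ : ∀ c i j, Q c i j = Q c j i)
    {p : EuclideanSpace ℝ (Fin n) × ℝ} (hy : quadMap y P Q p.1 ∈ (extChartAt (𝓡 n) c).target)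
    (hJ : (quadJac P Q p.1).det ≠ 0)
    (hv : DifferentiableAt ℝ (chartFun v c) (quadMapT y P Q p))
    (hv' : MDifferentiableAt (𝓡 n) 𝓘(ℝ, ℝ) (fun x => v x p.2)
      ((extChartAt (𝓡 n) c).symm (quadMap y P Q p.1))) :
    gradN (fun p => chartFun v c (quadMapT y P Q p)) p ⬝ᵥ
        ((pullForm (chartForm g.inner c) y P Q p.1)⁻¹ *ᵥ
          gradN (fun p => chartFun v c (quadMapT y P Q p)) p) =
      gradNorm g (fun x => v x p.2) ((extChartAt (𝓡 n) c).symm (quadMap y P Q p.1)) ^ 2 := by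
  have hx := symm_mem_source c hy
  have hr := (extChartAt (𝓡 n) c).right_inv hy
  rw [gradN_dotProduct_comp_quadMapT hQ hv hJ, gradNorm_sq g hx hv', dCoord_eq_gradN (by
    rw [hr]; exact hv), hr]
  rfl

/-- The test function is invariant under coordinate changes, so a global maximum at an interior time
is a local maximum in normal coordinates, where the local construction applies. -/
theorem IsAdmissibleSolution.exists_maximumJet (hkn : k + 1 ≤ n)
    (hA_symm : ∀ (x : M) (v w : TangentSpace (𝓡 n) x), A x v w = A x w v)
    (hx₀ : x₀ ∈ (chartAt (EuclideanSpace ℝ (Fin n)) c).source) {C : ℝ} (hC : 0 ≤ C)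
    (hN : ∀ P : Fin n → Fin n → ℝ, (Matrix.of P)ᵀ *
        chartForm g.inner c (extChartAt (𝓡 n) c x₀) * Matrix.of P = 1 →
      NormalData (fun z => (pullForm (chartForm g.inner c) (extChartAt (𝓡 n) c x₀) P
          (normalQ (chartForm g.inner c) (extChartAt (𝓡 n) c x₀) P) z)⁻¹)
        (pullConn (chr (chartForm g.inner c)) (extChartAt (𝓡 n) c x₀) P
          (normalQ (chartForm g.inner c) (extChartAt (𝓡 n) c x₀) P))
        (pullForm (chartForm A c) (extChartAt (𝓡 n) c x₀) P
          (normalQ (chartForm g.inner c) (extChartAt (𝓡 n) c x₀) P)) C)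
    (hψ : RegOn (n := n) ∞ ψ (Icc 0 1)) (hψpos : ∀ x, ∀ t ∈ Icc (0 : ℝ) 1, 0 < ψ x t)
    (sol : IsAdmissibleSolution g A s r γ (k + 1) ψ u₀ u₁ u) (ht₀ : t₀ ∈ Ioo (0 : ℝ) 1) {K : ℝ}
    (hK : gradNorm g (fun y => ψ y t₀ ^ (1 / (((k + 1 : ℕ) : ℝ) + 1))) x₀ ≤ K) {ε₀ L η : ℝ}
    (hmax : ∀ x, ∀ t ∈ Icc (0 : ℝ) 1,
      1 / 2 * gradNorm g (fun y => u y t) x ^ 2 * Real.exp (ε₀ * Real.exp (L * u x t) + η * t ^ 2) ≤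
      1 / 2 * gradNorm g (fun y => u y t₀) x₀ ^ 2 *
        Real.exp (ε₀ * Real.exp (L * u x₀ t₀) + η * t₀ ^ 2))
    (hgrad : 1 ≤ gradNorm g (fun y => u y t₀) x₀) :
    ∃ J : MaximumJet n k s r γ (ε₀ * L * Real.exp (L * u x₀ t₀))
        (L * (ε₀ * L * Real.exp (L * u x₀ t₀))) η ((n ^ 2 + 1) * C) K,
      J.q = gradNorm g (fun y => u y t₀) x₀ := by
  have hx₀' : x₀ ∈ (extChartAt (𝓡 n) c).source := by rwa [extChartAt_source]
  set y := extChartAt (𝓡 n) c x₀ with hy_def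
  have hy : y ∈ (extChartAt (𝓡 n) c).target := (extChartAt (𝓡 n) c).map_source hx₀'
  have hl : (extChartAt (𝓡 n) c).symm y = x₀ := (extChartAt (𝓡 n) c).left_inv hx₀'
  have ht₀' := Ioo_subset_Icc_self ht₀
  obtain ⟨P, l, hP, hdiag⟩ := sol.exists_diagonal_frame hkn hA_symm ht₀ hy
  set Q := normalQ (chartForm g.inner c) y P with hQ_def
  have hQ : ∀ c i j, Q c i j = Q c j i :=
    normalQ_symm (chartForm_symm g.inner g.symm c)
  obtain ⟨hS, hcone⟩ := hdiag Q hQ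
  set û : EuclideanSpace ℝ (Fin n) × ℝ → ℝ := fun p => chartFun u c (quadMapT y P Q p) with hû
  have hΦ : quadMapT y P Q (0, t₀) = (y, t₀) := by rw [quadMapT, quadMap_zero]
  have hdetP : (Matrix.of P).det ≠ 0 := det_ne_zero_of_normalized hP
  have htarget : ∀ᶠ z in 𝓝 (0 : EuclideanSpace ℝ (Fin n)),
      quadMap y P Q z ∈ (extChartAt (𝓡 n) c).target := by
    have hc : Filter.Tendsto (quadMap y P Q) (𝓝 0) (𝓝 y) := by
      have := (contDiff_quadMap (y := y) (P := P) (Q := Q) (m := 0)).continuous.tendsto 0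
      rwa [quadMap_zero] at this
    exact hc.eventually ((isOpen_extChartAt_target c).mem_nhds hy)
  have hJev : ∀ᶠ z in 𝓝 (0 : EuclideanSpace ℝ (Fin n)), (quadJac P Q z).det ≠ 0 := by
    have hc : ContinuousAt (fun z => (quadJac P Q z).det) 0 :=
      (contDiffAt_det (m := 0) fun i j => by
        simp only [quadJac, Matrix.of_apply]; fun_prop).continuousAt
    exact hc.eventually_ne (by rw [quadJac_zero]; exact hdetP)
  have hû3 : ContDiffAt ℝ 3 û (0, t₀) := by
    have h := sol.contDiffAt (c := c) ht₀ hy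
    rw [← hΦ] at h
    exact h.comp (0, t₀) contDiff_quadMapT.contDiffAt
  have hone : (pullForm (chartForm g.inner c) y P Q 0)⁻¹ = 1 := by
    rw [pullForm_zero, hP, inv_one]
  have hsq : ∀ v : M → ℝ → ℝ, DifferentiableAt ℝ (chartFun v c) (y, t₀) →
      MDifferentiableAt (𝓡 n) 𝓘(ℝ, ℝ) (fun x => v x t₀) x₀ →
      ∑ i, gradN (fun p => chartFun v c (quadMapT y P Q p)) (0, t₀) i ^ 2 =
        gradNorm g (fun x => v x t₀) x₀ ^ 2 := by
    intro v h1 h2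
    have h := gradN_dotProduct_eq_gradNorm_sq (g := g) (v := v) (c := c) (p := (0, t₀)) hQ
      (by simpa only [quadMap_zero] using hy) (by rw [quadJac_zero]; exact hdetP)
      (by rw [hΦ]; exact h1) (by simp only [quadMap_zero, hl]; exact h2)
    simp only [quadMap_zero, hl, hone, Matrix.one_mulVec] at h
    rw [← h, dotProduct]
    exact Finset.sum_congr rfl fun i _ => sq _
  have hgn : ∀ v x, 0 ≤ gradNorm g v x := fun v x => Real.sqrt_nonneg _
  have hugrad := hsq u ((sol.contDiffAt ht₀ hy).differentiableAt (by norm_num))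
    (sol.mdifferentiableAt x₀ ht₀')
  -- the root of the right-hand side
  set w : M → ℝ → ℝ := fun x t => ψ x t ^ (1 / (((k + 1 : ℕ) : ℝ) + 1)) with hw
  have hwC : ContDiffAt ℝ 1 (chartFun w c) (y, t₀) := by
    have h1 : ContDiffAt ℝ 1 (chartFun ψ c) (y, t₀) :=
      (contDiffAt_chartFun le_rfl hψ hy (Icc_mem_nhds ht₀.1 ht₀.2)).of_le (by norm_cast)
    exact h1.rpow_const_of_ne (hψpos _ _ ht₀').ne'
  have hwM : MDifferentiableAt (𝓡 n) 𝓘(ℝ, ℝ) (fun x => w x t₀) x₀ := by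
    have h1 : MDifferentiableAt (𝓡 n) 𝓘(ℝ, ℝ) (fun x => ψ x t₀) x₀ :=
      mdifferentiableAt_slice (J := Icc 0 1) (hψ.of_le (by norm_cast)) x₀ ht₀'
    have h2 : DifferentiableAt ℝ (fun τ : ℝ => τ ^ (1 / (((k + 1 : ℕ) : ℝ) + 1))) (ψ x₀ t₀) :=
      (Real.hasDerivAt_rpow_const (Or.inl (hψpos _ _ ht₀').ne')).differentiableAt
    exact MDifferentiableAt.comp (g := fun τ : ℝ => τ ^ (1 / (((k + 1 : ℕ) : ℝ) + 1))) x₀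
      h2.mdifferentiableAt h1
  have hwgrad := hsq w (hwC.differentiableAt one_ne_zero) hwM
  have hwd : DifferentiableAt ℝ (fun p => chartFun w c (quadMapT y P Q p)) (0, t₀) := by
    have h := hwC.differentiableAt one_ne_zero
    rw [← hΦ] at h
    exact h.comp (0, t₀) ((contDiff_quadMapT (m := 1)).contDiffAt.differentiableAt one_ne_zero)
  set f : EuclideanSpace ℝ (Fin n) → ℝ := fun z => chartFun w c (quadMapT y P Q (z, t₀)) with hf
  have hfd : DifferentiableAt ℝ f 0 :=
    DifferentiableAt.comp (g := fun p => chartFun w c (quadMapT y P Q p))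
      (f := fun z : EuclideanSpace ℝ (Fin n) => (z, t₀)) 0 hwd (by fun_prop)
  have hfi : ∀ i, fderiv ℝ f 0 (EuclideanSpace.single i 1) =
      gradN (fun p => chartFun w c (quadMapT y P Q p)) (0, t₀) i := fun i =>
    (dird_ex_eq_pd hwd i).symm
  have hu0 : û (0, t₀) = u x₀ t₀ := by
    rw [hû]; simp only [hΦ, chartFun, hl]
  obtain ⟨J, hJ⟩ := (hN P hP).exists_maximumJet (s := s) (r := r) (γ := γ) (K := K) (u := û)
    (t₀ := t₀) (l := l) (f := f) (ε₀ := ε₀) (L := L) (η := η)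
    (φ₁ := ε₀ * L * Real.exp (L * u x₀ t₀)) hkn hC hû3 (by
      have := ht₀.1; have := ht₀.2; nlinarith) (by
      rw [hû, dird_et_et_comp_quadMapT (by
        rw [hΦ]; exact (sol.contDiffAt ht₀ hy).of_le (by norm_num)), hΦ]
      exact (sol.equation_chart hkn ht₀ hy).1) hS hcone hfd
    (Real.rpow_pos_of_pos (hψpos _ _ ht₀') _) (by
      simp only [hfi, hwgrad]
      rw [Real.sqrt_sq (hgn _ _)]
      exact hK) (by
      filter_upwards [htarget, hJev] with z hz hJz
      have hUz : ContDiffAt ℝ 2 (chartFun u c) (quadMapT y P Q (z, t₀)) :=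
        (sol.contDiffAt ht₀ hz).of_le (by norm_num)
      rw [hû, dird_et_et_comp_quadMapT hUz, SN_comp_quadMapT hQ hUz hJz, sigma_conj _ _ _
        (Matrix.mul_nonsing_inv _ (isUnit_iff_ne_zero.2 hJz))]
      refine (sol.equation_chart hkn ht₀ hz).2.1.trans ?_
      have hpos := hψpos ((extChartAt (𝓡 n) c).symm (quadMap y P Q z)) t₀ ht₀'
      simp only [hf, hw, chartFun, quadMapT]
      rw [← Real.rpow_natCast, ← Real.rpow_mul hpos.le]
      push_cast
      -- The symmetric function has order k + 1, so the root of ψ is of order k + 2.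
      rw [show 1 / ((k : ℝ) + 1 + 1) * (k + 2) = 1 by field_simp; ring, Real.rpow_one]) (by
      rw [hû, hugrad]
      nlinarith) (by rw [hu0]) (by
      have hev : ∀ᶠ p in 𝓝 ((0 : EuclideanSpace ℝ (Fin n)), t₀),
          quadMap y P Q p.1 ∈ (extChartAt (𝓡 n) c).target ∧ (quadJac P Q p.1).det ≠ 0 ∧
          p.2 ∈ Ioo (0 : ℝ) 1 := by
        have h1 := (continuous_fst (X := EuclideanSpace ℝ (Fin n)) (Y := ℝ)).tendsto (0, t₀)
        have h2 := (continuous_snd (X := EuclideanSpace ℝ (Fin n)) (Y := ℝ)).tendsto (0, t₀)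
        filter_upwards [h1.eventually htarget, h1.eventually hJev,
          h2.eventually (Ioo_mem_nhds ht₀.1 ht₀.2)] with p a b c using ⟨a, b, c⟩
      have key : ∀ p : EuclideanSpace ℝ (Fin n) × ℝ,
          quadMap y P Q p.1 ∈ (extChartAt (𝓡 n) c).target → (quadJac P Q p.1).det ≠ 0 →
          p.2 ∈ Ioo (0 : ℝ) 1 → 1 / 2 * (gradN û p ⬝ᵥ
            ((pullForm (chartForm g.inner c) y P Q p.1)⁻¹ *ᵥ gradN û p)) *
            Real.exp (ε₀ * Real.exp (L * û p) + η * p.2 ^ 2) =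
          1 / 2 * gradNorm g (fun x => u x p.2)
            ((extChartAt (𝓡 n) c).symm (quadMap y P Q p.1)) ^ 2 *
            Real.exp (ε₀ * Real.exp (L * u ((extChartAt (𝓡 n) c).symm (quadMap y P Q p.1)) p.2) +
              η * p.2 ^ 2) := by
        intro p h1 h2 h3
        rw [hû, gradN_dotProduct_eq_gradNorm_sq hQ h1 h2
          ((sol.contDiffAt h3 h1).differentiableAt (by norm_num))
          (sol.mdifferentiableAt _ (Ioo_subset_Icc_self h3))]
        rfl
      filter_upwards [hev] with p hp
      rw [key p hp.1 hp.2.1 hp.2.2, key (0, t₀) hev.self_of_nhds.1 hev.self_of_nhds.2.1 ht₀]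
      simp only [quadMap_zero, hl]
      exact hmax _ _ (Ioo_subset_Icc_self hp.2.2))
  exact ⟨J, by rw [hJ, hû, hugrad, Real.sqrt_sq (hgn _ _)]⟩

end InteriorMaximum

/-! ### Constants uniform over the compact manifold. -/

section Uniform

variable {n : ℕ}

theorem NormalData.mono {H A : EuclideanSpace ℝ (Fin n) → Matrix (Fin n) (Fin n) ℝ}
    {Γ : Fin n → Fin n → Fin n → EuclideanSpace ℝ (Fin n) → ℝ} {C C' : ℝ}
    (h : NormalData H Γ A C) (hC : C ≤ C') : NormalData H Γ A C' where
  H_zero := h.H_zero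
  H_contDiffAt := h.H_contDiffAt
  H_fderiv := h.H_fderiv
  H_second i j m := (h.H_second i j m).trans hC
  Γ_zero := h.Γ_zero
  Γ_differentiableAt := h.Γ_differentiableAt
  Γ_fderiv m i j a := (h.Γ_fderiv m i j a).trans hC
  A_le i j := (h.A_le i j).trans hC
  A_differentiableAt := h.A_differentiableAt
  A_fderiv i j a := (h.A_fderiv i j a).trans hC

variable {M : Type*} [TopologicalSpace M] [ChartedSpace (EuclideanSpace ℝ (Fin n)) M]
  [IsManifold (𝓡 n) ∞ M]

/-- The chart at `c` provides normal coordinates at `x` with constants `C`, and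
`σ_k(g⁻¹ A) ≥ δ` at `x`. -/
structure GoodChart (g : RiemMetric n M) (A : TwoTensor n M) (k : ℕ) (C δ : ℝ) (c x : M) : Prop where
  mem_source : x ∈ (chartAt (EuclideanSpace ℝ (Fin n)) c).source
  normalData : ∀ P : Fin n → Fin n → ℝ, (Matrix.of P)ᵀ *
      chartForm g.inner c (extChartAt (𝓡 n) c x) * Matrix.of P = 1 →
    NormalData (fun z => (pullForm (chartForm g.inner c) (extChartAt (𝓡 n) c x) P
        (normalQ (chartForm g.inner c) (extChartAt (𝓡 n) c x) P) z)⁻¹)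
      (pullConn (chr (chartForm g.inner c)) (extChartAt (𝓡 n) c x) P
        (normalQ (chartForm g.inner c) (extChartAt (𝓡 n) c x) P))
      (pullForm (chartForm A c) (extChartAt (𝓡 n) c x) P
        (normalQ (chartForm g.inner c) (extChartAt (𝓡 n) c x) P)) C
  sigma_ge : δ ≤ sigma k ((tensorCoord g.inner c x)⁻¹ * tensorCoord A c x)

/-- Each point has a neighbourhood with its own constants, inside a small closed coordinate ball;
compactness keeps the maximum of finitely many C and the minimum of finitely many δ. -/
theorem exists_goodChart [CompactSpace M] (g : RiemMetric n M) {A : TwoTensor n M}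
    (hA : SmoothTwoTensor A) {k : ℕ} (hk : 1 ≤ k) (hkn : k ≤ n)
    (hA_gamma : ∀ c x : M, x ∈ (chartAt (EuclideanSpace ℝ (Fin n)) c).source →
      InGamma k ((tensorCoord g.inner c x)⁻¹ * tensorCoord A c x)) :
    ∃ C δ, 0 ≤ C ∧ 0 < δ ∧ ∀ x : M, ∃ c, GoodChart g A k C δ c x := by
  suffices h : ∃ C δ, 0 ≤ C ∧ 0 < δ ∧ ∀ x ∈ (univ : Set M), ∃ c, GoodChart g A k C δ c x by
    obtain ⟨C, δ, h1, h2, h3⟩ := h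
    exact ⟨C, δ, h1, h2, fun x => h3 x (mem_univ x)⟩
  refine isCompact_univ.induction_on
    (p := fun S : Set M => ∃ C δ, 0 ≤ C ∧ 0 < δ ∧ ∀ x ∈ S, ∃ c, GoodChart g A k C δ c x) ?_ ?_ ?_ ?_
  · exact ⟨0, 1, le_rfl, one_pos, fun x hx => hx.elim⟩
  · rintro S T hST ⟨C, δ, h1, h2, h3⟩
    exact ⟨C, δ, h1, h2, fun x hx => h3 x (hST hx)⟩
  · rintro S T ⟨C, δ, h1, h2, h3⟩ ⟨C', δ', h1', h2', h3'⟩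
    refine ⟨max C C', min δ δ', le_max_of_le_left h1, lt_min h2 h2', ?_⟩
    rintro x (hx | hx)
    · obtain ⟨c, hc⟩ := h3 x hx
      exact ⟨c, hc.1, fun P hP => (hc.2 P hP).mono (le_max_left _ _), (min_le_left _ _).trans hc.3⟩
    · obtain ⟨c, hc⟩ := h3' x hx
      exact ⟨c, hc.1, fun P hP => (hc.2 P hP).mono (le_max_right _ _), (min_le_right _ _).trans hc.3⟩
  · intro x _
    set y := extChartAt (𝓡 n) x x with hy_def
    have hy : y ∈ (extChartAt (𝓡 n) x).target := mem_extChartAt_target x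
    have hG : ∀ y' ∈ (extChartAt (𝓡 n) x).target, ∀ i j,
        ContDiffAt ℝ ∞ (fun y => chartForm g.inner x y i j) y' := fun y' hy' i j =>
      contDiffAt_chartForm (smoothTwoTensor_metric g) x hy' i j
    have hA' : ∀ y' ∈ (extChartAt (𝓡 n) x).target, ∀ i j,
        ContDiffAt ℝ ∞ (fun y => chartForm A x y i j) y' := fun y' hy' i j =>
      contDiffAt_chartForm hA x hy' i j
    have hdet : ∀ y' ∈ (extChartAt (𝓡 n) x).target, (chartForm g.inner x y').det ≠ 0 :=
      fun y' hy' => chartForm_det_ne_zero g hy'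
    set σ : EuclideanSpace ℝ (Fin n) → ℝ := fun y =>
      sigma k ((chartForm g.inner x y)⁻¹ * chartForm A x y) with hσ
    have hσc : ContinuousAt σ y :=
      (contDiff_sigma hkn (contDiffAt_matrix_mul (m := ∞)
        (contDiffAt_matrix_inv (hG y hy) (hdet y hy)) (hA' y hy))).continuousAt
    have hσ0 : 0 < σ y := hA_gamma x _ (symm_mem_source x hy) k hk le_rfl
    have hev : ∀ᶠ y' in 𝓝 y, y' ∈ (extChartAt (𝓡 n) x).target ∧ σ y / 2 < σ y' :=
      Filter.Eventually.and ((isOpen_extChartAt_target x).mem_nhds hy) (hσc.eventually_const_lt (half_lt_self hσ0))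
    obtain ⟨ρ, hρ, hball⟩ := Metric.nhds_basis_closedBall.eventually_iff.1 hev
    obtain ⟨C, hC, hND⟩ := exists_normalData (G := chartForm g.inner x) (A := chartForm A x)
      (isCompact_closedBall y ρ) (chartForm_symm g.inner g.symm x)
      (fun y' hy' => hG y' (hball hy').1) (fun y' hy' => hdet y' (hball hy').1)
      (fun y' hy' => hA' y' (hball hy').1)
    have hnhds : {x' | extChartAt (𝓡 n) x x' ∈ Metric.closedBall y ρ} ∩
        (chartAt (EuclideanSpace ℝ (Fin n)) x).source ∈ 𝓝 x :=
      Filter.inter_mem ((continuousAt_extChartAt x).preimage_mem_nhds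
        (Metric.closedBall_mem_nhds y hρ)) (chart_source_mem_nhds _ x)
    refine ⟨_, mem_nhdsWithin_of_mem_nhds hnhds, C, σ y / 2, hC, half_pos hσ0, ?_⟩
    rintro x' ⟨h1, h2⟩
    refine ⟨x, h2, hND _ h1, ?_⟩
    have := (hball h1).2.le
    rwa [show σ (extChartAt (𝓡 n) x x') = sigma k ((tensorCoord g.inner x x')⁻¹ *
      tensorCoord A x x') by simp only [hσ, chartForm_extChartAt _ h2]] at this

end Uniform

/-! ### Continuity of the gradient length up to the boundary times. -/

section Continuity

variable {n : ℕ} {M : Type*} [TopologicalSpace M] [ChartedSpace (EuclideanSpace ℝ (Fin n)) M]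
  [IsManifold (𝓡 n) ∞ M] {u : M → ℝ → ℝ}

theorem contDiffOn_chartFun {J : Set ℝ} (hu : RegOn (n := n) 1 u J) (c : M) :
    ContDiffOn ℝ 1 (chartFun u c) ((extChartAt (𝓡 n) c).target ×ˢ J) := by
  rw [← contMDiffOn_iff_contDiffOn]
  have h2 : ContMDiffOn 𝓘(ℝ, EuclideanSpace ℝ (Fin n) × ℝ) ((𝓡 n).prod 𝓘(ℝ, ℝ)) 1
      (fun p : EuclideanSpace ℝ (Fin n) × ℝ => ((extChartAt (𝓡 n) c).symm p.1, p.2))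
      ((extChartAt (𝓡 n) c).target ×ˢ J) := by
    refine ContMDiffOn.prodMk ?_ contDiffOn_snd.contMDiffOn
    exact ContMDiffOn.comp (g := (extChartAt (𝓡 n) c).symm) (t := (extChartAt (𝓡 n) c).target)
      (f := (Prod.fst : EuclideanSpace ℝ (Fin n) × ℝ → EuclideanSpace ℝ (Fin n)))
      ((contMDiffOn_extChartAt_symm (n := ∞) c).of_le (by norm_cast)) contDiffOn_fst.contMDiffOn
      (fun p hp => hp.1)
  exact hu.comp h2 (fun p hp => ⟨mem_univ _, hp.2⟩)

/-- The length of the gradient is continuous up to the boundary. -/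
theorem continuousOn_gradNorm_sq (g : RiemMetric n M) (hu : RegOn (n := n) 1 u (Icc 0 1)) :
    ContinuousOn (fun p : M × ℝ => gradNorm g (fun y => u y p.2) p.1 ^ 2) (univ ×ˢ Icc 0 1) := by
  rintro ⟨x, t⟩ hxt
  set T := (extChartAt (𝓡 n) x).target with hT
  have hTo : IsOpen T := isOpen_extChartAt_target x
  have hC := contDiffOn_chartFun hu x
  -- At t = 0 and t = 1 only one-sided regularity in time is available, so the continuous object is
  -- the derivative within the closed slab; its space components are the ordinary ones.
  have huniq : UniqueDiffOn ℝ (T ×ˢ Icc (0 : ℝ) 1) :=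
    hTo.uniqueDiffOn.prod (uniqueDiffOn_Icc zero_lt_one)
  have hD := hC.continuousOn_fderivWithin huniq le_rfl
  have hpd : ∀ y ∈ T, ∀ τ ∈ Icc (0 : ℝ) 1, ∀ i, pd i (fun y => chartFun u x (y, τ)) y =
      fderivWithin ℝ (chartFun u x) (T ×ˢ Icc (0 : ℝ) 1) (y, τ) (ex i) := by
    intro y hy τ hτ i
    have h1 := ((hC.differentiableOn one_ne_zero) (y, τ) ⟨hy, hτ⟩).hasFDerivWithinAt
    have h2 : HasFDerivWithinAt (fun y => chartFun u x (y, τ)) _ T y :=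
      HasFDerivWithinAt.comp (f := fun z => (z, τ)) (t := T ×ˢ Icc (0 : ℝ) 1) y h1
        (hasFDerivAt_prodMk_left y τ).hasFDerivWithinAt (fun z hz => ⟨hz, hτ⟩)
    rw [pd, (h2.hasFDerivAt (hTo.mem_nhds hy)).fderiv]
    rfl
  set v : EuclideanSpace ℝ (Fin n) × ℝ → Fin n → ℝ := fun p i =>
    fderivWithin ℝ (chartFun u x) (T ×ˢ Icc (0 : ℝ) 1) p (ex i) with hv
  have hvc : ∀ i, ContinuousOn (fun p => v p i) (T ×ˢ Icc (0 : ℝ) 1) := fun i =>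
    hD.clm_apply continuousOn_const
  have hNc : ContinuousOn (fun p => v p ⬝ᵥ ((chartForm g.inner x p.1)⁻¹ *ᵥ v p))
      (T ×ˢ Icc (0 : ℝ) 1) := by
    simp only [dotProduct, Matrix.mulVec]
    refine continuousOn_finsetSum _ fun i _ => (hvc i).mul
      (continuousOn_finsetSum _ fun j _ => ContinuousOn.mul ?_ (hvc j))
    have h : ContinuousOn (fun y => (chartForm g.inner x y)⁻¹ i j) T := fun y hy =>
      (contDiffAt_matrix_inv (fun i j => contDiffAt_chartForm (smoothTwoTensor_metric g) x hy i j)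
        (chartForm_det_ne_zero g hy) i j).continuousAt.continuousWithinAt
    exact h.comp continuousOn_fst (fun p hp => hp.1)
  have hx : x ∈ (chartAt (EuclideanSpace ℝ (Fin n)) x).source := mem_chart_source _ x
  have hφ : ContinuousWithinAt (fun p : M × ℝ => (extChartAt (𝓡 n) x p.1, p.2))
      ((chartAt (EuclideanSpace ℝ (Fin n)) x).source ×ˢ Icc 0 1) (x, t) :=
    ContinuousAt.continuousWithinAt (ContinuousAt.prodMk
      (ContinuousAt.comp (g := extChartAt (𝓡 n) x) (f := (Prod.fst : M × ℝ → M))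
        (continuousAt_extChartAt x) continuousAt_fst) continuousAt_snd)
  have hmap : MapsTo (fun p : M × ℝ => (extChartAt (𝓡 n) x p.1, p.2))
      ((chartAt (EuclideanSpace ℝ (Fin n)) x).source ×ˢ Icc 0 1) (T ×ˢ Icc 0 1) := fun p hp =>
    ⟨(extChartAt (𝓡 n) x).map_source (by rw [extChartAt_source]; exact hp.1), hp.2⟩
  have hcomp := ContinuousWithinAt.comp (x := (x, t))
    (f := fun p : M × ℝ => (extChartAt (𝓡 n) x p.1, p.2)) (hNc _ (hmap ⟨hx, hxt.2⟩)) hφ hmap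
  have heq : ∀ p ∈ (chartAt (EuclideanSpace ℝ (Fin n)) x).source ×ˢ Icc (0 : ℝ) 1,
      gradNorm g (fun y => u y p.2) p.1 ^ 2 =
      (fun p => v p ⬝ᵥ ((chartForm g.inner x p.1)⁻¹ *ᵥ v p)) (extChartAt (𝓡 n) x p.1, p.2) := by
    intro p hp
    rw [gradNorm_sq g hp.1 (mdifferentiableAt_slice hu p.1 hp.2)]
    have h1 : dCoord (fun y => u y p.2) x p.1 = v (extChartAt (𝓡 n) x p.1, p.2) := by
      funext i
      exact hpd _ (hmap hp).1 _ hp.2 i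
    simp only [h1, chartForm_extChartAt _ hp.1]
  refine ((hcomp.congr heq (heq (x, t) ⟨hx, hxt.2⟩)).mono_of_mem_nhdsWithin ?_)
  rw [nhdsWithin_prod_eq]
  exact Filter.prod_mem_prod (mem_nhdsWithin_of_mem_nhds (chart_source_mem_nhds _ x))
    self_mem_nhdsWithin

end Continuity

/-! ### The minimum of u + a t(1 - t). -/

section MinimumPrinciple

variable {n : ℕ} {H A : EuclideanSpace ℝ (Fin n) → Matrix (Fin n) (Fin n) ℝ}
  {Γ : Fin n → Fin n → Fin n → EuclideanSpace ℝ (Fin n) → ℝ}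
  {u : EuclideanSpace ℝ (Fin n) × ℝ → ℝ} {t₀ : ℝ}

theorem dird_toLp (F : EuclideanSpace ℝ (Fin n) × ℝ → ℝ) (z : Fin n → ℝ) :
    dird (WithLp.toLp 2 z, 0) F = fun p => ∑ i, z i * dird (ex i) F p := by
  funext p
  have e : ((WithLp.toLp 2 z, 0) : EuclideanSpace ℝ (Fin n) × ℝ) = ∑ i, z i • ex i := by
    apply Prod.ext
    · ext j; simp [ex, Prod.fst_sum, Pi.single_apply]
    · simp [ex, Prod.snd_sum]
  simp only [dird, e, map_sum, map_smul, smul_eq_mul]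

/-- First and second order conditions at a minimum of `u + a t (1 - t)`. -/
theorem minimum_conditions (hu : ContDiffAt ℝ 2 u (0, t₀)) {a : ℝ}
    (hmin : IsLocalMin (fun p : EuclideanSpace ℝ (Fin n) × ℝ => u p + a * (p.2 * (1 - p.2)))
      (0, t₀)) (v : EuclideanSpace ℝ (Fin n) × ℝ) :
    dird v u (0, t₀) + a * (1 - 2 * t₀) * v.2 = 0 ∧
      2 * a * v.2 ^ 2 ≤ dird v (dird v u) (0, t₀) := by
  have hline : IsLocalMax (fun τ : ℝ => (-1 : ℝ) * u ((0, t₀) + τ • v) +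
      (-a) * ((t₀ + τ * v.2) * ((1 - t₀) + τ * (-v.2)))) 0 := by
    have hc : ContinuousAt (fun τ : ℝ => ((0, t₀) + τ • v : EuclideanSpace ℝ (Fin n) × ℝ)) 0 := by
      fun_prop
    have h := IsLocalMin.comp_continuous (b := (0 : ℝ))
      (g := fun τ : ℝ => ((0, t₀) + τ • v : EuclideanSpace ℝ (Fin n) × ℝ))
      (by rw [zero_smul, add_zero]; exact hmin) hc
    have h2 := h.neg
    convert! h2 using 1
    funext τ
    simp
    ring
  have h := (((TwoJet.of_contDiffAt hu v).const_mul (-1)).add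
    (((TwoJet.affine t₀ v.2).mul (TwoJet.affine (1 - t₀) (-v.2))).const_mul (-a))).of_isLocalMax
      hline
  exact ⟨by linear_combination -h.1, by linarith [h.2]⟩

/-- At a minimum of `u + a t (1 - t)` the matrix `SN` dominates `A`. -/
theorem SN_ge_of_minimum (hu : ContDiffAt ℝ 2 u (0, t₀)) {a : ℝ} (ha : 0 < a)
    (hmin : IsLocalMin (fun p : EuclideanSpace ℝ (Fin n) × ℝ => u p + a * (p.2 * (1 - p.2)))
      (0, t₀)) (H0 : H 0 = 1) {s r γ : ℝ} (hγ : 0 ≤ γ) :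
    2 * a ≤ dird et (dird et u) (0, t₀) ∧
    ∀ z : Fin n → ℝ, z ⬝ᵥ (A 0 *ᵥ z) ≤ z ⬝ᵥ (SN H Γ A s r γ u (0, t₀) *ᵥ z) := by
  have hmc := minimum_conditions hu hmin
  have hutt : 2 * a ≤ dird et (dird et u) (0, t₀) := by
    have := (hmc et).2
    simpa [et] using this
  refine ⟨hutt, fun z => ?_⟩
  have hgrad : gradN u (0, t₀) = 0 := by
    funext i
    have := (hmc (ex i)).1
    simpa [ex, gradN] using this
  set utt := dird et (dird et u) (0, t₀) with hutt_def
  have hutt0 : 0 < utt := by linarith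
  set h : Matrix (Fin n) (Fin n) ℝ := Matrix.of fun i j => dird (ex i) (dird (ex j) u) (0, t₀)
    with hh
  set b := gradtN u (0, t₀) with hb
  have hquad : ∀ (z : Fin n → ℝ) (τ : ℝ),
      2 * a * τ ^ 2 ≤ z ⬝ᵥ (h *ᵥ z) + 2 * τ * (z ⬝ᵥ b) + τ ^ 2 * utt := by
    intro z τ
    have h1 := (hmc ((WithLp.toLp 2 z, 0) + τ • et)).2
    rw [dird_dird_add_smul hu] at h1
    have e1 : dird (WithLp.toLp 2 z, 0) (dird (WithLp.toLp 2 z, 0) u) (0, t₀) = z ⬝ᵥ (h *ᵥ z) := by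
      have e : ∀ i, dird (ex i) (dird (WithLp.toLp 2 z, 0) u) (0, t₀) =
          ∑ j, z j * dird (ex i) (dird (ex j) u) (0, t₀) := by
        intro i
        rw [dird_comm hu, dird_toLp]
        exact Finset.sum_congr rfl fun j _ => by rw [dird_comm hu]
      rw [dird_toLp]
      simp only [e, dotProduct, Matrix.mulVec, hh, Matrix.of_apply]
      exact Finset.sum_congr rfl fun i _ => by
        congr 1; exact Finset.sum_congr rfl fun j _ => mul_comm _ _
    have e2 : dird (WithLp.toLp 2 z, 0) (dird et u) (0, t₀) = z ⬝ᵥ b := by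
      rw [dird_toLp]; rfl
    have e3 : ((WithLp.toLp 2 z, 0) + τ • et : EuclideanSpace ℝ (Fin n) × ℝ).2 = τ := by simp [et]
    rw [e1, e2, e3] at h1
    exact h1
  have hnn : ∀ z : Fin n → ℝ, 0 ≤ z ⬝ᵥ (h *ᵥ z) := fun z => by simpa using hquad z 0
  have htr : 0 ≤ h.trace := Finset.sum_nonneg fun i _ => by
    simpa using hnn (Pi.single i 1)
  -- The value τ = -(z · b)/u_tt minimizes the quadratic in τ and yields the Schur complement.
  have hSchur : 0 ≤ z ⬝ᵥ (h *ᵥ z) - utt⁻¹ * (z ⬝ᵥ b) ^ 2 := by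
    have h1 := hquad z (-(z ⬝ᵥ b) / utt)
    have h2 : 0 ≤ 2 * a * (-(z ⬝ᵥ b) / utt) ^ 2 := by positivity
    have e : z ⬝ᵥ (h *ᵥ z) + 2 * (-(z ⬝ᵥ b) / utt) * (z ⬝ᵥ b) + (-(z ⬝ᵥ b) / utt) ^ 2 * utt =
        z ⬝ᵥ (h *ᵥ z) - utt⁻¹ * (z ⬝ᵥ b) ^ 2 := by field_simp; ring
    linarith
  -- The gradient vanishes at the minimum, so the connection plays no role there.
  have hess0 : hessN Γ u (0, t₀) = h := by
    ext i j
    have : ∀ m, dird (ex m) u (0, t₀) = 0 := fun m => congrFun hgrad m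
    simp [hessN, hh, this]
  have hSN : SN H Γ A s r γ u (0, t₀) =
      h + A 0 + (γ * h.trace) • 1 - utt⁻¹ • Matrix.vecMulVec b b := by
    rw [SN, WN, hgrad, hess0]
    simp [H0, ← hutt_def, ← hb]
  rw [hSN]
  have e : z ⬝ᵥ ((h + A 0 + (γ * h.trace) • 1 - utt⁻¹ • Matrix.vecMulVec b b) *ᵥ z) =
      z ⬝ᵥ (A 0 *ᵥ z) + (z ⬝ᵥ (h *ᵥ z) - utt⁻¹ * (z ⬝ᵥ b) ^ 2) + γ * h.trace * (z ⬝ᵥ z) := by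
    simp only [Matrix.sub_mulVec, Matrix.add_mulVec, Matrix.smul_mulVec, Matrix.one_mulVec,
      dotProduct_sub, dotProduct_add, dotProduct_smul, smul_eq_mul, Matrix.vecMulVec_mulVec]
    rw [dotProduct_comm b z]
    simp only [op_smul_eq_smul, smul_eq_mul]
    ring
  rw [e]
  have hzz : 0 ≤ z ⬝ᵥ z := Finset.sum_nonneg fun i _ => mul_self_nonneg _
  have := mul_nonneg (mul_nonneg hγ htr) hzz
  linarith

end MinimumPrinciple

/-! ### The sup bound for u. -/

section MaximumNorm

variable {n : ℕ} {M : Type*} [TopologicalSpace M] [ChartedSpace (EuclideanSpace ℝ (Fin n)) M]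
  [IsManifold (𝓡 n) ∞ M] {g : RiemMetric n M} {A : TwoTensor n M} {k : ℕ} {s r γ : ℝ}
  {ψ : M → ℝ → ℝ} {u₀ u₁ : M → ℝ} {u : M → ℝ → ℝ}

theorem IsAdmissibleSolution.continuousOn (sol : IsAdmissibleSolution g A s r γ k ψ u₀ u₁ u) :
    ContinuousOn (fun p : M × ℝ => u p.1 p.2) (univ ×ˢ Icc 0 1) :=
  sol.reg_closed.continuousOn

/-- Solutions are convex in time. -/
theorem IsAdmissibleSolution.le_of_boundary (sol : IsAdmissibleSolution g A s r γ k ψ u₀ u₁ u)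
    {B : ℝ} (h₀ : ∀ x, u₀ x ≤ B) (h₁ : ∀ x, u₁ x ≤ B) (x : M) {t : ℝ} (ht : t ∈ Icc (0 : ℝ) 1) :
    u x t ≤ B := by
  have hcont : ContinuousOn (u x) (Icc 0 1) :=
    sol.continuousOn.comp (f := fun τ : ℝ => (x, τ)) (by fun_prop) (fun τ hτ => ⟨mem_univ _, hτ⟩)
  have hconv : StrictConvexOn ℝ (Icc (0 : ℝ) 1) (u x) :=
    strictConvexOn_of_deriv2_pos (convex_Icc 0 1) hcont fun τ hτ => by
      rw [interior_Icc] at hτ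
      exact sol.dtt_pos τ hτ x
  have h := hconv.convexOn.le_max_of_mem_Icc (left_mem_Icc.2 zero_le_one)
    (right_mem_Icc.2 zero_le_one) ht
  rw [sol.initial, sol.final] at h
  exact h.trans (max_le (h₀ x) (h₁ x))

/-- The equation at an interior minimum of `u + a t (1 - t)`. -/
theorem IsAdmissibleSolution.rhs_ge_of_minimum (hkn : k ≤ n)
    (hA_symm : ∀ (x : M) (v w : TangentSpace (𝓡 n) x), A x v w = A x w v) (hγ : 0 ≤ γ)
    (sol : IsAdmissibleSolution g A s r γ k ψ u₀ u₁ u) {c x₀ : M}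
    (hx₀ : x₀ ∈ (chartAt (EuclideanSpace ℝ (Fin n)) c).source)
    (hA_gamma : InGamma k ((tensorCoord g.inner c x₀)⁻¹ * tensorCoord A c x₀)) {δ : ℝ}
    (hδ : 0 < δ) (hσ : δ ≤ sigma k ((tensorCoord g.inner c x₀)⁻¹ * tensorCoord A c x₀))
    {a : ℝ} (ha : 0 < a) {t₀ : ℝ} (ht₀ : t₀ ∈ Ioo (0 : ℝ) 1)
    (hmin : ∀ x, ∀ t ∈ Icc (0 : ℝ) 1, u x₀ t₀ + a * (t₀ * (1 - t₀)) ≤ u x t + a * (t * (1 - t))) :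
    2 * a * δ ≤ ψ x₀ t₀ := by
  have hx₀' : x₀ ∈ (extChartAt (𝓡 n) c).source := by rwa [extChartAt_source]
  set y := extChartAt (𝓡 n) c x₀ with hy_def
  have hy : y ∈ (extChartAt (𝓡 n) c).target := (extChartAt (𝓡 n) c).map_source hx₀'
  have hl : (extChartAt (𝓡 n) c).symm y = x₀ := (extChartAt (𝓡 n) c).left_inv hx₀'
  obtain ⟨P, l, hP, hdiag⟩ := sol.exists_diagonal_frame hkn hA_symm ht₀ hy
  -- A linear change of coordinates is enough, because neither derivatives of the metric nor the
  -- connection matter where ∇u = 0.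
  set Q : Fin n → Fin n → Fin n → ℝ := fun _ _ _ => 0 with hQ_def
  have hQ : ∀ c i j, Q c i j = Q c j i := fun _ _ _ => rfl
  obtain ⟨hS, -⟩ := hdiag Q hQ
  have hΦ : quadMapT y P Q (0, t₀) = (y, t₀) := by rw [quadMapT, quadMap_zero]
  have hdetP : (Matrix.of P).det ≠ 0 := det_ne_zero_of_normalized hP
  have hU2 : ContDiffAt ℝ 2 (chartFun u c) (quadMapT y P Q (0, t₀)) := by
    rw [hΦ]; exact (sol.contDiffAt ht₀ hy).of_le (by norm_num)
  have hlocal : IsLocalMin (fun p : EuclideanSpace ℝ (Fin n) × ℝ =>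
      chartFun u c (quadMapT y P Q p) + a * (p.2 * (1 - p.2))) (0, t₀) := by
    have h2 := (continuous_snd (X := EuclideanSpace ℝ (Fin n)) (Y := ℝ)).tendsto (0, t₀)
    filter_upwards [h2.eventually (Ioo_mem_nhds ht₀.1 ht₀.2)] with p hp
    rw [hΦ]
    simp only [chartFun, hl]
    exact hmin _ _ (Ioo_subset_Icc_self hp)
  have hone : (pullForm (chartForm g.inner c) y P Q 0)⁻¹ = 1 := by
    rw [pullForm_zero, hP, inv_one]
  obtain ⟨hutt, hge⟩ := SN_ge_of_minimum
    (H := fun z => (pullForm (chartForm g.inner c) y P Q z)⁻¹)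
    (Γ := pullConn (chr (chartForm g.inner c)) y P Q) (A := pullForm (chartForm A c) y P Q)
    (s := s) (r := r) (γ := γ) (u := fun p => chartFun u c (quadMapT y P Q p))
    (hU2.comp (0, t₀) contDiff_quadMapT.contDiffAt) ha hlocal hone hγ
  have hG : chartForm g.inner c y = tensorCoord g.inner c x₀ := chartForm_extChartAt _ hx₀
  have hAc : chartForm A c y = tensorCoord A c x₀ := chartForm_extChartAt _ hx₀
  have hPinv : (Matrix.of P)⁻¹ = (Matrix.of P)ᵀ * chartForm g.inner c y :=
    Matrix.inv_eq_left_inv hP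
  have hPP : Matrix.of P * (Matrix.of P)⁻¹ = 1 :=
    Matrix.mul_nonsing_inv _ (isUnit_iff_ne_zero.2 hdetP)
  have hA0 : pullForm (chartForm A c) y P Q 0 = (Matrix.of P)⁻¹ *
      ((tensorCoord g.inner c x₀)⁻¹ * tensorCoord A c x₀) * Matrix.of P := by
    rw [pullForm_zero, hPinv, hG, hAc, Matrix.mul_assoc (Matrix.of P)ᵀ (tensorCoord g.inner c x₀),
      Matrix.mul_nonsing_inv_cancel_left _ _ (isUnit_iff_ne_zero.2 (det_metric_ne_zero g hx₀))]
  have hAsymm : (pullForm (chartForm A c) y P Q 0)ᵀ = pullForm (chartForm A c) y P Q 0 := by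
    have h : (chartForm A c y)ᵀ = chartForm A c y := by
      ext i j; exact chartForm_symm A hA_symm c y j i
    rw [pullForm_zero, Matrix.transpose_mul, Matrix.transpose_mul, Matrix.transpose_transpose, h,
      Matrix.mul_assoc]
  have hAΓ : InGamma k (pullForm (chartForm A c) y P Q 0) := by
    rw [hA0]; exact hA_gamma.conj hPP
  have hmono := InGamma.sigma_mono hkn hAsymm (by rw [hS, Matrix.diagonal_transpose]) hAΓ hge
    (le_refl k)
  rw [hA0, sigma_conj _ _ _ hPP, SN_comp_quadMapT hQ hU2 (by rw [quadJac_zero]; exact hdetP),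
    quadJac_zero, sigma_conj _ _ _ hPP, hΦ] at hmono
  have heq := (sol.equation_chart hkn ht₀ hy).2.1
  rw [dird_et_et_comp_quadMapT hU2, hΦ] at hutt
  rw [hl] at heq
  rw [← heq]
  exact mul_le_mul hutt (hσ.trans hmono) hδ.le (by linarith)

/-- The upper bound on ψ excludes an interior minimum of u + a t(1 - t), so the minimum sits on the
boundary data; the barrier costs at most a because t(1 - t) ≤ 1. -/
theorem IsAdmissibleSolution.ge_of_boundary [CompactSpace M] (hkn : k ≤ n)
    (hA_symm : ∀ (x : M) (v w : TangentSpace (𝓡 n) x), A x v w = A x w v) (hγ : 0 ≤ γ)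
    (hA_gamma : ∀ c x : M, x ∈ (chartAt (EuclideanSpace ℝ (Fin n)) c).source →
      InGamma k ((tensorCoord g.inner c x)⁻¹ * tensorCoord A c x))
    (sol : IsAdmissibleSolution g A s r γ k ψ u₀ u₁ u) {C δ : ℝ} (hδ : 0 < δ)
    (hgood : ∀ x : M, ∃ c, GoodChart g A k C δ c x) {a : ℝ} (ha : 0 < a)
    (hψ : ∀ x, ∀ t ∈ Icc (0 : ℝ) 1, ψ x t < 2 * a * δ)
    {B : ℝ} (h₀ : ∀ x, -B ≤ u₀ x) (h₁ : ∀ x, -B ≤ u₁ x) (x : M) {t : ℝ}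
    (ht : t ∈ Icc (0 : ℝ) 1) : -B - a ≤ u x t := by
  have hcont : ContinuousOn (fun p : M × ℝ => u p.1 p.2 + a * (p.2 * (1 - p.2)))
      (univ ×ˢ Icc 0 1) := sol.continuousOn.add (by fun_prop)
  obtain ⟨⟨x₀, t₀⟩, hmem, hmin⟩ := (isCompact_univ.prod isCompact_Icc).exists_isMinOn
    ⟨(x, t), mem_univ _, ht⟩ hcont
  have hmin' : ∀ x, ∀ t ∈ Icc (0 : ℝ) 1,
      u x₀ t₀ + a * (t₀ * (1 - t₀)) ≤ u x t + a * (t * (1 - t)) := fun x t ht =>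
    hmin (show (x, t) ∈ univ ×ˢ Icc (0 : ℝ) 1 from ⟨mem_univ _, ht⟩)
  have hB : -B ≤ u x₀ t₀ + a * (t₀ * (1 - t₀)) := by
    rcases eq_or_lt_of_le hmem.2.1 with h | h0
    · simp only at h
      rw [← h, sol.initial]; simpa using h₀ x₀
    rcases eq_or_lt_of_le hmem.2.2 with h | h1
    · simp only at h
      rw [h, sol.final]; simpa using h₁ x₀
    obtain ⟨c, hc⟩ := hgood x₀
    have := sol.rhs_ge_of_minimum hkn hA_symm hγ hc.mem_source (hA_gamma c x₀ hc.mem_source) hδ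
      hc.sigma_ge ha ⟨h0, h1⟩ hmin'
    exact absurd (hψ x₀ t₀ hmem.2) (not_lt.2 this)
  have h := hB.trans (hmin' x t ht)
  have h2 : t * (1 - t) ≤ 1 := by nlinarith [ht.1, ht.2]
  nlinarith

end MaximumNorm

/-! ### From the maximum of the test function to the gradient bound. -/

section GradientBound

variable {n : ℕ} {M : Type*} [TopologicalSpace M] [ChartedSpace (EuclideanSpace ℝ (Fin n)) M]
  [IsManifold (𝓡 n) ∞ M] {g : RiemMetric n M} {A : TwoTensor n M} {k : ℕ} {s r γ : ℝ}
  {ψ : M → ℝ → ℝ} {u₀ u₁ : M → ℝ} {u : M → ℝ → ℝ}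

/-- A bound for the gradient at the maximum point of the test function bounds it everywhere. -/
theorem IsAdmissibleSolution.gradNorm_le_of_maximum [CompactSpace M]
    (sol : IsAdmissibleSolution g A s r γ k ψ u₀ u₁ u) {ε₀ L η B R : ℝ} (hε₀ : 0 ≤ ε₀) (hL : 0 ≤ L)
    (hη : 0 ≤ η) (hR : 0 ≤ R) (hub : ∀ x, ∀ t ∈ Icc (0 : ℝ) 1, u x t ≤ B)
    (h₀ : ∀ x, gradNorm g u₀ x ≤ R) (h₁ : ∀ x, gradNorm g u₁ x ≤ R)
    (hinterior : ∀ x₀, ∀ t₀ ∈ Ioo (0 : ℝ) 1, (∀ x, ∀ t ∈ Icc (0 : ℝ) 1,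
      1 / 2 * gradNorm g (fun y => u y t) x ^ 2 * Real.exp (ε₀ * Real.exp (L * u x t) + η * t ^ 2) ≤
      1 / 2 * gradNorm g (fun y => u y t₀) x₀ ^ 2 *
        Real.exp (ε₀ * Real.exp (L * u x₀ t₀) + η * t₀ ^ 2)) →
      gradNorm g (fun y => u y t₀) x₀ ≤ R) (x : M) {t : ℝ} (ht : t ∈ Icc (0 : ℝ) 1) :
    gradNorm g (fun y => u y t) x ≤ R * Real.exp (ε₀ * Real.exp (L * B) + η) := by
  set E : ℝ := Real.exp (ε₀ * Real.exp (L * B) + η) with hE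
  have hE1 : 1 ≤ E := Real.one_le_exp (by positivity)
  have hcont : ContinuousOn (fun p : M × ℝ => 1 / 2 * gradNorm g (fun y => u y p.2) p.1 ^ 2 *
      Real.exp (ε₀ * Real.exp (L * u p.1 p.2) + η * p.2 ^ 2)) (univ ×ˢ Icc 0 1) := by
    have h1 := continuousOn_gradNorm_sq g sol.reg_closed
    have h2 := sol.continuousOn
    refine (continuousOn_const.mul h1).mul (ContinuousOn.rexp ?_)
    exact (continuousOn_const.mul (continuousOn_const.mul h2).rexp).add (by fun_prop)
  obtain ⟨⟨x₀, t₀⟩, hmem, hmax⟩ := (isCompact_univ.prod isCompact_Icc).exists_isMaxOn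
    ⟨(x, t), mem_univ _, ht⟩ hcont
  replace hmem : t₀ ∈ Icc (0 : ℝ) 1 := hmem.2
  have hmax' : ∀ x, ∀ t ∈ Icc (0 : ℝ) 1, 1 / 2 * gradNorm g (fun y => u y t) x ^ 2 *
      Real.exp (ε₀ * Real.exp (L * u x t) + η * t ^ 2) ≤
      1 / 2 * gradNorm g (fun y => u y t₀) x₀ ^ 2 *
        Real.exp (ε₀ * Real.exp (L * u x₀ t₀) + η * t₀ ^ 2) := fun x t ht =>
    hmax (show (x, t) ∈ univ ×ˢ Icc (0 : ℝ) 1 from ⟨mem_univ _, ht⟩)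
  have hq₀ : gradNorm g (fun y => u y t₀) x₀ ≤ R := by
    rcases eq_or_lt_of_le hmem.1 with h | h0
    · rw [← h, show (fun y => u y 0) = u₀ from funext sol.initial]
      exact h₀ x₀
    rcases eq_or_lt_of_le hmem.2 with h | h1
    · rw [h, show (fun y => u y 1) = u₁ from funext sol.final]
      exact h₁ x₀
    exact hinterior x₀ t₀ ⟨h0, h1⟩ hmax'
  have hq₀' : 0 ≤ gradNorm g (fun y => u y t₀) x₀ := Real.sqrt_nonneg _
  have hle : Real.exp (ε₀ * Real.exp (L * u x₀ t₀) + η * t₀ ^ 2) ≤ E := by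
    refine Real.exp_le_exp.2 (add_le_add ?_ ?_)
    · exact mul_le_mul_of_nonneg_left
        (Real.exp_le_exp.2 (mul_le_mul_of_nonneg_left (hub x₀ t₀ hmem) hL)) hε₀
    · exact mul_le_of_le_one_right hη (pow_le_one₀ hmem.1 hmem.2)
  have hge : 1 ≤ Real.exp (ε₀ * Real.exp (L * u x t) + η * t ^ 2) :=
    Real.one_le_exp (by positivity)
  refine abs_le_of_sq_le_sq' ?_ (by positivity) |>.2
  calc gradNorm g (fun y => u y t) x ^ 2
      ≤ gradNorm g (fun y => u y t) x ^ 2 *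
        Real.exp (ε₀ * Real.exp (L * u x t) + η * t ^ 2) :=
        le_mul_of_one_le_right (sq_nonneg _) hge
    _ ≤ gradNorm g (fun y => u y t₀) x₀ ^ 2 *
        Real.exp (ε₀ * Real.exp (L * u x₀ t₀) + η * t₀ ^ 2) := by linarith [hmax' x t ht]
    _ ≤ R ^ 2 * E := by gcongr
    -- Squaring E ≥ 1 is wasteful but makes the bound a perfect square.
    _ ≤ R ^ 2 * E ^ 2 := by gcongr; exact le_self_pow₀ hE1 two_ne_zero
    _ = (R * E) ^ 2 := by ring

end GradientBound

end GurskyStreets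

theorem mainTheorem5 {n k : ℕ} (hn : 3 ≤ n) (hk : 1 ≤ k) (hkn : k ≤ n)
    {M : Type*} [TopologicalSpace M] [T2Space M] [CompactSpace M]
    [ChartedSpace (EuclideanSpace ℝ (Fin n)) M] [IsManifold (𝓡 n) ∞ M]
    (g : RiemMetric n M) (A : TwoTensor n M)
    (hA_symm : ∀ (x : M) (v w : TangentSpace (𝓡 n) x), A x v w = A x w v)
    (hA_smooth : SmoothTwoTensor A)
    (hA_gamma : ∀ c x : M, x ∈ (chartAt (EuclideanSpace ℝ (Fin n)) c).source →
      InGamma k ((tensorCoord g.inner c x)⁻¹ * tensorCoord A c x))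
    (s r γ : ℝ) (hγ : 0 ≤ γ) (hrγ : r ≠ 0 ∨ 0 < γ)
    (Kψ Kdψ K₀ K₁ : ℝ) :
    ∃ C : ℝ, 0 < C ∧
      ∀ (ψ : M → ℝ → ℝ) (u₀ u₁ : M → ℝ) (u : M → ℝ → ℝ),
        RegOn (n := n) ∞ ψ (Icc 0 1) →
        (∀ x, ∀ t ∈ Icc (0 : ℝ) 1, 0 < ψ x t) →
        ContMDiff (𝓡 n) 𝓘(ℝ, ℝ) ∞ u₀ →
        ContMDiff (𝓡 n) 𝓘(ℝ, ℝ) ∞ u₁ →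
        WInGamma g A s r γ k u₀ →
        WInGamma g A s r γ k u₁ →
        (∀ x, ∀ t ∈ Icc (0 : ℝ) 1, ψ x t ≤ Kψ) →
        (∀ x, ∀ t ∈ Icc (0 : ℝ) 1,
          gradNorm g (fun y => ψ y t ^ (1 / ((k : ℝ) + 1))) x ≤ Kdψ) →
        (∀ x, |u₀ x| ≤ K₀ ∧ gradNorm g u₀ x ≤ K₀) →
        (∀ x, |u₁ x| ≤ K₁ ∧ gradNorm g u₁ x ≤ K₁) →
        IsAdmissibleSolution g A s r γ k ψ u₀ u₁ u →
        ∀ x, ∀ t ∈ Icc (0 : ℝ) 1, gradNorm g (fun y => u y t) x ≤ C := by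
  -- Writing the order as k + 1 makes the derivatives of σ_{k+1} symmetric functions of order k.
  obtain ⟨k, rfl⟩ : ∃ j, k = j + 1 := ⟨k - 1, by omega⟩
  obtain ⟨C, δ, hC, hδ, hgood⟩ := exists_goodChart g hA_smooth hk hkn hA_gamma
  obtain ⟨Λ, ε, hΛ, hε, -, hbound⟩ := exists_bound_maximumJet hkn s r γ ((n ^ 2 + 1) * C)
    (max Kdψ 0) hγ hrγ (by positivity) (le_max_right _ _)
  -- Makes 2 a δ exceed sup ψ, as the lower barrier requires.
  set a : ℝ := (|Kψ| + 1) / δ with ha_def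
  have ha : 0 < a := by positivity
  have haδ : Kψ < 2 * a * δ := by
    have : a * δ = |Kψ| + 1 := div_mul_cancel₀ _ hδ.ne'
    nlinarith [le_abs_self Kψ, abs_nonneg Kψ]
  set B : ℝ := |K₀| + |K₁| + a with hB
  have hB0 : 0 ≤ B := by positivity
  -- The ratio φ''/φ' demanded by `quadratic_completion`.
  set L : ℝ := 2 * Λ + 2 with hL
  have hL0 : 0 < L := by positivity
  -- With |u| ≤ B this places φ'(u) = ε₀ L exp(Lu) between m = ε exp(-2LB) and ε. The sup bound must
  -- therefore come before the test function is chosen.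
  set ε₀ : ℝ := ε * Real.exp (-(L * B)) / L with hε₀
  have hε₀0 : 0 < ε₀ := by positivity
  set m : ℝ := ε * Real.exp (-(2 * (L * B))) with hm
  have hm0 : 0 < m := by positivity
  set η : ℝ := m / (8 * (Λ + 1)) with hη
  have hη0 : 0 < η := by positivity
  obtain ⟨Q, hQ, hJ⟩ := hbound m η hm0 hη0 (div_mul_cancel₀ _ (by positivity)).le
  set R : ℝ := |K₀| + |K₁| + Q with hR
  have hR1 : 1 ≤ R := by have := abs_nonneg K₀; have := abs_nonneg K₁; linarith
  refine ⟨R * Real.exp (ε₀ * Real.exp (L * B) + η), by positivity, ?_⟩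
  intro ψ u₀ u₁ u hψ hψpos _ _ _ _ hψK hdψ hu₀ hu₁ sol x t ht
  have hub : ∀ x, ∀ t ∈ Icc (0 : ℝ) 1, |u x t| ≤ B := fun x t ht => by
    have h0 : ∀ x, |u₀ x| ≤ |K₀| + |K₁| := fun x =>
      ((hu₀ x).1.trans (le_abs_self K₀)).trans (le_add_of_nonneg_right (abs_nonneg _))
    have h1 : ∀ x, |u₁ x| ≤ |K₀| + |K₁| := fun x =>
      ((hu₁ x).1.trans (le_abs_self K₁)).trans (le_add_of_nonneg_left (abs_nonneg _))
    refine abs_le.2 ⟨?_, ?_⟩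
    · have := sol.ge_of_boundary hkn hA_symm hγ hA_gamma hδ hgood ha
        (fun x t ht => (hψK x t ht).trans_lt haδ) (fun x => (abs_le.1 (h0 x)).1)
        (fun x => (abs_le.1 (h1 x)).1) x ht
      linarith
    · have := sol.le_of_boundary (fun x => (abs_le.1 (h0 x)).2) (fun x => (abs_le.1 (h1 x)).2) x ht
      linarith
  refine sol.gradNorm_le_of_maximum hε₀0.le hL0.le hη0.le (zero_le_one.trans hR1)
    (fun x t ht => (abs_le.1 (hub x t ht)).2) (fun x => ?_) (fun x => ?_) ?_ x ht
  · linarith [(hu₀ x).2, le_abs_self K₀, abs_nonneg K₁]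
  · linarith [(hu₁ x).2, le_abs_self K₁, abs_nonneg K₀]
  intro x₀ t₀ ht₀ hmax
  by_contra! hlt
  have ht₀' := Ioo_subset_Icc_self ht₀
  obtain ⟨c, hc⟩ := hgood x₀
  obtain ⟨J, hJq⟩ := sol.exists_maximumJet hkn hA_symm hc.mem_source hC hc.normalData hψ hψpos
    ht₀ ((hdψ x₀ t₀ ht₀').trans (le_max_left _ _)) hmax (hR1.trans hlt.le)
  have hφ : ε₀ * L * Real.exp (L * u x₀ t₀) = ε * Real.exp (-(L * B) + L * u x₀ t₀) := by
    rw [hε₀, div_mul_cancel₀ _ hL0.ne', mul_assoc, ← Real.exp_add]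
  have hu := abs_le.1 (hub x₀ t₀ ht₀')
  have hlower : m ≤ ε₀ * L * Real.exp (L * u x₀ t₀) := by
    rw [hφ, hm]
    exact mul_le_mul_of_nonneg_left (Real.exp_le_exp.2 (by nlinarith [hu.1])) hε.le
  have hupper : ε₀ * L * Real.exp (L * u x₀ t₀) ≤ ε := by
    rw [hφ]
    exact mul_le_of_le_one_right hε.le (Real.exp_le_one_iff.2 (by nlinarith [hu.2]))
  have := hJ _ hlower hupper J
  rw [hJq] at this
  linarith [abs_nonneg K₀, abs_nonneg K₁]
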